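/- **Setting.** Let $(X,\mathfrak M,\mu)$ be a measure space. A family $\mathcal B\subset\mathfrak M$, together with a choice of a hull $B^*\in\mathcal B$ for every $B\in\mathcal B$, is a *ball-basis with constant $\mathcal K$* if: (B1) $0<\mu(B)<\infty$ for $B\in\mathcal B$; (B2) any two points of $X$ lie in a common $B\in\mathcal B$; (B3) for every $E\in\mathfrak M$ and $\varepsilon>0$ there is a countable subfamily $\{B_k\}\subset\mathcal B$ with $\mu(E\bigtriangleup\bigcup_k B_k)<\varepsilon$; (B4) for every $B\in\mathcal B$, $\mu(B^*)\le\mathcal K\mu(B)$, and $A\subset B^*$ whenever $A\in\mathcal B$, $A\cap B\ne\varnothing$, $\mu(A)\le2\mu(B)$. Put $\langle f\rangle_B=\frac1{\mu(B)}\int_B|f|\,d\mu$ and $\langle f\rangle_B^*=\sup_{A\in\mathcal B,\,A\supset B}\langle f\rangle_A$. A collection $\mathcal S\subset\mathcal B$ is *$\gamma$-sparse* ($0<\gamma<1$) if there are pairwise disjoint measurable sets $E_B\subset B$ ($B\in\mathcal S$) with $\mu(E_B)\ge\gamma\mu(B)$; its sparse operator is $\mathcal A_{\mathcal S}f=\sum_{A\in\mathcal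 S}\langle f\rangle_A\mathbb 1_A$. An operator $T$ from $L^1(X)$ to the space of all (not necessarily measurable) real functions on $X$ is *subadditive* if $|T(\lambda f)(x)|=|\lambda|\,|Tf(x)|$ for $\lambda\in\mathbb R$ and $|T(f+g)(x)|\le|Tf(x)|+|Tg(x)|$, for all $x\in X$. A subadditive $T$ is a *bounded oscillation (BO) operator* with respect to $\mathcal B$ if $$\mathcal L_1=\sup_{B\in\mathcal B}\ \sup_{x,x'\in B,\ f\in L^1(X)}\frac{|T(f\mathbb 1_{X\setminus B^*})(x)-T(f\mathbb 1_{X\setminus B^*})(x')|}{\langle f\rangle_B^*}<\infty,$$ $$\mathcal L_2=\sup_{A\in\mathcal B,\ A^*\ne X}\ \inf_{B\in\mathcal B,\ B\supsetneq A}\ \sup_{x\in A,\ f\in L^1(X)}\frac{|T(f\mathbb 1_{B^*\setminus A^*})(x)|}{\langle f\rangle_{B^*}}<\infty .$$ It satisfies the *weak-$L^1$ inequality* if $\|T\|_{L^1\to L^{1,\infty}}=\sup_{t>0,\ f\in L^1(X)}t\,\mu^*\{|Tf|>t\}/\|f\|_{L^1}<\infty$, where $\mu^*$ is the outer measure of $\mu$.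 In these quotients $0/0=0$ and $a/0=\infty$ for $a>0$. For $1<p<\infty$, an *$A_p$ weight* is a measurable $w$ on $X$, positive and finite almost everywhere, with $$[w]_{A_p}=\sup_{B\in\mathcal B}\Big(\frac1{\mu(B)}\int_Bw\,d\mu\Big)\Big(\frac1{\mu(B)}\int_Bw^{-1/(p-1)}\,d\mu\Big)^{p-1}<\infty .$$ The $L^p(w)$ norm of a possibly non-measurable $g$ is $\big(p\int_0^\infty t^{p-1}w^*\{|g|>t\}\,dt\big)^{1/p}$, where $w^*$ is the outer measure of $w\,d\mu$. **Theorem.** For every $1<p<\infty$ and every $\mathcal K$ there is a constant $c(p,\mathcal K)$, depending on $p$ and $\mathcal K$ only, such that for every measure space $(X,\mathfrak M,\mu)$ with a ball-basis $\mathcal B$ with constant $\mathcal K$ and every $A_p$ weight $w$ the following hold. 1. For every $0<\gamma<1$ and every $\gamma$-sparse collection $\mathcal S\subset\mathcal B$, $$\|\mathcal A_{\mathcal S}\|_{L^p(w)\to L^p(w)}\le c(p,\mathcal K)\,\gamma^{-1}\,[w]_{A_p}^{\max\left\{\frac{p+2}{p(p-1)},\,\frac{3p-2}{p}\right\}} .$$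 2. For every BO operator $T$ with respect to $\mathcal B$ that satisfies the weak-$L^1$ inequality, $$\|T\|_{L^p(w)\to L^p(w)}\le c(p,\mathcal K)\,\big(\mathcal L_1+\mathcal L_2+\|T\|_{L^1\to L^{1,\infty}}\big)\,[w]_{A_p}^{\max\left\{\frac{p+2}{p(p-1)},\,\frac{3p-2}{p}\right\}},$$ where $\|T\|_{L^p(w)\to L^p(w)}$ is the supremum of $\|Tf\|_{L^p(w)}/\|f\|_{L^p(w)}$ over $f\in L^1(X)\cap L^p(w)$, the functions of $L^p(w)$ on which $T$ is defined. -/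

import Mathlib

open MeasureTheory Set
open scoped ENNReal NNReal

/-- `𝓑` is a ball-basis of the measure space `(X, μ)`, with `hull B` the chosen hull of the
ball `B`, and with constant `K`. -/
structure IsBallBasis {X : Type*} [MeasurableSpace X] (μ : Measure X) (K : ℝ≥0)
    (𝓑 : Set (Set X)) (hull : Set X → Set X) : Prop where
  measurableSet : ∀ B ∈ 𝓑, MeasurableSet B
  measure_pos : ∀ B ∈ 𝓑, 0 < μ B
  measure_lt_top : ∀ B ∈ 𝓑, μ B < ∞
  exists_ball : ∀ x y : X, ∃ B ∈ 𝓑, x ∈ B ∧ y ∈ B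
  approx : ∀ E : Set X, MeasurableSet E → ∀ ε : ℝ≥0∞, 0 < ε →
    ∃ 𝒞 : Set (Set X), 𝒞 ⊆ 𝓑 ∧ 𝒞.Countable ∧ μ (symmDiff E (⋃₀ 𝒞)) < ε
  hull_mem : ∀ B ∈ 𝓑, hull B ∈ 𝓑
  subset_hull : ∀ B ∈ 𝓑, ∀ A ∈ 𝓑, μ A ≤ 2 * μ B → (A ∩ B).Nonempty → A ⊆ hull B
  measure_hull_le : ∀ B ∈ 𝓑, μ (hull B) ≤ (K : ℝ≥0∞) * μ B

/-- The average `⟨f⟩_B` of `|f|` over `B`. -/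
noncomputable def ballAvg {X : Type*} [MeasurableSpace X] (μ : Measure X)
    (B : Set X) (f : X → ℝ) : ℝ≥0∞ :=
  (∫⁻ x in B, ‖f x‖ₑ ∂μ) / μ B

/-- `⟨f⟩*_B`, the supremum of the averages of `|f|` over the balls that contain `B`. -/
noncomputable def ballAvgSup {X : Type*} [MeasurableSpace X] (μ : Measure X)
    (𝓑 : Set (Set X)) (B : Set X) (f : X → ℝ) : ℝ≥0∞ :=
  ⨆ A ∈ 𝓑, ⨆ (_ : B ⊆ A), ballAvg μ A f

/-- `T : L¹(X) → L⁰(X)` is subadditive. Only the values of `T` at integrable functions are ever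
used; `T f` may be non-measurable. -/
structure IsSubadditiveOp {X : Type*} [MeasurableSpace X] (μ : Measure X)
    (T : (X → ℝ) → (X → ℝ)) : Prop where
  abs_smul : ∀ (c : ℝ) (f : X → ℝ), Integrable f μ → ∀ x, |T (c • f) x| = |c| * |T f x|
  abs_add_le : ∀ f g : X → ℝ, Integrable f μ → Integrable g μ →
    ∀ x, |T (f + g) x| ≤ |T f x| + |T g x|

/-- The least localization constant `L₁(T)`. -/
noncomputable def locConst {X : Type*} [MeasurableSpace X] (μ : Measure X)
    (𝓑 : Set (Set X)) (hull : Set X → Set X) (T : (X → ℝ) → (X → ℝ)) : ℝ≥0∞ :=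
  ⨆ B ∈ 𝓑, ⨆ x ∈ B, ⨆ x' ∈ B, ⨆ (f : X → ℝ) (_ : Integrable f μ),
    ‖T ((hull B)ᶜ.indicator f) x - T ((hull B)ᶜ.indicator f) x'‖ₑ / ballAvgSup μ 𝓑 B f

/-- The quantity `Δ_T(A, B)` for balls `A ⊆ B`. -/
noncomputable def connDelta {X : Type*} [MeasurableSpace X] (μ : Measure X)
    (hull : Set X → Set X) (T : (X → ℝ) → (X → ℝ)) (A B : Set X) : ℝ≥0∞ :=
  ⨆ x ∈ A, ⨆ (f : X → ℝ) (_ : Integrable f μ),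
    ‖T ((hull B \ hull A).indicator f) x‖ₑ / ballAvg μ (hull B) f

/-- The least connectivity constant `L₂(T)`: every ball `A` with `hull A ≠ X` has a ball
`B ⊋ A` with `Δ_T(A, B)` bounded by it. -/
noncomputable def connConst {X : Type*} [MeasurableSpace X] (μ : Measure X)
    (𝓑 : Set (Set X)) (hull : Set X → Set X) (T : (X → ℝ) → (X → ℝ)) : ℝ≥0∞ :=
  ⨆ A ∈ 𝓑, ⨆ (_ : hull A ≠ univ), ⨅ B ∈ 𝓑, ⨅ (_ : A ⊂ B), connDelta μ hull T A B

/-- `T` is a bounded oscillation operator with respect to the ball-basis `𝓑`. -/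
structure IsBO {X : Type*} [MeasurableSpace X] (μ : Measure X)
    (𝓑 : Set (Set X)) (hull : Set X → Set X) (T : (X → ℝ) → (X → ℝ)) : Prop where
  subadditive : IsSubadditiveOp μ T
  localization : locConst μ 𝓑 hull T < ∞
  connectivity : connConst μ 𝓑 hull T < ∞

/-- `‖T‖_{L¹ → L^{1,∞}}`. A Mathlib measure takes the value of the outer measure at a
non-measurable set. -/
noncomputable def weakOneNorm {X : Type*} [MeasurableSpace X] (μ : Measure X)
    (T : (X → ℝ) → (X → ℝ)) : ℝ≥0∞ :=
  ⨆ (t : ℝ) (_ : 0 < t) (f : X → ℝ) (_ : Integrable f μ),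
    ENNReal.ofReal t * μ {x | t < |T f x|} / ∫⁻ x, ‖f x‖ₑ ∂μ

/-- `𝓢` is a `γ`-sparse collection of balls. -/
def IsSparse {X : Type*} [MeasurableSpace X] (μ : Measure X)
    (𝓑 : Set (Set X)) (γ : ℝ) (𝓢 : Set (Set X)) : Prop :=
  𝓢 ⊆ 𝓑 ∧ ∃ E : Set X → Set X,
    (∀ B ∈ 𝓢, MeasurableSet (E B) ∧ E B ⊆ B ∧ ENNReal.ofReal γ * μ B ≤ μ (E B)) ∧
    𝓢.PairwiseDisjoint E

/-- The sparse operator `A_𝓢 f = ∑_{A ∈ 𝓢} ⟨f⟩_A 𝟙_A`. -/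
noncomputable def sparseOp {X : Type*} [MeasurableSpace X] (μ : Measure X)
    (𝓢 : Set (Set X)) (f : X → ℝ) (x : X) : ℝ≥0∞ :=
  ∑' A : 𝓢, (A : Set X).indicator (fun _ => ballAvg μ (A : Set X) f) x

/-- The characteristic `[w]_{A_p}` with respect to `𝓑`. -/
noncomputable def apConst {X : Type*} [MeasurableSpace X] (μ : Measure X)
    (𝓑 : Set (Set X)) (p : ℝ) (w : X → ℝ≥0∞) : ℝ≥0∞ :=
  ⨆ B ∈ 𝓑, ((∫⁻ x in B, w x ∂μ) / μ B) *
    ((∫⁻ x in B, (w x) ^ (-1 / (p - 1)) ∂μ) / μ B) ^ (p - 1)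

/-- `w` is a weight (measurable, positive and finite almost everywhere) of class `A_p`. -/
structure IsApWeight {X : Type*} [MeasurableSpace X] (μ : Measure X)
    (𝓑 : Set (Set X)) (p : ℝ) (w : X → ℝ≥0∞) : Prop where
  aemeasurable : AEMeasurable w μ
  pos_lt_top : ∀ᵐ x ∂μ, 0 < w x ∧ w x < ∞
  apConst_lt_top : apConst μ 𝓑 p w < ∞

/-- The `L^p(ν)` norm of a non-negative, possibly non-measurable function, through its (outer)
distribution function. -/
noncomputable def outerLpNorm {X : Type*} [MeasurableSpace X] (ν : Measure X)
    (p : ℝ) (g : X → ℝ≥0∞) : ℝ≥0∞ :=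
  (ENNReal.ofReal p * ∫⁻ t in Ioi (0 : ℝ),
    ENNReal.ofReal (t ^ (p - 1)) * ν {x | ENNReal.ofReal t < g x}) ^ (1 / p)

/-- The `L^p(ν) → L^p(ν)` norm of (the absolute value `U` of) an operator with domain `D`. -/
noncomputable def opLpNorm {X : Type*} [MeasurableSpace X] (ν : Measure X)
    (p : ℝ) (D : Set (X → ℝ)) (U : (X → ℝ) → (X → ℝ≥0∞)) : ℝ≥0∞ :=
  ⨆ f ∈ D, ⨆ (_ : MemLp f (ENNReal.ofReal p) ν),
    outerLpNorm ν p (U f) / eLpNorm f (ENNReal.ofReal p) ν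

/-! Both parts rest on one weighted bound for sparse sums, with the power $[w]_{A_p}^{p/(p-1)}$.
Hölder's inequality on a ball gives $[w]_{A_p}\ge1$, and $p/(p-1)$ is at most the stated maximum
(equal to it at $p=2$), so the power may be enlarged.

Weighted bound. In a sparse sum the measure of each ball is traded for that of its disjoint part, so
the form $\int(\mathcal A_{\mathcal S}\varphi)\psi$ is at most a constant times $\int
M\varphi\,M\psi$. Hölder's inequality and Buckley's theorem on $L^p(w)$ and on the dual space
$L^{p'}(\sigma)$, $\sigma=w^{-1/(p-1)}$, contribute the powers $1/(p-1)$ and $1$ of $[w]_{A_p}$.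
Buckley's theorem follows from
$(M\varphi)^{p-1}\le[w]_{A_p}K^pM_w\big((M_\sigma(\varphi/\sigma)\,\sigma)^{p-1}\big)$, where $M_w$
and $M_\sigma$ divide by the weighted mass of the hull. With that normalization Vitali's lemma gives
weak type $(1,1)$ for every measure, doubling or not (`lintegral_hullMax_rpow_le`).

Sparse domination (`exists_sparse_domination`). The exceptional set of a ball $A$ is where
$T(f\mathbb 1_{A^{***}})$ or the maximal function of $f\mathbb 1_{A^{***}}$ is large against
$\langle f\rangle_{A^{***}}$; it fills a small proportion of $A$. From a starting ball, balls at
least half inside an exceptional set are selected greedily, each of nearly maximal measure. Almost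
every point of the first hull lies in the hull of some selected ball and outside its exceptional
set, where $T$ of the localized function is controlled. A step from parent to child costs a multiple
of the parent's average: near-maximality leaves good points in every strictly larger ball,
connectivity supplies such a ball with control of the annulus, and localization carries the
estimates from good points to all points. Children are much smaller than parents, so the later balls
meeting a given ball have at most half its measure: the family is sparse.

Finally, balls whose hulls exhaust $X$ make the domination global, by continuity of outer measure
along increasing sets. -/

/-! ### Geometry of ball-bases. -/

namespace IsBallBasis

variable {X : Type*} [MeasurableSpace X] {μ : Measure X} {K : ℝ≥0} {𝓑 : Set (Set X)}
  {hull : Set X → Set X}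

theorem nonempty (h : IsBallBasis μ K 𝓑 hull) {B : Set X} (hB : B ∈ 𝓑) : B.Nonempty :=
  nonempty_of_measure_ne_zero (h.measure_pos B hB).ne'

theorem self_subset_hull (h : IsBallBasis μ K 𝓑 hull) {B : Set X} (hB : B ∈ 𝓑) : B ⊆ hull B :=
  h.subset_hull B hB B hB (by rw [two_mul]; exact le_self_add)
    (by rw [inter_self]; exact h.nonempty hB)

theorem one_le_const (h : IsBallBasis μ K 𝓑 hull) {B : Set X} (hB : B ∈ 𝓑) :
    (1 : ℝ≥0∞) ≤ K := by
  have h1 : μ B * 1 ≤ μ B * K := by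
    rw [mul_one, mul_comm]
    exact (measure_mono (h.self_subset_hull hB)).trans (h.measure_hull_le B hB)
  exact (ENNReal.mul_le_mul_iff_right (h.measure_pos B hB).ne' (h.measure_lt_top B hB).ne).1 h1

theorem iterate_hull_mem (h : IsBallBasis μ K 𝓑 hull) {B : Set X} (hB : B ∈ 𝓑) (k : ℕ) :
    hull^[k] B ∈ 𝓑 := by
  induction k with
  | zero => exact hB
  | succ k ih => rw [Function.iterate_succ_apply']; exact h.hull_mem _ ih

theorem measure_iterate_hull_le (h : IsBallBasis μ K 𝓑 hull) {B : Set X} (hB : B ∈ 𝓑) (k : ℕ) :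
    μ (hull^[k] B) ≤ (K : ℝ≥0∞) ^ k * μ B := by
  induction k with
  | zero => simp
  | succ k ih =>
    rw [Function.iterate_succ_apply', pow_succ', mul_assoc]
    exact (h.measure_hull_le _ (h.iterate_hull_mem hB k)).trans (by gcongr)

theorem subset_iterate_hull (h : IsBallBasis μ K 𝓑 hull) {A : Set X} (hA : A ∈ 𝓑) (k : ℕ) :
    A ⊆ hull^[k] A := by
  induction k with
  | zero => exact Subset.rfl
  | succ k ih =>
    rw [Function.iterate_succ_apply']
    exact ih.trans (h.self_subset_hull (h.iterate_hull_mem hA k))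

/-- Two intersecting balls: the larger of the two hulls contains both balls. -/
theorem subset_hull_of_measure_le (h : IsBallBasis μ K 𝓑 hull) {A B : Set X} (hA : A ∈ 𝓑)
    (hB : B ∈ 𝓑) (hAB : (A ∩ B).Nonempty) (hμ : μ A ≤ μ B) : A ⊆ hull B :=
  h.subset_hull B hB A hA (hμ.trans (by rw [two_mul]; exact le_self_add)) hAB

/-- Approximation of $X$ itself with errors tending to $0$ covers all but a null set by countably
many balls. -/
theorem sigmaFinite (h : IsBallBasis μ K 𝓑 hull) : SigmaFinite μ := by
  have h1 : ∀ n : ℕ, ∃ 𝒞 : Set (Set X), 𝒞 ⊆ 𝓑 ∧ 𝒞.Countable ∧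
      μ (symmDiff univ (⋃₀ 𝒞)) < ((n : ℝ≥0∞) + 1)⁻¹ := fun n =>
    h.approx univ MeasurableSet.univ _ (by simp)
  choose 𝒞 hsub hcount hlt using h1
  set U : Set X := ⋃ n, ⋃₀ 𝒞 n with hU
  have hU0 : μ Uᶜ = 0 := by
    refine le_antisymm (ENNReal.le_of_forall_pos_le_add fun ε hε _ => ?_) bot_le
    obtain ⟨n, hn⟩ := ENNReal.exists_inv_nat_lt (a := (ε : ℝ≥0∞)) (by simpa using hε.ne')
    rw [zero_add]
    calc μ Uᶜ ≤ μ (symmDiff univ (⋃₀ 𝒞 n)) := by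
          refine measure_mono fun x hx => Or.inl ⟨trivial, fun hx' => hx ?_⟩
          exact mem_iUnion.2 ⟨n, hx'⟩
      _ ≤ ((n : ℝ≥0∞) + 1)⁻¹ := (hlt n).le
      _ ≤ (n : ℝ≥0∞)⁻¹ := by gcongr; exact le_self_add
      _ ≤ ε := hn.le
  refine Measure.sigmaFinite_of_countable (S := insert Uᶜ (⋃ n, 𝒞 n))
    ((countable_iUnion hcount).insert _) ?_ ?_
  · rintro s (rfl | hs)
    · simp [hU0]
    · obtain ⟨n, hn⟩ := mem_iUnion.1 hs
      exact h.measure_lt_top s (hsub n hn)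
  · refine eq_univ_of_forall fun x => ?_
    by_cases hx : x ∈ U
    · obtain ⟨n, s, hs, hxs⟩ := mem_iUnion.1 hx
      exact ⟨s, Or.inr (mem_iUnion.2 ⟨n, hs⟩), hxs⟩
    · exact ⟨Uᶜ, Or.inl rfl, hx⟩

theorem countable_of_pairwiseDisjoint (h : IsBallBasis μ K 𝓑 hull) {ι : Type*} {s : Set ι}
    {E : ι → Set X} (hm : ∀ i ∈ s, MeasurableSet (E i)) (hpos : ∀ i ∈ s, 0 < μ (E i))
    (hd : s.PairwiseDisjoint E) : s.Countable := by
  have := h.sigmaFinite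
  have h1 := Measure.countable_meas_pos_of_disjoint_iUnion (μ := μ) (As := fun i : s => E i)
    (fun i => hm i i.2) (fun i j hij => hd i.2 j.2 (fun h => hij (Subtype.ext h)))
  have h2 : {i : s | 0 < μ (E i)} = univ := eq_univ_of_forall fun i => hpos i i.2
  rw [h2] at h1
  exact countable_coe_iff.1 (countable_univ_iff.1 h1)

/-- Vitali's covering lemma in a ball-basis. -/
theorem exists_disjoint_cover (h : IsBallBasis μ K 𝓑 hull) {ι : Type*} (A : ι → Set X)
    (s : Set ι) (hs : ∀ i ∈ s, A i ∈ 𝓑) {M : ℝ≥0∞} (hM : M ≠ ∞) (hsM : ∀ i ∈ s, μ (A i) ≤ M) :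
    ∃ u ⊆ s, u.Countable ∧ u.PairwiseDisjoint A ∧ (⋃ i ∈ s, A i) ⊆ ⋃ i ∈ u, hull (A i) := by
  -- The ratio 2 is the one in the hull axiom, so hulls serve as the enlargements of the selected
  -- balls.
  obtain ⟨u, hus, hd, hcov⟩ := Vitali.exists_disjoint_subfamily_covering_enlargement A s
    (fun i => (μ (A i)).toReal) 2 one_lt_two (fun _ _ => ENNReal.toReal_nonneg) M.toReal
    (fun i hi => ENNReal.toReal_mono hM (hsM i hi)) (fun i hi => h.nonempty (hs i hi))
  refine ⟨u, hus, h.countable_of_pairwiseDisjoint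
    (fun i hi => h.measurableSet _ (hs i (hus hi)))
    (fun i hi => h.measure_pos _ (hs i (hus hi))) hd, hd, ?_⟩
  refine iUnion₂_subset fun i hi => ?_
  obtain ⟨j, hj, hij, hle⟩ := hcov i hi
  refine (h.subset_hull _ (hs j (hus hj)) _ (hs i hi) ?_ hij).trans
    (subset_biUnion_of_mem (u := fun i => hull (A i)) hj)
  have h1 := ENNReal.ofReal_le_ofReal hle
  rwa [ENNReal.ofReal_mul zero_le_two, ENNReal.ofReal_toReal (h.measure_lt_top _ (hs i hi)).ne,
    ENNReal.ofReal_toReal (h.measure_lt_top _ (hs j (hus hj))).ne, ENNReal.ofReal_ofNat] at h1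

/-- If each ball of a family satisfies `μ B ≤ ρ B` for a measure `ρ`, then the union of the family
has measure at most `K * ρ (⋃ B)`. -/
theorem measure_biUnion_le_of_forall_le (h : IsBallBasis μ K 𝓑 hull) {ι : Type*} (A : ι → Set X)
    (s : Set ι) (hs : ∀ i ∈ s, A i ∈ 𝓑) {M : ℝ≥0∞} (hM : M ≠ ∞) (hsM : ∀ i ∈ s, μ (A i) ≤ M)
    (ρ : Measure X) (hρ : ∀ i ∈ s, μ (A i) ≤ ρ (A i)) :
    μ (⋃ i ∈ s, A i) ≤ K * ρ (⋃ i ∈ s, A i) := by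
  obtain ⟨u, hus, hc, hd, hcov⟩ := h.exists_disjoint_cover A s hs hM hsM
  calc μ (⋃ i ∈ s, A i) ≤ μ (⋃ i ∈ u, hull (A i)) := measure_mono hcov
    _ ≤ ∑' i : u, μ (hull (A i)) := measure_biUnion_le _ hc _
    _ ≤ ∑' i : u, K * ρ (A i) := ENNReal.tsum_le_tsum fun i =>
        (h.measure_hull_le _ (hs i (hus i.2))).trans (mul_le_mul_right (hρ i (hus i.2)) _)
    _ = K * ρ (⋃ i ∈ u, A i) := by
        rw [ENNReal.tsum_mul_left, measure_biUnion hc hd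
          fun i hi => h.measurableSet _ (hs i (hus hi))]
    _ ≤ K * ρ (⋃ i ∈ s, A i) :=
        mul_le_mul_right (measure_mono (biUnion_subset_biUnion_left hus)) _

/-- Almost every point of a measurable set `E` lies in a ball at least half of which is
in `E`. -/
theorem ae_exists_density_ball (h : IsBallBasis μ K 𝓑 hull) {E : Set X} (hE : MeasurableSet E) :
    ∀ᵐ x ∂μ, x ∈ E → ∃ B ∈ 𝓑, x ∈ B ∧ μ B ≤ 2 * μ (B ∩ E) := by
  set F : Set X := {x | ¬ (x ∈ E → ∃ B ∈ 𝓑, x ∈ B ∧ μ B ≤ 2 * μ (B ∩ E))} with hF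
  change μ F = 0
  -- Take a countable family approximating $E$ up to $\delta$. A bad point of $E$ is either not
  -- covered, or in a ball with at least half its measure outside $E$; by Vitali such balls have a
  -- union of measure at most $2K\delta$.
  have key : ∀ δ : ℝ≥0, 0 < δ → μ F ≤ δ + K * (2 * δ) := by
    intro δ hδ
    obtain ⟨𝒞, hsub, hc, hlt⟩ := h.approx E hE δ (by simpa using hδ)
    set s : Set (Set X) := {B ∈ 𝒞 | ¬ μ B ≤ 2 * μ (B ∩ E)}
    have hhalf : ∀ B ∈ s, μ B ≤ ((2 : ℝ≥0∞) • μ.restrict Eᶜ) B := by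
      intro B hB
      have hBm := h.measurableSet B (hsub hB.1)
      rw [Measure.smul_apply, Measure.restrict_apply hBm, smul_eq_mul]
      have h1 : μ B = μ (B ∩ E) + μ (B ∩ Eᶜ) := by
        rw [← sdiff_eq_compl_inter.trans (inter_comm _ _), measure_inter_add_sdiff B hE]
      have h2 : 2 * μ (B ∩ E) ≤ μ B := (not_le.1 hB.2).le
      have h3 : μ (B ∩ E) ≠ ∞ :=
        ((measure_mono inter_subset_left).trans_lt (h.measure_lt_top B (hsub hB.1))).ne
      rw [h1, two_mul] at h2
      rw [h1, two_mul]
      exact add_le_add_left ((ENNReal.add_le_add_iff_left h3).1 h2) _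
    have hsU : (⋃ B ∈ s, B) ⊆ ⋃₀ 𝒞 := iUnion₂_subset fun B hB => subset_sUnion_of_mem hB.1
    have hρ : ((2 : ℝ≥0∞) • μ.restrict Eᶜ) (⋃ B ∈ s, B) ≤ 2 * δ := by
      rw [Measure.smul_apply, Measure.restrict_apply' hE.compl, smul_eq_mul]
      gcongr
      exact (measure_mono fun x hx => Or.inr ⟨hsU hx.1, hx.2⟩).trans hlt.le
    have h4 : μ (⋃ B ∈ s, B) ≤ K * (2 * δ) := by
      refine (h.measure_biUnion_le_of_forall_le id s (fun B hB => hsub hB.1) (M := 2 * δ)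
        (by finiteness) (fun B hB => ?_) _ hhalf).trans (by gcongr; exact hρ)
      exact (hhalf B hB).trans ((measure_mono (subset_biUnion_of_mem (u := id) hB)).trans hρ)
    calc μ F ≤ μ (symmDiff E (⋃₀ 𝒞) ∪ ⋃ B ∈ s, B) := by
          refine measure_mono fun x hx => ?_
          simp only [hF, mem_ofPred_eq, Classical.not_imp, not_exists, not_and] at hx
          by_cases hxU : x ∈ ⋃₀ 𝒞
          · obtain ⟨B, hB, hxB⟩ := hxU
            exact Or.inr (mem_biUnion (show B ∈ s from ⟨hB, hx.2 B (hsub hB) hxB⟩) hxB)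
          · exact Or.inl (Or.inl ⟨hx.1, hxU⟩)
      _ ≤ μ (symmDiff E (⋃₀ 𝒞)) + μ (⋃ B ∈ s, B) := measure_union_le _ _
      _ ≤ δ + K * (2 * δ) := add_le_add hlt.le h4
  refine le_antisymm (ENNReal.le_of_forall_pos_le_add fun ε hε _ => ?_) bot_le
  have h5 := key (ε / (1 + K * 2)) (by positivity)
  rw [zero_add]
  refine h5.trans (le_of_eq ?_)
  norm_cast
  field_simp

/-- The balls that meet `B` and have measure at most `c * μ B` lie in one ball of comparable
measure. -/
theorem exists_ball_superset (h : IsBallBasis μ K 𝓑 hull) {B : Set X} (hB : B ∈ 𝓑) {c : ℝ≥0∞}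
    (hc : 1 ≤ c) (hc' : c ≠ ∞) :
    ∃ G ∈ 𝓑, μ G ≤ K ^ 2 * (c * μ B) ∧
      ∀ H ∈ 𝓑, (H ∩ B).Nonempty → μ H ≤ c * μ B → H ⊆ G := by
  set P : Set (Set X) := {H ∈ 𝓑 | (H ∩ B).Nonempty ∧ μ H ≤ c * μ B}
  have hBP : B ∈ P := ⟨hB, by rw [inter_self]; exact h.nonempty hB, le_mul_of_one_le_left' hc⟩
  have hcB : c * μ B ≠ ∞ := ENNReal.mul_ne_top hc' (h.measure_lt_top B hB).ne
  have hsup : (⨆ H ∈ P, μ H) ≤ c * μ B := iSup₂_le fun H hH => hH.2.2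
  have hsup0 : (⨆ H ∈ P, μ H) ≠ 0 :=
    ((h.measure_pos B hB).trans_le (le_iSup₂ (f := fun H (_ : H ∈ P) => μ H) B hBP)).ne'
  -- Every member of `P` has at most twice the measure of `H₀`. The first hull of `H₀` takes in `B`;
  -- then all members meet that hull, and the second hull takes them in.
  obtain ⟨H₀, hH₀, hlt⟩ : ∃ H₀ ∈ P, (⨆ H ∈ P, μ H) / 2 < μ H₀ := by
    simpa only [lt_iSup_iff, exists_prop] using
      ENNReal.half_lt_self hsup0 (ne_top_of_le_ne_top hcB hsup)
  have hle : ∀ H ∈ P, μ H ≤ 2 * μ H₀ := fun H hH => by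
    refine (le_iSup₂ (f := fun H (_ : H ∈ P) => μ H) H hH).trans ?_
    rw [mul_comm]
    exact (ENNReal.div_le_iff_le_mul (by simp) (by simp)).1 hlt.le
  have hB₀ : B ⊆ hull H₀ := h.subset_hull _ hH₀.1 _ hB (hle B hBP) (by
    rw [inter_comm]; exact hH₀.2.1)
  refine ⟨hull (hull H₀), h.hull_mem _ (h.hull_mem _ hH₀.1), ?_, fun H hH hHB hμ => ?_⟩
  · exact (h.measure_iterate_hull_le hH₀.1 2).trans (by gcongr; exact hH₀.2.2)
  · refine h.subset_hull _ (h.hull_mem _ hH₀.1) _ hH ((hle H ⟨hH, hHB, hμ⟩).trans ?_)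
      (hHB.mono (inter_subset_inter_right _ hB₀))
    gcongr
    exact h.self_subset_hull hH₀.1

/-- A sequence of balls whose hulls exhaust the space. -/
theorem exists_exhausting_seq (h : IsBallBasis μ K 𝓑 hull) [Nonempty X] :
    ∃ A : ℕ → Set X, (∀ n, A n ∈ 𝓑) ∧ ∀ x, ∀ᶠ n in Filter.atTop, x ∈ hull (A n) := by
  obtain ⟨x₀⟩ := ‹Nonempty X›
  have key : ∀ A ∈ 𝓑, x₀ ∈ A → ∀ x B, B ∈ 𝓑 → x₀ ∈ B → x ∈ B → μ B ≤ 2 * μ A → x ∈ hull A :=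
    fun A hA hx₀ x B hB hx₀B hxB hμ => h.subset_hull A hA B hB hμ ⟨x₀, hx₀B, hx₀⟩ hxB
  set s : ℝ≥0∞ := ⨆ B ∈ {B ∈ 𝓑 | x₀ ∈ B}, μ B with hs
  have hle : ∀ B ∈ 𝓑, x₀ ∈ B → μ B ≤ s := fun B hB hx =>
    le_iSup₂ (f := fun B (_ : B ∈ {B ∈ 𝓑 | x₀ ∈ B}) => μ B) B ⟨hB, hx⟩
  have hlt : ∀ t < s, ∃ B ∈ 𝓑, x₀ ∈ B ∧ t < μ B := fun t ht => by
    simpa only [hs, lt_iSup_iff, exists_prop, mem_ofPred_eq, and_assoc] using ht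
  -- Balls through `x₀` of measure above $n$ have hulls that eventually take in any ball through
  -- `x₀`. If measures are bounded, one ball above half the supremum already has hull $X$.
  by_cases hs' : s = ∞
  · have : ∀ n : ℕ, ∃ B ∈ 𝓑, x₀ ∈ B ∧ (n : ℝ≥0∞) < μ B := fun n => hlt _ (by simp [hs'])
    choose A hA hx₀ hμ using this
    refine ⟨A, hA, fun x => ?_⟩
    obtain ⟨B, hB, hxB₀, hxB⟩ := h.exists_ball x₀ x
    obtain ⟨m, hm⟩ := ENNReal.exists_nat_gt (h.measure_lt_top B hB).ne
    filter_upwards [Filter.eventually_ge_atTop m] with n hn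
    refine key _ (hA n) (hx₀ n) x B hB hxB₀ hxB (hm.le.trans ?_)
    calc (m : ℝ≥0∞) ≤ n := by exact_mod_cast hn
      _ ≤ μ (A n) := (hμ n).le
      _ ≤ 2 * μ (A n) := by rw [two_mul]; exact le_self_add
  · have hs0 : s ≠ 0 := by
      obtain ⟨B, hB, hxB₀, -⟩ := h.exists_ball x₀ x₀
      exact ((h.measure_pos B hB).trans_le (hle B hB hxB₀)).ne'
    obtain ⟨A, hA, hx₀, hμ⟩ := hlt (s / 2) (ENNReal.half_lt_self hs0 hs')
    refine ⟨fun _ => A, fun _ => hA, fun x => Filter.Eventually.of_forall fun _ => ?_⟩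
    obtain ⟨B, hB, hxB₀, hxB⟩ := h.exists_ball x₀ x
    refine key A hA hx₀ x B hB hxB₀ hxB ((hle B hB hxB₀).trans ?_)
    rw [mul_comm]
    exact (ENNReal.div_le_iff_le_mul (by simp) (by simp)).1 hμ.le

end IsBallBasis

/-! ### Layer-cake formula and interpolation. -/

theorem ENNReal.rpow_sub_one_mul_self {p : ℝ} (hp : 1 ≤ p) (a : ℝ≥0∞) : a ^ (p - 1) * a = a ^ p := by
  nth_rewrite 2 [← ENNReal.rpow_one a]
  rw [← ENNReal.rpow_add_of_nonneg _ _ (sub_nonneg.2 hp) zero_le_one, sub_add_cancel]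

/-- The layer-cake formula for a constant: the finite case comes from a Dirac mass, the value
$\infty$ by monotonicity. Integration over $X$ then gives the formula for functions that take the
value $\infty$. -/
theorem ENNReal.rpow_eq_lintegral_indicator {q : ℝ} (hq : 0 < q) (x : ℝ≥0∞) :
    x ^ q = ENNReal.ofReal q * ∫⁻ t in Ioi (0 : ℝ),
      ENNReal.ofReal (t ^ (q - 1)) * {t : ℝ | ENNReal.ofReal t < x}.indicator 1 t := by
  have hfin : ∀ y : ℝ≥0, (y : ℝ≥0∞) ^ q = ENNReal.ofReal q * ∫⁻ t in Ioi (0 : ℝ),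
      ENNReal.ofReal (t ^ (q - 1)) * {t : ℝ | ENNReal.ofReal t < y}.indicator 1 t := by
    intro y
    have h1 := lintegral_rpow_eq_lintegral_meas_lt_mul (Measure.dirac ()) (f := fun _ => (y : ℝ))
      (Filter.Eventually.of_forall fun _ => y.2) (by fun_prop) hq
    rw [lintegral_dirac, ← ENNReal.ofReal_rpow_of_nonneg y.coe_nonneg hq.le, ENNReal.ofReal_coe_nnreal] at h1
    rw [h1]
    congr 1
    refine setLIntegral_congr_fun measurableSet_Ioi fun t ht => ?_
    have ht' : (0 : ℝ) < t := ht
    by_cases hty : t < y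
    · have : ENNReal.ofReal t < y := by
        rw [← ENNReal.ofReal_coe_nnreal]; exact (ENNReal.ofReal_lt_ofReal_iff_of_nonneg ht'.le).2 hty
      simp [hty, this]
    · have : ¬ ENNReal.ofReal t < y := by
        rw [← ENNReal.ofReal_coe_nnreal, ENNReal.ofReal_lt_ofReal_iff_of_nonneg ht'.le]; exact hty
      simp [hty, this]
  induction x with
  | coe y => exact hfin y
  | top =>
    rw [ENNReal.top_rpow_of_pos hq]
    refine (top_le_iff.1 (ENNReal.le_of_forall_nnreal_lt fun r _ => ?_)).symm
    have h2 : (r : ℝ≥0∞) = ((r ^ (1 / q) : ℝ≥0) : ℝ≥0∞) ^ q := by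
      rw [← ENNReal.coe_rpow_of_nonneg _ hq.le, ← NNReal.rpow_mul]
      simp [hq.ne']
    rw [h2, hfin]
    gcongr
    exact le_top

theorem lintegral_rpow_eq_lintegral_measure_lt {X : Type*} [MeasurableSpace X] (ν : Measure X)
    [SFinite ν] {g : X → ℝ≥0∞} (hg : Measurable g) {q : ℝ} (hq : 0 < q) :
    ∫⁻ x, g x ^ q ∂ν = ENNReal.ofReal q * ∫⁻ t in Ioi (0 : ℝ),
      ENNReal.ofReal (t ^ (q - 1)) * ν {x | ENNReal.ofReal t < g x} := by
  have hm : MeasurableSet {z : X × ℝ | ENNReal.ofReal z.2 < g z.1} :=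
    measurableSet_lt (by fun_prop) (by fun_prop)
  have hm' : Measurable fun z : X × ℝ => ENNReal.ofReal (z.2 ^ (q - 1)) *
      {t : ℝ | ENNReal.ofReal t < g z.1}.indicator 1 z.2 :=
    Measurable.mul (by fun_prop) (measurable_one.indicator hm)
  simp_rw [ENNReal.rpow_eq_lintegral_indicator hq]
  rw [lintegral_const_mul _ hm'.lintegral_prod_right', lintegral_lintegral_swap hm'.aemeasurable]
  congr 1
  refine lintegral_congr fun t => ?_
  have hmt : MeasurableSet {x | ENNReal.ofReal t < g x} := measurableSet_lt (by fun_prop) hg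
  rw [← lintegral_indicator_one hmt, ← lintegral_const_mul _ (measurable_one.indicator hmt)]
  rfl

/-- The constant of the strong-type inequality. -/
noncomputable def maxConst (p : ℝ) : ℝ≥0∞ := ENNReal.ofReal (2 * p / (p - 1)) * 2 ^ (p - 1)

theorem maxConst_ne_top (p : ℝ) : maxConst p ≠ ∞ :=
  ENNReal.mul_ne_top ENNReal.ofReal_ne_top (by simp [ENNReal.rpow_eq_top_iff])

/-- A Marcinkiewicz-type interpolation between a weak-type and an `L^∞` bound. -/
theorem lintegral_rpow_le_of_weak_type {X : Type*} [MeasurableSpace X] (ν : Measure X)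
    [SFinite ν] {g G : X → ℝ≥0∞} (hg : Measurable g) (hG : Measurable G) {p : ℝ} (hp : 1 < p)
    (hweak : ∀ t : ℝ, 0 < t → ENNReal.ofReal t * ν {x | ENNReal.ofReal t < G x} ≤
      2 * ∫⁻ x in {x | ENNReal.ofReal t < 2 * g x}, g x ∂ν) :
    ∫⁻ x, G x ^ p ∂ν ≤ maxConst p * ∫⁻ x, g x ^ p ∂ν := by
  have hp0 : 0 < p - 1 := by linarith
  -- After multiplication by $t^{p-2}$ the weak-type bound becomes the layer-cake integral of
  -- $(2g)^{p-1}$ for the measure $g\,d\nu$.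
  have hI : ∫⁻ x, (2 * g x) ^ (p - 1) ∂(ν.withDensity g) = 2 ^ (p - 1) * ∫⁻ x, g x ^ p ∂ν := by
    rw [lintegral_withDensity_eq_lintegral_mul _ hg (by fun_prop),
      ← lintegral_const_mul _ (by fun_prop)]
    refine lintegral_congr fun x => ?_
    rw [Pi.mul_apply, ENNReal.mul_rpow_of_nonneg _ _ hp0.le, mul_left_comm]
    rw [mul_comm (g x), ENNReal.rpow_sub_one_mul_self hp.le]
  have h1 := lintegral_rpow_eq_lintegral_measure_lt (ν.withDensity g) (g := fun x => 2 * g x)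
    (by fun_prop) hp0
  rw [hI] at h1
  calc ∫⁻ x, G x ^ p ∂ν = ENNReal.ofReal p * ∫⁻ t in Ioi (0 : ℝ),
        ENNReal.ofReal (t ^ (p - 1)) * ν {x | ENNReal.ofReal t < G x} :=
        lintegral_rpow_eq_lintegral_measure_lt ν hG (by linarith)
    _ ≤ ENNReal.ofReal p * ∫⁻ t in Ioi (0 : ℝ), 2 * (ENNReal.ofReal (t ^ (p - 1 - 1)) *
        (ν.withDensity g) {x | ENNReal.ofReal t < 2 * g x}) := by
        refine mul_le_mul_right (setLIntegral_mono' measurableSet_Ioi fun t ht => ?_) _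
        have ht' : (0 : ℝ) < t := ht
        have h2 : t ^ (p - 1) = t ^ (p - 1 - 1) * t := by
          conv_rhs => rw [← Real.rpow_add_one ht'.ne']
          ring_nf
        rw [h2, ENNReal.ofReal_mul (by positivity), mul_assoc,
          withDensity_apply _ (measurableSet_lt (by fun_prop) (by fun_prop)), mul_left_comm 2]
        exact mul_le_mul_right (hweak t ht') _
    _ = maxConst p * ∫⁻ x, g x ^ p ∂ν := by
        have hmeas : Measurable fun t : ℝ => (ν.withDensity g) {x | ENNReal.ofReal t < 2 * g x} := by
          refine Antitone.measurable fun s t hst => measure_mono fun x hx => ?_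
          exact (ENNReal.ofReal_le_ofReal hst).trans_lt hx
        rw [lintegral_const_mul _ (by fun_prop), maxConst, mul_assoc (ENNReal.ofReal _), h1,
          ← mul_assoc, ← mul_assoc, ← ENNReal.ofReal_mul (by positivity),
          div_mul_cancel₀ _ hp0.ne', mul_comm 2 p, ENNReal.ofReal_mul (by positivity),
          ENNReal.ofReal_ofNat]

/-! ### Maximal functions normalized by hulls, for arbitrary measures. -/

/-- The maximal function of `g` over the family `A`, with respect to the measure `ν` and with the
normalization `ν (hull (A i))`. -/
noncomputable def hullMax {X ι : Type*} [MeasurableSpace X] (ν : Measure X)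
    (hull : Set X → Set X) (A : ι → Set X) (g : X → ℝ≥0∞) (x : X) : ℝ≥0∞ :=
  ⨆ i, (A i).indicator (fun _ => (∫⁻ y in A i, g y ∂ν) / ν (hull (A i))) x

theorem measurable_hullMax {X ι : Type*} [MeasurableSpace X] [Countable ι] (ν : Measure X)
    (hull : Set X → Set X) {A : ι → Set X} (hA : ∀ i, MeasurableSet (A i)) (g : X → ℝ≥0∞) :
    Measurable (hullMax ν hull A g) :=
  Measurable.iSup fun i => measurable_const.indicator (hA i)

theorem le_hullMax {X ι : Type*} [MeasurableSpace X] (ν : Measure X)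
    (hull : Set X → Set X) (A : ι → Set X) (g : X → ℝ≥0∞) {x : X} {i : ι} (hx : x ∈ A i) :
    (∫⁻ y in A i, g y ∂ν) / ν (hull (A i)) ≤ hullMax ν hull A g x := by
  refine le_trans ?_ (le_iSup _ i)
  rw [indicator_of_mem hx]

namespace IsBallBasis

variable {X : Type*} [MeasurableSpace X] {μ : Measure X} {K : ℝ≥0} {𝓑 : Set (Set X)}
  {hull : Set X → Set X} {ι : Type*} {A : ι → Set X}

/-- The hulls of disjoint selected balls cover the level set, and the quotient already divides by
the mass of the hull; so the constant is 1 and nothing relates `ν` to `μ`. -/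
theorem weak_hullMax (h : IsBallBasis μ K 𝓑 hull) (hA : ∀ i, A i ∈ 𝓑) (ν : Measure X)
    (g : X → ℝ≥0∞) (c : ℝ≥0∞) : c * ν {x | c < hullMax ν hull A g x} ≤ ∫⁻ x, g x ∂ν := by
  -- Vitali selection needs bounded measures; the bound `N` is removed by monotone continuity.
  set J : ℕ → Set ι := fun N => {i | μ (A i) ≤ N ∧ c < (∫⁻ y in A i, g y ∂ν) / ν (hull (A i))}
    with hJ
  have hset : {x | c < hullMax ν hull A g x} = ⋃ N, ⋃ i ∈ J N, A i := by
    ext x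
    simp only [hullMax, mem_ofPred_eq, lt_iSup_iff, mem_iUnion, hJ, exists_prop]
    constructor
    · rintro ⟨i, hi⟩
      have hxi : x ∈ A i := by
        by_contra hx
        rw [indicator_of_notMem hx] at hi
        exact not_lt_bot hi
      rw [indicator_of_mem hxi] at hi
      obtain ⟨N, hN⟩ := ENNReal.exists_nat_gt (h.measure_lt_top _ (hA i)).ne
      exact ⟨N, i, ⟨hN.le, hi⟩, hxi⟩
    · rintro ⟨N, i, ⟨-, hi⟩, hxi⟩
      exact ⟨i, by rwa [indicator_of_mem hxi]⟩
  have hmono : Monotone fun N => ⋃ i ∈ J N, A i := fun M N hMN =>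
    biUnion_subset_biUnion_left fun i hi => ⟨hi.1.trans (by exact_mod_cast hMN), hi.2⟩
  rw [hset, hmono.measure_iUnion, ENNReal.mul_iSup]
  refine iSup_le fun N => ?_
  obtain ⟨u, huJ, hc, hd, hcov⟩ := h.exists_disjoint_cover A (J N) (fun i _ => hA i)
    (ENNReal.natCast_ne_top N) (fun i hi => hi.1)
  calc c * ν (⋃ i ∈ J N, A i) ≤ c * ∑' i : u, ν (hull (A i)) :=
        mul_le_mul_right ((measure_mono hcov).trans (measure_biUnion_le _ hc _)) _
    _ = ∑' i : u, c * ν (hull (A i)) := ENNReal.tsum_mul_left.symm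
    _ ≤ ∑' i : u, ∫⁻ x in A i, g x ∂ν := ENNReal.tsum_le_tsum fun i =>
        ENNReal.mul_le_of_le_div (huJ i.2).2.le
    _ = ∫⁻ x in ⋃ i ∈ u, A i, g x ∂ν :=
        (lintegral_biUnion hc (fun i _ => h.measurableSet _ (hA i)) hd _).symm
    _ ≤ ∫⁻ x, g x ∂ν := setLIntegral_le_lintegral _ _

/-- The weak-type bound is applied to `g` cut at half the level. The constant depends on $p$ alone,
which is what lets the $A_p$ characteristic enter Buckley's theorem only through the pointwise
estimate. -/
theorem lintegral_hullMax_rpow_le (h : IsBallBasis μ K 𝓑 hull) [Countable ι] (hA : ∀ i, A i ∈ 𝓑)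
    (ν : Measure X) [SFinite ν] {g : X → ℝ≥0∞} (hg : Measurable g) {p : ℝ} (hp : 1 < p) :
    ∫⁻ x, hullMax ν hull A g x ^ p ∂ν ≤ maxConst p * ∫⁻ x, g x ^ p ∂ν := by
  have hAm : ∀ i, MeasurableSet (A i) := fun i => h.measurableSet _ (hA i)
  refine lintegral_rpow_le_of_weak_type ν hg (measurable_hullMax ν hull hAm g) hp fun t ht => ?_
  set c : ℝ≥0∞ := ENNReal.ofReal t / 2 with hc
  have hc2 : ENNReal.ofReal t = 2 * c := by
    rw [hc, ENNReal.mul_div_cancel (by simp) (by simp)]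
  set S : Set X := {x | ENNReal.ofReal t < 2 * g x} with hS
  have hSm : MeasurableSet S := measurableSet_lt (by fun_prop) (by fun_prop)
  have hsub : {x | ENNReal.ofReal t < hullMax ν hull A g x} ⊆
      {x | c < hullMax ν hull A (S.indicator g) x} := by
    intro x hx
    simp only [hullMax, mem_ofPred_eq, lt_iSup_iff] at hx ⊢
    obtain ⟨i, hi⟩ := hx
    refine ⟨i, ?_⟩
    have hxi : x ∈ A i := by
      by_contra hx
      rw [indicator_of_notMem hx] at hi
      exact not_lt_bot hi
    rw [indicator_of_mem hxi] at hi ⊢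
    by_contra hle
    rw [not_lt] at hle
    refine hi.not_ge ?_
    -- The part of `g` below `c` contributes at most `c` to any quotient because a ball lies in its
    -- hull, so the part on `S` must supply the rest of $t=2c$.
    have hgle : ∀ y, g y ≤ S.indicator g y + c := by
      intro y
      by_cases hy : y ∈ S
      · rw [indicator_of_mem hy]; exact le_self_add
      · rw [indicator_of_notMem hy, zero_add]
        simp only [hS, mem_ofPred_eq, not_lt, hc2] at hy
        exact (ENNReal.mul_le_mul_iff_right (by simp) (by simp)).1 hy
    calc (∫⁻ y in A i, g y ∂ν) / ν (hull (A i))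
        ≤ (∫⁻ y in A i, (S.indicator g y + c) ∂ν) / ν (hull (A i)) :=
          ENNReal.div_le_div_right (lintegral_mono hgle) _
      _ = (∫⁻ y in A i, S.indicator g y ∂ν) / ν (hull (A i)) +
          c * (ν (A i) / ν (hull (A i))) := by
          rw [lintegral_add_right _ measurable_const, setLIntegral_const, ENNReal.add_div,
            mul_div_assoc]
      _ ≤ c + c * 1 := by
          gcongr
          exact ENNReal.div_le_of_le_mul (by
            rw [one_mul]; exact measure_mono (h.self_subset_hull (hA i)))
      _ = ENNReal.ofReal t := by rw [hc2, mul_one, two_mul]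
  calc ENNReal.ofReal t * ν {x | ENNReal.ofReal t < hullMax ν hull A g x}
      ≤ 2 * (c * ν {x | c < hullMax ν hull A (S.indicator g) x}) := by
        rw [hc2, mul_assoc]
        refine mul_le_mul_right (mul_le_mul_right (measure_mono ?_) _) _
        rwa [hc2] at hsub
    _ ≤ 2 * ∫⁻ x, S.indicator g x ∂ν := mul_le_mul_right (h.weak_hullMax hA ν _ c) _
    _ = 2 * ∫⁻ x in S, g x ∂ν := by rw [lintegral_indicator hSm]

end IsBallBasis

/-! ### Dual pairs of weights and Buckley's theorem. -/

/-- `w` and `σ` are weights, dual to each other, that satisfy the `A_p` condition with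
constant `Q`. -/
structure IsApPair {X : Type*} [MeasurableSpace X] (μ : Measure X) (𝓑 : Set (Set X)) (p : ℝ)
    (Q : ℝ≥0∞) (w σ : X → ℝ≥0∞) : Prop where
  measurable_left : Measurable w
  measurable_right : Measurable σ
  ne_zero_left : ∀ᵐ x ∂μ, w x ≠ 0
  ne_top_left : ∀ᵐ x ∂μ, w x ≠ ∞
  ne_zero_right : ∀ᵐ x ∂μ, σ x ≠ 0
  ne_top_right : ∀ᵐ x ∂μ, σ x ≠ ∞
  mul_rpow_eq_one : ∀ᵐ x ∂μ, w x * σ x ^ (p - 1) = 1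
  mul_rpow_le : ∀ B ∈ 𝓑, (∫⁻ x in B, w x ∂μ) * (∫⁻ x in B, σ x ∂μ) ^ (p - 1) ≤ Q * μ B ^ p

namespace IsApPair

variable {X : Type*} [MeasurableSpace X] {μ : Measure X} {𝓑 : Set (Set X)} {p : ℝ}
  {Q : ℝ≥0∞} {w σ : X → ℝ≥0∞}

/-- Raising the conditions to the power $1/(p-1)=p'-1$ exchanges the two weights; this gives
Buckley's theorem on the dual side. -/
theorem symm (h : IsApPair μ 𝓑 p Q w σ) (hp : 1 < p) :
    IsApPair μ 𝓑 (p / (p - 1)) (Q ^ (p - 1)⁻¹) σ w where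
  measurable_left := h.measurable_right
  measurable_right := h.measurable_left
  ne_zero_left := h.ne_zero_right
  ne_top_left := h.ne_top_right
  ne_zero_right := h.ne_zero_left
  ne_top_right := h.ne_top_left
  mul_rpow_eq_one := by
    have hp0 : 0 < p - 1 := by linarith
    have hq : p / (p - 1) - 1 = (p - 1)⁻¹ := by field_simp; ring
    filter_upwards [h.mul_rpow_eq_one] with x hx
    have h1 := congrArg (fun y => y ^ (p - 1)⁻¹) hx
    simp only [ENNReal.one_rpow] at h1
    rw [ENNReal.mul_rpow_of_nonneg _ _ (by positivity), ENNReal.rpow_rpow_inv hp0.ne'] at h1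
    rw [hq, mul_comm, h1]
  mul_rpow_le B hB := by
    have hp0 : 0 < p - 1 := by linarith
    have hq : p / (p - 1) - 1 = (p - 1)⁻¹ := by field_simp; ring
    have h1 := ENNReal.rpow_le_rpow (h.mul_rpow_le B hB) (z := (p - 1)⁻¹) (by positivity)
    rw [ENNReal.mul_rpow_of_nonneg _ _ (by positivity), ENNReal.rpow_rpow_inv hp0.ne',
      ENNReal.mul_rpow_of_nonneg _ _ (by positivity), ← ENNReal.rpow_mul] at h1
    rwa [hq, mul_comm, div_eq_mul_inv]

end IsApPair

/-- The maximal function over the family `A`. -/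
noncomputable def famMax {X ι : Type*} [MeasurableSpace X] (μ : Measure X)
    (A : ι → Set X) (φ : X → ℝ≥0∞) (x : X) : ℝ≥0∞ :=
  ⨆ i, (A i).indicator (fun _ => (∫⁻ y in A i, φ y ∂μ) / μ (A i)) x

theorem measurable_famMax {X ι : Type*} [MeasurableSpace X] [Countable ι] (μ : Measure X)
    {A : ι → Set X} (hA : ∀ i, MeasurableSet (A i)) (φ : X → ℝ≥0∞) :
    Measurable (famMax μ A φ) :=
  Measurable.iSup fun i => measurable_const.indicator (hA i)

theorem le_famMax {X ι : Type*} [MeasurableSpace X] (μ : Measure X)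
    (A : ι → Set X) (φ : X → ℝ≥0∞) {x : X} {i : ι} (hx : x ∈ A i) :
    (∫⁻ y in A i, φ y ∂μ) / μ (A i) ≤ famMax μ A φ x := by
  refine le_trans ?_ (le_iSup _ i)
  rw [indicator_of_mem hx]

theorem setLIntegral_ne_zero_of_ae {X : Type*} [MeasurableSpace X] {μ : Measure X}
    {w : X → ℝ≥0∞} (hw : Measurable w) (h0 : ∀ᵐ x ∂μ, w x ≠ 0) {B : Set X}
    (hB0 : 0 < μ B) : ∫⁻ x in B, w x ∂μ ≠ 0 := by
  intro h1
  rw [lintegral_eq_zero_iff hw] at h1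
  have h2 : ∀ᵐ x ∂(μ.restrict B), False := by
    filter_upwards [h1, ae_restrict_of_ae h0] with x hx hx' using hx' hx
  rw [Filter.eventually_false_iff_eq_bot, ae_eq_bot, Measure.restrict_eq_zero] at h2
  exact hB0.ne' h2

/-- The constant in Buckley's theorem. -/
noncomputable def buckleyConst (K : ℝ≥0) (p : ℝ) : ℝ≥0∞ :=
  ((K : ℝ≥0∞) ^ p) ^ (p / (p - 1)) * maxConst (p / (p - 1)) * maxConst p

theorem buckleyConst_ne_top (K : ℝ≥0) {p : ℝ} (hp : 1 < p) : buckleyConst K p ≠ ∞ := by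
  have h1 : (K : ℝ≥0∞) ^ p ≠ ∞ := ENNReal.rpow_ne_top_of_nonneg (by linarith) (by simp)
  have h2 : ((K : ℝ≥0∞) ^ p) ^ (p / (p - 1)) ≠ ∞ :=
    ENNReal.rpow_ne_top_of_nonneg (div_nonneg (by linarith) (by linarith)) h1
  exact ENNReal.mul_ne_top (ENNReal.mul_ne_top h2 (maxConst_ne_top _)) (maxConst_ne_top _)

namespace IsBallBasis

variable {X : Type*} [MeasurableSpace X] {μ : Measure X} {K : ℝ≥0} {𝓑 : Set (Set X)}
  {hull : Set X → Set X} {ι : Type*} {A : ι → Set X} {p : ℝ} {Q : ℝ≥0∞} {w σ : X → ℝ≥0∞}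

/-- The pointwise estimate behind Buckley's theorem. -/
theorem famMax_rpow_le (h : IsBallBasis μ K 𝓑 hull) (hA : ∀ i, A i ∈ 𝓑)
    (hw : IsApPair μ 𝓑 p Q w σ) (hp : 1 < p) (hQ : Q ≠ ∞) {φ g : X → ℝ≥0∞} [Countable ι]
    (hg : Measurable g) (hφ : ∀ᵐ x ∂μ, φ x = σ x * g x) (x : X) :
    famMax μ A φ x ^ (p - 1) ≤ Q * K ^ p *
      hullMax (μ.withDensity w) hull A
        (fun y => (hullMax (μ.withDensity σ) hull A g y * σ y) ^ (p - 1)) x := by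
  have hp0 : 0 < p - 1 := by linarith
  have hAm : ∀ i, MeasurableSet (A i) := fun i => h.measurableSet _ (hA i)
  set G := hullMax (μ.withDensity σ) hull A g with hG
  have hGm : Measurable G := measurable_hullMax _ _ hAm _
  have hmono : famMax μ A φ x ^ (p - 1) =
      ⨆ i, ((A i).indicator (fun _ => (∫⁻ y in A i, φ y ∂μ) / μ (A i)) x) ^ (p - 1) :=
    (ENNReal.orderIsoRpow (p - 1) hp0).map_iSup _
  rw [hmono]
  refine iSup_le fun i => ?_
  by_cases hx : x ∈ A i
  swap
  · rw [indicator_of_notMem hx, ENNReal.zero_rpow_of_pos hp0]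
    exact bot_le
  rw [indicator_of_mem hx]
  refine le_trans ?_ (mul_le_mul_right (le_hullMax _ _ _ _ hx) _)
  set I := ∫⁻ y in A i, φ y ∂μ
  set m := μ (A i)
  have hH := h.hull_mem _ (hA i)
  have hHm := h.measurableSet _ hH
  rw [withDensity_apply _ hHm]
  set W := ∫⁻ y in hull (A i), w y ∂μ
  have hS : (μ.withDensity σ) (hull (A i)) = ∫⁻ y in hull (A i), σ y ∂μ :=
    withDensity_apply _ hHm
  set S := ∫⁻ y in hull (A i), σ y ∂μ
  have hI : ∫⁻ y in A i, g y ∂(μ.withDensity σ) = I := by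
    rw [setLIntegral_withDensity_eq_setLIntegral_mul _ hw.measurable_right hg (hAm i)]
    exact setLIntegral_congr_fun_ae (hAm i) (by filter_upwards [hφ] with y hy _ using hy.symm)
  have hm0 : m ≠ 0 := (h.measure_pos _ (hA i)).ne'
  have hmt : m ≠ ∞ := (h.measure_lt_top _ (hA i)).ne
  have hW0 : W ≠ 0 :=
    setLIntegral_ne_zero_of_ae hw.measurable_left hw.ne_zero_left (h.measure_pos _ hH)
  have hS0 : S ≠ 0 :=
    setLIntegral_ne_zero_of_ae hw.measurable_right hw.ne_zero_right (h.measure_pos _ hH)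
  have hSp0 : S ^ (p - 1) ≠ 0 := by simp [ENNReal.rpow_eq_zero_iff, hS0, hp.le]
  -- The $A_p$ condition is used on the hull, since both maximal functions divide by masses of the
  -- hull; the return to `A i` costs $K^p$.
  have hprod : W * S ^ (p - 1) ≤ Q * K ^ p * (m ^ (p - 1) * m) := by
    refine (hw.mul_rpow_le _ hH).trans ?_
    rw [mul_assoc]
    refine mul_le_mul_right ?_ _
    refine (ENNReal.rpow_le_rpow (h.measure_hull_le _ (hA i)) (by linarith)).trans ?_
    rw [ENNReal.mul_rpow_of_nonneg _ _ (by linarith)]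
    exact mul_le_mul_right (ENNReal.rpow_sub_one_mul_self hp.le _).ge _
  have hprod_top : W * S ^ (p - 1) ≠ ∞ := by
    refine ne_top_of_le_ne_top ?_ hprod
    have : m ^ (p - 1) ≠ ∞ := ENNReal.rpow_ne_top_of_nonneg hp0.le hmt
    have : (K : ℝ≥0∞) ^ p ≠ ∞ := ENNReal.rpow_ne_top_of_nonneg (by linarith) ENNReal.coe_ne_top
    finiteness
  have hWt : W ≠ ∞ := fun h1 => hprod_top (by rw [h1, ENNReal.top_mul hSp0])
  have hSt : S ^ (p - 1) ≠ ∞ := fun h1 => hprod_top (by rw [h1, ENNReal.mul_top hW0])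
  -- On `A i` the inner maximal function is at least $I/S$, and $w\sigma^{p-1}=1$ removes the
  -- weights from the integrand.
  have hU : I ^ (p - 1) / S ^ (p - 1) * m ≤
      ∫⁻ y in A i, (G y * σ y) ^ (p - 1) ∂(μ.withDensity w) := by
    rw [setLIntegral_withDensity_eq_setLIntegral_mul _ hw.measurable_left
      (by have := hw.measurable_right; fun_prop) (hAm i)]
    rw [← setLIntegral_const]
    refine lintegral_mono_ae ?_
    rw [ae_restrict_iff' (hAm i)]
    filter_upwards [hw.mul_rpow_eq_one] with y hy hyA
    rw [Pi.mul_apply, ENNReal.mul_rpow_of_nonneg _ _ hp0.le, mul_left_comm, hy, mul_one,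
      ← ENNReal.div_rpow_of_nonneg _ _ hp0.le, ← hI, ← hS]
    exact ENNReal.rpow_le_rpow (le_hullMax _ _ _ _ hyA) hp0.le
  rw [ENNReal.div_rpow_of_nonneg _ _ hp0.le]
  refine le_trans ?_ (mul_le_mul_right (ENNReal.div_le_div_right hU W) _)
  refine ENNReal.div_le_of_le_mul ?_
  calc I ^ (p - 1) = I ^ (p - 1) * ((W * W⁻¹) * (S ^ (p - 1) * (S ^ (p - 1))⁻¹)) := by
        rw [ENNReal.mul_inv_cancel hW0 hWt, ENNReal.mul_inv_cancel hSp0 hSt, mul_one, mul_one]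
    _ = I ^ (p - 1) * (W⁻¹ * (S ^ (p - 1))⁻¹) * (W * S ^ (p - 1)) := by ring
    _ ≤ I ^ (p - 1) * (W⁻¹ * (S ^ (p - 1))⁻¹) * (Q * K ^ p * (m ^ (p - 1) * m)) :=
        mul_le_mul_right hprod _
    _ = Q * K ^ p * (I ^ (p - 1) / S ^ (p - 1) * m / W) * m ^ (p - 1) := by
        simp only [div_eq_mul_inv]; ring

/-- Buckley's theorem for the maximal function of a countable family of balls. -/
theorem lintegral_famMax_rpow_le (h : IsBallBasis μ K 𝓑 hull) [Countable ι] (hA : ∀ i, A i ∈ 𝓑)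
    (hw : IsApPair μ 𝓑 p Q w σ) (hp : 1 < p) (hQ : Q ≠ ∞) {φ : X → ℝ≥0∞} (hφ : Measurable φ) :
    ∫⁻ x, famMax μ A φ x ^ p * w x ∂μ ≤
      Q ^ (p / (p - 1)) * buckleyConst K p * ∫⁻ x, φ x ^ p * w x ∂μ := by
  have := h.sigmaFinite
  have hp0 : 0 < p - 1 := by linarith
  have hq : 1 < p / (p - 1) := by rw [lt_div_iff₀ hp0]; linarith
  have hq' : (p - 1) * (p / (p - 1)) = p := by field_simp
  have hAm : ∀ i, MeasurableSet (A i) := fun i => h.measurableSet _ (hA i)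
  have hwm := hw.measurable_left
  have hσm := hw.measurable_right
  set g : X → ℝ≥0∞ := fun x => φ x / σ x with hgdef
  have hg : Measurable g := hφ.div hσm
  have hφg : ∀ᵐ x ∂μ, φ x = σ x * g x := by
    filter_upwards [hw.ne_zero_right, hw.ne_top_right] with x h0 h1
    rw [hgdef, ENNReal.mul_div_cancel h0 h1]
  set G := hullMax (μ.withDensity σ) hull A g with hG
  have hGm : Measurable G := measurable_hullMax _ _ hAm _
  set u : X → ℝ≥0∞ := fun y => (G y * σ y) ^ (p - 1) with hu
  have hum : Measurable u := by fun_prop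
  have hMm := measurable_famMax μ hAm φ
  -- This identity turns the $L^{p'}(w)$ norm of $(G\sigma)^{p-1}$ into an $L^p(\sigma)$ norm of
  -- $G$, and the $L^p(\sigma)$ norm of $\varphi/\sigma$ into the $L^p(w)$ norm of $\varphi$.
  have hwσ : ∀ᵐ x ∂μ, ∀ a : ℝ≥0∞, (a * σ x) ^ p * w x = a ^ p * σ x := by
    filter_upwards [hw.mul_rpow_eq_one] with x hx a
    have h2 : σ x ^ p = σ x ^ (p - 1) * σ x := (ENNReal.rpow_sub_one_mul_self hp.le _).symm
    rw [ENNReal.mul_rpow_of_nonneg _ _ (by linarith), h2]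
    calc a ^ p * (σ x ^ (p - 1) * σ x) * w x = a ^ p * σ x * (w x * σ x ^ (p - 1)) := by ring
      _ = a ^ p * σ x := by rw [hx, mul_one]
  calc ∫⁻ x, famMax μ A φ x ^ p * w x ∂μ
      = ∫⁻ x, (famMax μ A φ x ^ (p - 1)) ^ (p / (p - 1)) ∂(μ.withDensity w) := by
        rw [lintegral_withDensity_eq_lintegral_mul _ hwm (by fun_prop)]
        refine lintegral_congr fun x => ?_
        rw [Pi.mul_apply, ← ENNReal.rpow_mul, hq', mul_comm]
    _ ≤ ∫⁻ x, (Q * K ^ p) ^ (p / (p - 1)) *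
        hullMax (μ.withDensity w) hull A u x ^ (p / (p - 1)) ∂(μ.withDensity w) := by
        refine lintegral_mono fun x => ?_
        rw [← ENNReal.mul_rpow_of_nonneg _ _ (by linarith)]
        exact ENNReal.rpow_le_rpow (h.famMax_rpow_le hA hw hp hQ hg hφg x) (by linarith)
    _ = (Q * K ^ p) ^ (p / (p - 1)) *
        ∫⁻ x, hullMax (μ.withDensity w) hull A u x ^ (p / (p - 1)) ∂(μ.withDensity w) :=
        lintegral_const_mul _ ((measurable_hullMax _ _ hAm _).pow_const _)
    _ ≤ (Q * K ^ p) ^ (p / (p - 1)) * (maxConst (p / (p - 1)) *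
        ∫⁻ x, u x ^ (p / (p - 1)) ∂(μ.withDensity w)) :=
        mul_le_mul_right (h.lintegral_hullMax_rpow_le hA _ hum hq) _
    _ = (Q * K ^ p) ^ (p / (p - 1)) * (maxConst (p / (p - 1)) *
        ∫⁻ x, G x ^ p ∂(μ.withDensity σ)) := by
        rw [lintegral_withDensity_eq_lintegral_mul _ hwm (by fun_prop),
          lintegral_withDensity_eq_lintegral_mul _ hσm (by fun_prop)]
        congr 2
        refine lintegral_congr_ae ?_
        filter_upwards [hwσ] with x hx
        rw [Pi.mul_apply, Pi.mul_apply, hu, ← ENNReal.rpow_mul, hq', mul_comm, hx, mul_comm]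
    _ ≤ (Q * K ^ p) ^ (p / (p - 1)) * (maxConst (p / (p - 1)) *
        (maxConst p * ∫⁻ x, g x ^ p ∂(μ.withDensity σ))) :=
        mul_le_mul_right (mul_le_mul_right (h.lintegral_hullMax_rpow_le hA _ hg hp) _) _
    _ = (Q * K ^ p) ^ (p / (p - 1)) * (maxConst (p / (p - 1)) *
        (maxConst p * ∫⁻ x, φ x ^ p * w x ∂μ)) := by
        rw [lintegral_withDensity_eq_lintegral_mul _ hσm (by fun_prop)]
        congr 3
        refine lintegral_congr_ae ?_
        filter_upwards [hwσ, hφg] with x hx hx'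
        rw [Pi.mul_apply, hx', mul_comm (σ x), mul_comm (σ x), hx]
    _ = Q ^ (p / (p - 1)) * buckleyConst K p * ∫⁻ x, φ x ^ p * w x ∂μ := by
        rw [ENNReal.mul_rpow_of_nonneg _ _ (by linarith), buckleyConst]
        ring

end IsBallBasis

/-! ### The weighted bound for sparse sums. -/

/-- The constant in the weighted estimate for sparse operators. -/
noncomputable def sparseConst (K : ℝ≥0) (p : ℝ) : ℝ≥0∞ :=
  buckleyConst K p ^ (1 / p) * buckleyConst K (p / (p - 1)) ^ ((p - 1) / p)

/-- The sparse operator of an indexed family. -/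
noncomputable def famSum {X ι : Type*} [MeasurableSpace X] (μ : Measure X) (A : ι → Set X)
    (φ : X → ℝ≥0∞) (J : Finset ι) (x : X) : ℝ≥0∞ :=
  ∑ i ∈ J, (A i).indicator (fun _ => (∫⁻ y in A i, φ y ∂μ) / μ (A i)) x

namespace IsBallBasis

variable {X : Type*} [MeasurableSpace X] {μ : Measure X} {K : ℝ≥0} {𝓑 : Set (Set X)}
  {hull : Set X → Set X} {ι : Type*} {A F : ι → Set X} {p : ℝ} {Q Γ : ℝ≥0∞} {w σ : X → ℝ≥0∞}

/-- The sparse form is dominated by the product of two maximal functions. -/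
theorem lintegral_famSum_mul_le (h : IsBallBasis μ K 𝓑 hull) [Countable ι] (hA : ∀ i, A i ∈ 𝓑)
    (hF : ∀ i, MeasurableSet (F i)) (hFA : ∀ i, F i ⊆ A i)
    (hd : Pairwise (Function.onFun Disjoint F)) (hΓ : ∀ i, μ (A i) ≤ Γ * μ (F i))
    (φ : X → ℝ≥0∞) {ψ : X → ℝ≥0∞} (hψ : Measurable ψ) (J : Finset ι) :
    ∫⁻ x, famSum μ A φ J x * ψ x ∂μ ≤ Γ * ∫⁻ x, famMax μ A φ x * famMax μ A ψ x ∂μ := by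
  have hAm : ∀ i, MeasurableSet (A i) := fun i => h.measurableSet _ (hA i)
  set P : ι → ℝ≥0∞ := fun i => (∫⁻ y in A i, φ y ∂μ) / μ (A i) with hP
  set R : ι → ℝ≥0∞ := fun i => (∫⁻ y in A i, ψ y ∂μ) / μ (A i) with hR
  have hRm : ∀ i, ∫⁻ y in A i, ψ y ∂μ = R i * μ (A i) := fun i =>
    (ENNReal.div_mul_cancel (h.measure_pos _ (hA i)).ne' (h.measure_lt_top _ (hA i)).ne).symm
  calc ∫⁻ x, famSum μ A φ J x * ψ x ∂μ = ∫⁻ x, ∑ i ∈ J, P i * (A i).indicator ψ x ∂μ := by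
        refine lintegral_congr fun x => ?_
        rw [famSum, Finset.sum_mul]
        refine Finset.sum_congr rfl fun i _ => ?_
        by_cases hx : x ∈ A i <;> simp [hx, hP]
    _ = ∑ i ∈ J, P i * ∫⁻ x in A i, ψ x ∂μ := by
        rw [lintegral_finsetSum _ fun i _ => (hψ.indicator (hAm i)).const_mul _]
        refine Finset.sum_congr rfl fun i _ => ?_
        rw [lintegral_const_mul _ (hψ.indicator (hAm i)), lintegral_indicator (hAm i)]
    -- Sparseness replaces `μ (A i)` by `Γ * μ (F i)`; on `F i` both averages lie below the maximal
    -- functions.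
    _ ≤ ∑ i ∈ J, Γ * ∫⁻ x in F i, famMax μ A φ x * famMax μ A ψ x ∂μ := by
        refine Finset.sum_le_sum fun i _ => ?_
        rw [hRm]
        calc P i * (R i * μ (A i)) ≤ P i * (R i * (Γ * μ (F i))) := by gcongr; exact hΓ i
          _ = Γ * ∫⁻ x in F i, P i * R i ∂μ := by rw [setLIntegral_const]; ring
          _ ≤ Γ * ∫⁻ x in F i, famMax μ A φ x * famMax μ A ψ x ∂μ :=
            mul_le_mul_right (setLIntegral_mono' (hF i) fun x hx =>
              mul_le_mul' (le_famMax μ A φ (hFA i hx)) (le_famMax μ A ψ (hFA i hx))) _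
    _ = Γ * ∫⁻ x in ⋃ i ∈ J, F i, famMax μ A φ x * famMax μ A ψ x ∂μ := by
        rw [← Finset.mul_sum, lintegral_biUnion_finset (hd.set_pairwise _) fun i _ => hF i]
    _ ≤ Γ * ∫⁻ x, famMax μ A φ x * famMax μ A ψ x ∂μ :=
        mul_le_mul_right (setLIntegral_le_lintegral _ _) _

/-- The sum $H$ is tested against its own dual function $\psi=H^{p-1}w$, for which $\int
H\psi=\int\psi^{p'}\sigma=Y$, the left side. Hölder and Buckley on both sides give $Y\le
DN^{1/p}Y^{1/p'}$, and $Y^{1/p'}$ is cancelled. -/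
theorem lintegral_famSum_rpow_le (h : IsBallBasis μ K 𝓑 hull) [Countable ι] (hA : ∀ i, A i ∈ 𝓑)
    (hF : ∀ i, MeasurableSet (F i)) (hFA : ∀ i, F i ⊆ A i)
    (hd : Pairwise (Function.onFun Disjoint F)) (hΓ : ∀ i, μ (A i) ≤ Γ * μ (F i))
    (hw : IsApPair μ 𝓑 p Q w σ) (hp : 1 < p) (hQ : Q ≠ ∞) {φ : X → ℝ≥0∞} (hφ : Measurable φ)
    (hφt : ∫⁻ x, φ x ^ p * w x ∂μ ≠ ∞) (J : Finset ι) :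
    ∫⁻ x, famSum μ A φ J x ^ p * w x ∂μ ≤
      (Γ * Q ^ (p / (p - 1)) * sparseConst K p) ^ p * ∫⁻ x, φ x ^ p * w x ∂μ := by
  have hp0 : 0 < p - 1 := by linarith
  have hpp : 0 < p := by linarith
  have hq : 1 < p / (p - 1) := by rw [lt_div_iff₀ hp0]; linarith
  have hqq : p / (p - 1) / (p / (p - 1) - 1) = p := by field_simp; ring
  have hpq : p.HolderConjugate (p / (p - 1)) := Real.HolderConjugate.conjExponent hp
  have hAm : ∀ i, MeasurableSet (A i) := fun i => h.measurableSet _ (hA i)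
  have hwm := hw.measurable_left
  have hσm := hw.measurable_right
  set N := ∫⁻ x, φ x ^ p * w x ∂μ with hN
  set H : X → ℝ≥0∞ := famSum μ A φ J with hH
  have hHm : Measurable H := by
    rw [hH]; unfold famSum
    exact Finset.measurable_sum _ fun i _ => measurable_const.indicator (hAm i)
  set M : X → ℝ≥0∞ := famMax μ A φ with hM
  have hMm : Measurable M := measurable_famMax μ hAm φ
  have hMN : ∫⁻ x, M x ^ p * w x ∂μ ≤ Q ^ (p / (p - 1)) * buckleyConst K p * N :=
    h.lintegral_famMax_rpow_le hA hw hp hQ hφ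
  have hQt : Q ^ (p / (p - 1)) ≠ ∞ := ENNReal.rpow_ne_top_of_nonneg (by linarith) hQ
  -- The cancellation needs $Y<\infty$; this is why the sum is finite at first, hence at most a
  -- multiple of the maximal function.
  have hHtop : ∫⁻ x, H x ^ p * w x ∂μ ≠ ∞ := by
    have h1 : ∀ x, H x ≤ J.card * M x := fun x => by
      rw [← nsmul_eq_mul, ← Finset.sum_const]
      exact Finset.sum_le_sum fun i _ =>
        le_iSup (fun i => (A i).indicator (fun _ => (∫⁻ y in A i, φ y ∂μ) / μ (A i)) x) i
    have h2 : ∫⁻ x, H x ^ p * w x ∂μ ≤ (J.card : ℝ≥0∞) ^ p * ∫⁻ x, M x ^ p * w x ∂μ := by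
      rw [← lintegral_const_mul _ (by fun_prop)]
      refine lintegral_mono fun x => ?_
      rw [← mul_assoc, ← ENNReal.mul_rpow_of_nonneg _ _ hpp.le]
      gcongr
      exact h1 x
    refine ne_top_of_le_ne_top ?_ (h2.trans (mul_le_mul_right hMN _))
    exact ENNReal.mul_ne_top (ENNReal.rpow_ne_top_of_nonneg hpp.le (by simp))
      (ENNReal.mul_ne_top (ENNReal.mul_ne_top hQt (buckleyConst_ne_top K hp)) hφt)
  set Y := ∫⁻ x, H x ^ p * w x ∂μ with hY
  set ψ : X → ℝ≥0∞ := fun x => H x ^ (p - 1) * w x with hψ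
  have hψm : Measurable ψ := by fun_prop
  have hMψm := measurable_famMax μ hAm ψ
  have hYψ : Y = ∫⁻ x, H x * ψ x ∂μ := by
    refine lintegral_congr fun x => ?_
    rw [hψ, ← ENNReal.rpow_sub_one_mul_self hp.le]
    ring
  have hYψ' : ∫⁻ x, ψ x ^ (p / (p - 1)) * σ x ∂μ = Y := by
    refine lintegral_congr_ae ?_
    filter_upwards [(hw.symm hp).mul_rpow_eq_one] with x hx
    rw [hψ, ENNReal.mul_rpow_of_nonneg _ _ (by linarith), ← ENNReal.rpow_mul,
      ← ENNReal.rpow_sub_one_mul_self hq.le (w x), mul_div_cancel₀ _ hp0.ne']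
    calc H x ^ p * (w x ^ (p / (p - 1) - 1) * w x) * σ x
        = H x ^ p * w x * (σ x * w x ^ (p / (p - 1) - 1)) := by ring
      _ = H x ^ p * w x := by rw [hx, mul_one]
  have hMψ : ∫⁻ x, famMax μ A ψ x ^ (p / (p - 1)) * σ x ∂μ ≤
      (Q ^ (p - 1)⁻¹) ^ p * buckleyConst K (p / (p - 1)) * Y := by
    have h1 := h.lintegral_famMax_rpow_le hA (hw.symm hp) hq
      (ENNReal.rpow_ne_top_of_nonneg (by positivity) hQ) hψm
    rwa [hqq, hYψ'] at h1
  have hYle : Y ≤ Γ * (((Q ^ (p / (p - 1)) * buckleyConst K p * N) ^ (1 / p)) *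
      ((Q ^ (p - 1)⁻¹) ^ p * buckleyConst K (p / (p - 1)) * Y) ^ (1 / (p / (p - 1)))) := by
    rw [hYψ]
    refine (h.lintegral_famSum_mul_le hA hF hFA hd hΓ φ hψm J).trans (mul_le_mul_right ?_ _)
    calc ∫⁻ x, M x * famMax μ A ψ x ∂μ
        = ∫⁻ x, ((fun x => M x * w x ^ (1 / p)) *
          (fun x => famMax μ A ψ x * σ x ^ (1 / (p / (p - 1))))) x ∂μ := by
          refine lintegral_congr_ae ?_
          filter_upwards [hw.mul_rpow_eq_one] with x hx
          have h1 := congrArg (fun y => y ^ (1 / p)) hx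
          simp only [ENNReal.one_rpow] at h1
          rw [ENNReal.mul_rpow_of_nonneg _ _ (by positivity), ← ENNReal.rpow_mul,
            mul_one_div] at h1
          rw [Pi.mul_apply, one_div_div]
          calc M x * famMax μ A ψ x
              = M x * famMax μ A ψ x * (w x ^ (1 / p) * σ x ^ ((p - 1) / p)) := by
                rw [h1, mul_one]
            _ = _ := by ring
      _ ≤ (∫⁻ x, (M x * w x ^ (1 / p)) ^ p ∂μ) ^ (1 / p) *
          (∫⁻ x, (famMax μ A ψ x * σ x ^ (1 / (p / (p - 1)))) ^ (p / (p - 1)) ∂μ) ^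
            (1 / (p / (p - 1))) :=
          ENNReal.lintegral_mul_le_Lp_mul_Lq μ hpq (by fun_prop) (by fun_prop)
      _ ≤ _ := by
          refine mul_le_mul' (ENNReal.rpow_le_rpow ?_ (by positivity))
            (ENNReal.rpow_le_rpow ?_ (by positivity))
          · refine le_trans (le_of_eq (lintegral_congr fun x => ?_)) hMN
            rw [ENNReal.mul_rpow_of_nonneg _ _ hpp.le, ← ENNReal.rpow_mul,
              one_div_mul_cancel hpp.ne', ENNReal.rpow_one]
          · refine le_trans (le_of_eq (lintegral_congr fun x => ?_)) (hYψ ▸ hMψ)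
            rw [ENNReal.mul_rpow_of_nonneg _ _ (by positivity), ← ENNReal.rpow_mul,
              one_div_mul_cancel (by positivity), ENNReal.rpow_one]
  set D := Γ * Q ^ (p / (p - 1)) * sparseConst K p with hD
  have hYle' : Y ≤ D * N ^ (1 / p) * Y ^ ((p - 1) / p) := by
    refine hYle.trans (le_of_eq ?_)
    -- The two Buckley factors are $Q^{1/(p-1)}$ and $Q$.
    have e1 : (Q ^ (p / (p - 1))) ^ (1 / p) * ((Q ^ (p - 1)⁻¹) ^ p) ^ ((p - 1) / p) =
        Q ^ (p / (p - 1)) := by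
      rw [← ENNReal.rpow_mul, ← ENNReal.rpow_mul, ← ENNReal.rpow_mul,
        ← ENNReal.rpow_add_of_nonneg _ _ (by positivity) (by positivity)]
      congr 1
      field_simp
      ring
    rw [one_div_div, ENNReal.mul_rpow_of_nonneg _ _ (by positivity),
      ENNReal.mul_rpow_of_nonneg _ _ (by positivity),
      ENNReal.mul_rpow_of_nonneg _ _ (by positivity),
      ENNReal.mul_rpow_of_nonneg _ _ (by positivity)]
    calc Γ * ((Q ^ (p / (p - 1))) ^ (1 / p) * buckleyConst K p ^ (1 / p) * N ^ (1 / p) *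
          (((Q ^ (p - 1)⁻¹) ^ p) ^ ((p - 1) / p) * buckleyConst K (p / (p - 1)) ^ ((p - 1) / p) *
            Y ^ ((p - 1) / p)))
        = Γ * ((Q ^ (p / (p - 1))) ^ (1 / p) * ((Q ^ (p - 1)⁻¹) ^ p) ^ ((p - 1) / p)) *
          (buckleyConst K p ^ (1 / p) * buckleyConst K (p / (p - 1)) ^ ((p - 1) / p)) *
          N ^ (1 / p) * Y ^ ((p - 1) / p) := by ac_rfl
      _ = D * N ^ (1 / p) * Y ^ ((p - 1) / p) := by rw [e1, hD, sparseConst]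
  by_cases hY0 : Y = 0
  · rw [hY0]; exact bot_le
  have hYr0 : Y ^ ((p - 1) / p) ≠ 0 := by
    simp [ENNReal.rpow_eq_zero_iff, hY0, hHtop]
  have hYrt : Y ^ ((p - 1) / p) ≠ ∞ := ENNReal.rpow_ne_top_of_nonneg (by positivity) hHtop
  have hYs : Y = Y ^ (1 / p) * Y ^ ((p - 1) / p) := by
    rw [← ENNReal.rpow_add_of_nonneg _ _ (by positivity) (by positivity), ← add_div,
      add_sub_cancel, div_self hpp.ne', ENNReal.rpow_one]
  nth_rewrite 1 [hYs] at hYle'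
  have h3 := ENNReal.rpow_le_rpow ((ENNReal.mul_le_mul_iff_left hYr0 hYrt).1 hYle') hpp.le
  rwa [ENNReal.mul_rpow_of_nonneg _ _ hpp.le, ← ENNReal.rpow_mul, ← ENNReal.rpow_mul,
    one_div_mul_cancel hpp.ne', ENNReal.rpow_one, ENNReal.rpow_one] at h3

theorem lintegral_tsum_rpow_le (h : IsBallBasis μ K 𝓑 hull) [Countable ι] (hA : ∀ i, A i ∈ 𝓑)
    (hF : ∀ i, MeasurableSet (F i)) (hFA : ∀ i, F i ⊆ A i)
    (hd : Pairwise (Function.onFun Disjoint F)) (hΓ : ∀ i, μ (A i) ≤ Γ * μ (F i))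
    (hw : IsApPair μ 𝓑 p Q w σ) (hp : 1 < p) (hQ : Q ≠ ∞) {φ : X → ℝ≥0∞} (hφ : Measurable φ)
    (hφt : ∫⁻ x, φ x ^ p * w x ∂μ ≠ ∞) :
    ∫⁻ x, (∑' i, (A i).indicator (fun _ => (∫⁻ y in A i, φ y ∂μ) / μ (A i)) x) ^ p * w x ∂μ ≤
      (Γ * Q ^ (p / (p - 1)) * sparseConst K p) ^ p * ∫⁻ x, φ x ^ p * w x ∂μ := by
  have hAm : ∀ i, MeasurableSet (A i) := fun i => h.measurableSet _ (hA i)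
  have hpp : 0 < p := by linarith
  have hwm := hw.measurable_left
  have h1 : ∀ x, (∑' i, (A i).indicator (fun _ => (∫⁻ y in A i, φ y ∂μ) / μ (A i)) x) ^ p * w x =
      ⨆ J : Finset ι, famSum μ A φ J x ^ p * w x := by
    intro x
    rw [ENNReal.tsum_eq_iSup_sum, ← ENNReal.iSup_mul]
    congr 1
    exact (ENNReal.orderIsoRpow p hpp).map_iSup _
  simp_rw [h1]
  rw [lintegral_iSup_directed]
  · exact iSup_le fun J => h.lintegral_famSum_rpow_le hA hF hFA hd hΓ hw hp hQ hφ hφt J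
  · intro J
    have : Measurable (famSum μ A φ J) :=
      Finset.measurable_sum _ fun i _ => measurable_const.indicator (hAm i)
    exact ((this.pow_const p).mul hwm).aemeasurable
  · refine Monotone.directed_le fun J J' hJ x => ?_
    simp only [famSum]
    gcongr

end IsBallBasis

/-! ### Greedy stopping sequences. -/

/-- The solution of `B n = F n B` when `F n` looks at the first `n` terms only. -/
noncomputable def seqRec {α : Type*} [Inhabited α] (F : ℕ → (ℕ → α) → α) (n : ℕ) : α :=
  F n fun m => if _h : m < n then seqRec F m else default
termination_by n

/-- Dependent choice in which each choice may look at all earlier terms; by `hloc` the default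
values from index `n` on do not matter. -/
theorem exists_seq_of_local {α : Type*} [Inhabited α] (P : ℕ → (ℕ → α) → α → Prop)
    (hloc : ∀ n b b' a, (∀ m < n, b m = b' m) → P n b a → P n b' a)
    (hex : ∀ n b, ∃ a, P n b a) : ∃ B : ℕ → α, ∀ n, P n B (B n) := by
  choose F hF using hex
  refine ⟨seqRec F, fun n => ?_⟩
  refine hloc n (fun m => if _h : m < n then seqRec F m else default) _ _
    (fun m hm => by simp [hm]) ?_
  rw [seqRec]
  exact hF n _

/-- The candidates for the `n`-th ball of a stopping sequence, given the previous balls: the balls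
that contain a point whose current ball is `B i`, and at least half of which is in `E (B i)`. -/
def stoppingCandidates {X : Type*} [MeasurableSpace X] (μ : Measure X) (𝓑 : Set (Set X))
    (hull E : Set X → Set X) (n : ℕ) (B : ℕ → Set X) : Set (Set X) :=
  {G | G ∈ 𝓑 ∧ ∃ i < n, B i ∈ 𝓑 ∧ μ G ≤ 2 * μ (G ∩ E (B i)) ∧
    ∃ x ∈ G, x ∈ hull (B i) ∧ ∀ j, i < j → j < n → B j ∈ 𝓑 → x ∉ hull (B j)}

/-- A sequence of balls, with the empty set as a placeholder, obtained by a greedy selection. -/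
structure IsStoppingSeq {X : Type*} [MeasurableSpace X] (μ : Measure X) (𝓑 : Set (Set X))
    (hull E : Set X → Set X) (B : ℕ → Set X) (par : ℕ → ℕ) (y : ℕ → X) : Prop where
  mem_or_eq_empty : ∀ n, B n ∈ 𝓑 ∨ B n = ∅
  zero_mem : B 0 ∈ 𝓑
  par_lt : ∀ n, n ≠ 0 → B n ∈ 𝓑 → par n < n
  par_mem : ∀ n, n ≠ 0 → B n ∈ 𝓑 → B (par n) ∈ 𝓑
  mem : ∀ n, n ≠ 0 → B n ∈ 𝓑 → y n ∈ B n
  mem_hull : ∀ n, n ≠ 0 → B n ∈ 𝓑 → y n ∈ hull (B (par n))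
  notMem_hull : ∀ n, n ≠ 0 → B n ∈ 𝓑 → ∀ j, par n < j → j < n → B j ∈ 𝓑 → y n ∉ hull (B j)
  density : ∀ n, n ≠ 0 → B n ∈ 𝓑 → μ (B n) ≤ 2 * μ (B n ∩ E (B (par n)))
  maximal : ∀ n, n ≠ 0 → ∀ G ∈ stoppingCandidates μ 𝓑 hull E n B, B n ∈ 𝓑 ∧ μ G ≤ 2 * μ (B n)

/-- At each stage a candidate above half the supremum of the measures is taken, or the empty set if
there is none. The parent is the most recent ball whose hull contains the witness point `y n`. -/
theorem IsBallBasis.exists_isStoppingSeq {X : Type*} [MeasurableSpace X] {μ : Measure X} {K : ℝ≥0}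
    {𝓑 : Set (Set X)} {hull E : Set X → Set X} (h : IsBallBasis μ K 𝓑 hull)
    (hE : ∀ A ∈ 𝓑, μ (E A) ≠ ∞) {A₀ : Set X} (hA₀ : A₀ ∈ 𝓑) :
    ∃ B par y, B 0 = A₀ ∧ IsStoppingSeq μ 𝓑 hull E B par y := by
  have hemp : (∅ : Set X) ∉ 𝓑 := fun h0 => by simpa using h.measure_pos _ h0
  obtain ⟨B, hB⟩ := exists_seq_of_local (α := Set X) (fun n b a =>
    (n = 0 ∧ a = A₀) ∨ (n ≠ 0 ∧ stoppingCandidates μ 𝓑 hull E n b = ∅ ∧ a = ∅) ∨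
    (n ≠ 0 ∧ a ∈ stoppingCandidates μ 𝓑 hull E n b ∧
      ∀ G ∈ stoppingCandidates μ 𝓑 hull E n b, μ G ≤ 2 * μ a)) (by
    intro n b b' a hbb
    have : stoppingCandidates μ 𝓑 hull E n b = stoppingCandidates μ 𝓑 hull E n b' := by
      ext G
      simp only [stoppingCandidates, mem_ofPred_eq]
      refine and_congr_right fun _ => exists_congr fun i => and_congr_right fun hi => ?_
      rw [hbb i hi]
      refine and_congr_right fun _ => and_congr_right fun _ => exists_congr fun x =>
        and_congr_right fun _ => and_congr_right fun _ => forall_congr' fun j =>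
        forall_congr' fun _ => forall_congr' fun hj => ?_
      rw [hbb j hj]
    rw [this]
    exact id) (by
    intro n b
    by_cases hn : n = 0
    · exact ⟨A₀, Or.inl ⟨hn, rfl⟩⟩
    set P := stoppingCandidates μ 𝓑 hull E n b with hP
    by_cases hPe : P = ∅
    · exact ⟨∅, Or.inr (Or.inl ⟨hn, hPe, rfl⟩)⟩
    obtain ⟨G₀, hG₀⟩ := nonempty_iff_ne_empty.2 hPe
    -- A candidate has at most twice the measure of one of finitely many exceptional sets.
    have hsup : (⨆ G ∈ P, μ G) ≠ ∞ := by
      have hfin : {i | i < n ∧ b i ∈ 𝓑}.Finite := (finite_lt_nat n).subset fun i hi => hi.1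
      refine ne_top_of_le_ne_top (b := ∑ i ∈ hfin.toFinset, 2 * μ (E (b i))) ?_ ?_
      · refine ENNReal.sum_ne_top.2 fun i hi => ?_
        have := hE _ (hfin.mem_toFinset.1 hi).2
        finiteness
      · refine iSup₂_le fun G hG => ?_
        obtain ⟨-, i, hi, hbi, hd, -⟩ := hG
        refine hd.trans ((mul_le_mul_right (measure_mono inter_subset_right) _).trans ?_)
        exact Finset.single_le_sum (f := fun i => 2 * μ (E (b i))) (fun _ _ => bot_le)
          (hfin.mem_toFinset.2 ⟨hi, hbi⟩)
    have hsup0 : (⨆ G ∈ P, μ G) ≠ 0 := ((h.measure_pos G₀ hG₀.1).trans_le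
      (le_iSup₂ (f := fun G (_ : G ∈ P) => μ G) G₀ hG₀)).ne'
    obtain ⟨G₁, hG₁, hlt⟩ : ∃ G₁ ∈ P, (⨆ G ∈ P, μ G) / 2 < μ G₁ := by
      simpa only [lt_iSup_iff, exists_prop] using ENNReal.half_lt_self hsup0 hsup
    refine ⟨G₁, Or.inr (Or.inr ⟨hn, hG₁, fun G hG => ?_⟩)⟩
    refine (le_iSup₂ (f := fun G (_ : G ∈ P) => μ G) G hG).trans ?_
    rw [mul_comm]
    exact (ENNReal.div_le_iff_le_mul (by simp) (by simp)).1 hlt.le)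
  have hcand : ∀ n, n ≠ 0 → B n ∈ 𝓑 → B n ∈ stoppingCandidates μ 𝓑 hull E n B := by
    intro n hn hBn
    rcases hB n with h0 | h1 | h2
    · exact absurd h0.1 hn
    · rw [h1.2.2] at hBn; exact absurd hBn hemp
    · exact h2.2.1
  have hB0 : B 0 = A₀ := by
    rcases hB 0 with h0 | h1 | h2
    · exact h0.2
    · exact absurd rfl h1.1
    · exact absurd rfl h2.1
  obtain ⟨x₀, -⟩ := h.nonempty hA₀
  have hex : ∀ n, ∃ i x, n ≠ 0 → B n ∈ 𝓑 → i < n ∧ B i ∈ 𝓑 ∧ μ (B n) ≤ 2 * μ (B n ∩ E (B i)) ∧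
      x ∈ B n ∧ x ∈ hull (B i) ∧ ∀ j, i < j → j < n → B j ∈ 𝓑 → x ∉ hull (B j) := by
    intro n
    by_cases hn : n ≠ 0 ∧ B n ∈ 𝓑
    · obtain ⟨-, i, hi, hBi, hd, x, hx⟩ := hcand n hn.1 hn.2
      exact ⟨i, x, fun _ _ => ⟨hi, hBi, hd, hx⟩⟩
    · exact ⟨0, x₀, fun h1 h2 => absurd ⟨h1, h2⟩ hn⟩
  choose par y hpy using hex
  refine ⟨B, par, y, hB0, ?_, hB0 ▸ hA₀, fun n hn hb => (hpy n hn hb).1,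
    fun n hn hb => (hpy n hn hb).2.1, fun n hn hb => (hpy n hn hb).2.2.2.1,
    fun n hn hb => (hpy n hn hb).2.2.2.2.1, fun n hn hb => (hpy n hn hb).2.2.2.2.2,
    fun n hn hb => (hpy n hn hb).2.2.1, ?_⟩
  · intro n
    rcases hB n with h0 | h1 | h2
    · exact Or.inl (h0.2 ▸ hA₀)
    · exact Or.inr h1.2.2
    · exact Or.inl h2.2.1.1
  · intro n hn G hG
    rcases hB n with h0 | h1 | h2
    · exact absurd h0.1 hn
    · rw [h1.2.1] at hG; exact absurd hG (notMem_empty _)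
    · exact ⟨h2.2.1.1, h2.2.2 G hG⟩

namespace IsStoppingSeq

variable {X : Type*} [MeasurableSpace X] {μ : Measure X} {K : ℝ≥0} {𝓑 : Set (Set X)}
  {hull E : Set X → Set X} {B : ℕ → Set X} {par : ℕ → ℕ} {y : ℕ → X} {ε : ℝ≥0∞}

/-- The children of the members of a set of indices. -/
def children (𝓑 : Set (Set X)) (B : ℕ → Set X) (par : ℕ → ℕ) (R : Set ℕ) : Set ℕ :=
  {m | m ≠ 0 ∧ B m ∈ 𝓑 ∧ par m ∈ R}

theorem measure_le_mul_measure_par (t : IsStoppingSeq μ 𝓑 hull E B par y)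
    (hE : ∀ A ∈ 𝓑, μ (E A) ≤ ε * μ A) {n : ℕ} (hn : n ≠ 0) (hB : B n ∈ 𝓑) :
    μ (B n) ≤ 2 * ε * μ (B (par n)) := by
  rw [mul_assoc]
  exact (t.density n hn hB).trans (mul_le_mul_right ((measure_mono inter_subset_right).trans
    (hE _ (t.par_mem n hn hB))) _)

/-- Measures do not increase from parent to child, so `m` may be replaced by its ancestors until the
parent is `n` or precedes `n`. In the latter case the ball was already a candidate at stage `n`, and
lost to `B n`. -/
theorem measure_le_two_mul (t : IsStoppingSeq μ 𝓑 hull E B par y)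
    (hE : ∀ A ∈ 𝓑, μ (E A) ≤ ε * μ A) (hε : 2 * ε ≤ 1) {n : ℕ} (m : ℕ)
    (hnm : n < m) (hBm : B m ∈ 𝓑) : μ (B m) ≤ 2 * μ (B n) := by
  induction m using Nat.strong_induction_on with
  | _ m ih =>
    have hm : m ≠ 0 := by omega
    by_cases hpar : par m < n
    · have hn : n ≠ 0 := by omega
      refine (t.maximal n hn (B m) ⟨hBm, par m, hpar, t.par_mem m hm hBm, t.density m hm hBm,
        y m, t.mem m hm hBm, t.mem_hull m hm hBm, fun j hj hjn hBj => ?_⟩).2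
      exact t.notMem_hull m hm hBm j hj (hjn.trans hnm) hBj
    · have h1 : μ (B m) ≤ μ (B (par m)) :=
        (t.measure_le_mul_measure_par hE hm hBm).trans (mul_le_of_le_one_left' hε)
      rcases (not_lt.1 hpar).eq_or_lt with h2 | h2
      · rw [h2, two_mul]
        exact h1.trans le_self_add
      · exact h1.trans (ih _ (t.par_lt m hm hBm) h2 (t.par_mem m hm hBm))

theorem subset_hull_of_lt (t : IsStoppingSeq μ 𝓑 hull E B par y) (h : IsBallBasis μ K 𝓑 hull)
    (hE : ∀ A ∈ 𝓑, μ (E A) ≤ ε * μ A) (hε : 2 * ε ≤ 1) {n m : ℕ} (hBn : B n ∈ 𝓑)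
    (hnm : n < m) (hBm : B m ∈ 𝓑) (hmeet : (B m ∩ B n).Nonempty) : B m ⊆ hull (B n) :=
  h.subset_hull _ hBn _ hBm (t.measure_le_two_mul hE hε m hnm hBm) hmeet

/-- The later ball lies in the hull of `B n`, so its witness point does; the parent is the most
recent such index. -/
theorem le_par_of_inter_nonempty (t : IsStoppingSeq μ 𝓑 hull E B par y)
    (h : IsBallBasis μ K 𝓑 hull) (hE : ∀ A ∈ 𝓑, μ (E A) ≤ ε * μ A) (hε : 2 * ε ≤ 1) {n m : ℕ}
    (hBn : B n ∈ 𝓑) (hnm : n < m) (hBm : B m ∈ 𝓑) (hmeet : (B m ∩ B n).Nonempty) :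
    n ≤ par m := by
  by_contra hlt
  have hm : m ≠ 0 := by omega
  exact t.notMem_hull m hm hBm n (not_le.1 hlt) hnm hBn
    (t.subset_hull_of_lt h hE hε hBn hnm hBm hmeet (t.mem m hm hBm))

theorem tsum_measure_le (h : IsBallBasis μ K 𝓑 hull) {S : Set ℕ} (hS : ∀ m ∈ S, B m ∈ 𝓑)
    (hd : S.PairwiseDisjoint B) {E : Set X} (hE : MeasurableSet E) :
    ∑' m : S, μ (B m ∩ E) ≤ μ ((⋃ m ∈ S, B m) ∩ E) := by
  rw [← Measure.restrict_apply' hE, measure_biUnion (to_countable S) hd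
    fun m hm => h.measurableSet _ (hS m hm)]
  exact le_of_eq (tsum_congr fun m => (Measure.restrict_apply' hE).symm)

/-- Siblings are disjoint: if the later met the earlier, its parent could not precede the earlier.
At least half of each child lies in the exceptional set of the parent. -/
theorem tsum_children_le (t : IsStoppingSeq μ 𝓑 hull E B par y) (h : IsBallBasis μ K 𝓑 hull)
    (hEm : ∀ A ∈ 𝓑, MeasurableSet (E A)) (hE : ∀ A ∈ 𝓑, μ (E A) ≤ ε * μ A) (hε : 2 * ε ≤ 1)
    (R : Set ℕ) :
    ∑' m : children 𝓑 B par R, μ (B m) ≤ 2 * ε * ∑' m : R, μ (B m) := by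
  have hU : children 𝓑 B par R = ⋃ i ∈ R, children 𝓑 B par {i} := by
    ext m; simp [children]
  rw [hU, ← ENNReal.tsum_mul_left]
  refine (ENNReal.tsum_biUnion_le_tsum (fun m => μ (B m)) R _).trans
    (ENNReal.tsum_le_tsum fun i => ?_)
  set S := children 𝓑 B par {(i : ℕ)} with hS
  by_cases hBi : B i ∈ 𝓑
  swap
  · have : IsEmpty S := ⟨fun ⟨m, hm⟩ => hBi (by
      have := t.par_mem m hm.1 hm.2.1
      rwa [mem_singleton_iff.1 hm.2.2] at this)⟩
    simp
  have hd : S.PairwiseDisjoint B := by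
    have key : ∀ m ∈ S, ∀ m' ∈ S, m < m' → Disjoint (B m) (B m') := by
      intro m hm m' hm' hlt
      by_contra hdis
      have h1 := t.le_par_of_inter_nonempty h hE hε hm.2.1 hlt hm'.2.1
        (by rw [inter_comm]; exact not_disjoint_iff_nonempty_inter.1 hdis)
      have h2 := t.par_lt m hm.1 hm.2.1
      rw [mem_singleton_iff.1 hm.2.2] at h2
      rw [mem_singleton_iff.1 hm'.2.2] at h1
      omega
    intro m hm m' hm' hne
    rcases lt_or_gt_of_ne hne with h1 | h1
    · exact key m hm m' hm' h1
    · exact (key m' hm' m hm h1).symm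
  calc ∑' m : S, μ (B m) ≤ ∑' m : S, 2 * μ (B m ∩ E (B i)) := ENNReal.tsum_le_tsum fun m => by
        have := t.density m m.2.1 m.2.2.1
        rwa [mem_singleton_iff.1 m.2.2.2] at this
    _ = 2 * ∑' m : S, μ (B m ∩ E (B i)) := ENNReal.tsum_mul_left
    _ ≤ 2 * μ (E (B i)) := mul_le_mul_right ((tsum_measure_le h (fun m hm => hm.2.1) hd
        (hEm _ hBi)).trans (measure_mono inter_subset_right)) _
    _ ≤ 2 * ε * μ (B i) := by rw [mul_assoc]; exact mul_le_mul_right (hE _ hBi) _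

/-- A geometric series over generations: children carry at most half the measure of their parents,
and this half is absorbed. -/
theorem tsum_le_of_subset_union_children (t : IsStoppingSeq μ 𝓑 hull E B par y)
    (h : IsBallBasis μ K 𝓑 hull) (hEm : ∀ A ∈ 𝓑, MeasurableSet (E A))
    (hE : ∀ A ∈ 𝓑, μ (E A) ≤ ε * μ A) (hε : 4 * ε ≤ 1) {R Q : Set ℕ}
    (hR : R ⊆ Q ∪ children 𝓑 B par R) : ∑' m : R, μ (B m) ≤ 2 * ∑' m : Q, μ (B m) := by
  have hε2 : 2 * ε ≤ 1 := le_trans (by gcongr; norm_num) hε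
  have hfinB : ∀ m, μ (B m) ≠ ∞ := fun m => by
    rcases t.mem_or_eq_empty m with h1 | h1
    · exact (h.measure_lt_top _ h1).ne
    · simp [h1]
  rw [tsum_subtype R (fun m => μ (B m))]
  refine ENNReal.tsum_le_of_sum_range_le fun N => ?_
  -- Truncation makes the absorbed sum finite, and keeps the hypothesis because parents precede
  -- children.
  set RN := R ∩ Iio N with hRN
  have hsub : RN ⊆ Q ∪ children 𝓑 B par RN := by
    intro m hm
    rcases hR hm.1 with h1 | h1
    · exact Or.inl h1
    · exact Or.inr ⟨h1.1, h1.2.1, h1.2.2, (t.par_lt m h1.1 h1.2.1).trans hm.2⟩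
  set s := ∑' m : RN, μ (B m) with hs
  have hsle : ∑ m ∈ Finset.range N, R.indicator (fun m => μ (B m)) m = s := by
    rw [hs, tsum_subtype RN (fun m => μ (B m)), tsum_eq_sum (s := Finset.range N)]
    · refine Finset.sum_congr rfl fun m hm => ?_
      have hm' : m < N := Finset.mem_range.1 hm
      by_cases hmR : m ∈ R <;> simp [hRN, hmR, hm']
    · intro m hm
      refine indicator_of_notMem (fun hm' => hm (Finset.mem_range.2 hm'.2)) _
  rw [hsle]
  have hst : s ≠ ∞ := by
    rw [← hsle]
    refine ENNReal.sum_ne_top.2 fun m _ => ne_top_of_le_ne_top (hfinB m) ?_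
    exact indicator_le_self' (fun _ _ => bot_le) _
  have h1 : s ≤ ∑' m : Q, μ (B m) + 2 * ε * s :=
    (ENNReal.tsum_mono_subtype (fun m => μ (B m)) hsub).trans
      ((ENNReal.tsum_union_le (fun m => μ (B m)) _ _).trans
        (add_le_add_right (t.tsum_children_le h hEm hE hε2 RN) _))
  have h2 : s + s ≤ 2 * ∑' m : Q, μ (B m) + s := by
    calc s + s = 2 * s := (two_mul s).symm
      _ ≤ 2 * (∑' m : Q, μ (B m) + 2 * ε * s) := mul_le_mul_right h1 _
      _ = 2 * ∑' m : Q, μ (B m) + 4 * ε * s := by ring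
      _ ≤ 2 * ∑' m : Q, μ (B m) + s := add_le_add_right (mul_le_of_le_one_left' hε) _
  exact (ENNReal.add_le_add_iff_right hst).1 h2

/-- A child is so small that even its triple hull is admissible in the hull axiom for the parent's
hull, which it meets at `y n`. Hence double hulls are nested along chains of parents. -/
theorem iterate_hull_subset (t : IsStoppingSeq μ 𝓑 hull E B par y) (h : IsBallBasis μ K 𝓑 hull)
    (hE : ∀ A ∈ 𝓑, μ (E A) ≤ ε * μ A) (hε : 24 * K ^ 4 * ε ≤ 1) {n : ℕ} (hn : n ≠ 0)
    (hB : B n ∈ 𝓑) : hull^[3] (B n) ⊆ hull^[2] (B (par n)) := by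
  have hP := t.par_mem n hn hB
  have hK := h.one_le_const hP
  have hsub : B n ⊆ hull^[3] (B n) := h.subset_iterate_hull hB 3
  refine h.subset_hull _ (h.hull_mem _ hP) _ (h.iterate_hull_mem hB 3) ?_
    ⟨y n, hsub (t.mem n hn hB), t.mem_hull n hn hB⟩
  calc μ (hull^[3] (B n)) ≤ K ^ 3 * (2 * ε * μ (B (par n))) :=
        (h.measure_iterate_hull_le hB 3).trans
          (mul_le_mul_right (t.measure_le_mul_measure_par hE hn hB) _)
    _ = 2 * K ^ 3 * ε * μ (B (par n)) := by ring
    _ ≤ 24 * K ^ 4 * ε * μ (B (par n)) := by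
        gcongr
        · norm_num
        · norm_num
    _ ≤ 1 * μ (B (par n)) := by gcongr
    _ ≤ 2 * μ (hull (B (par n))) := by
        gcongr
        · norm_num
        · exact h.self_subset_hull hP

end IsStoppingSeq

/-! ### Sparseness and exhaustion for stopping sequences. -/

namespace IsStoppingSeq

variable {X : Type*} [MeasurableSpace X] {μ : Measure X} {K : ℝ≥0} {𝓑 : Set (Set X)}
  {hull E : Set X → Set X} {B : ℕ → Set X} {par : ℕ → ℕ} {y : ℕ → X} {ε : ℝ≥0∞}

/-- The later balls of the sequence that meet `B n`. -/
def later (𝓑 : Set (Set X)) (B : ℕ → Set X) (n : ℕ) : Set ℕ :=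
  {m | n < m ∧ B m ∈ 𝓑 ∧ (B m ∩ B n).Nonempty}

theorem iterate_two_hull_subset (t : IsStoppingSeq μ 𝓑 hull E B par y)
    (h : IsBallBasis μ K 𝓑 hull) (hE : ∀ A ∈ 𝓑, μ (E A) ≤ ε * μ A) (hε : 24 * K ^ 4 * ε ≤ 1)
    {n : ℕ} (hn : n ≠ 0) (hB : B n ∈ 𝓑) : hull^[2] (B n) ⊆ hull^[2] (B (par n)) := by
  refine Subset.trans ?_ (t.iterate_hull_subset h hE hε hn hB)
  rw [Function.iterate_succ_apply' hull 2]
  exact h.self_subset_hull (h.iterate_hull_mem hB 2)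

/-- Along the parents of a later ball that meets `B n`, the double hulls keep meeting `B n`; so the
ball descends from `n` or from some $q>n$ with parent at most $n$ (the set `Q₁`). The balls of `Q₁`
have total measure at most $2K^4\mu(B_n)$, and the passage to descendants gains the factor
$\varepsilon$. -/
theorem tsum_later_le (t : IsStoppingSeq μ 𝓑 hull E B par y)
    (h : IsBallBasis μ K 𝓑 hull) (hEm : ∀ A ∈ 𝓑, MeasurableSet (E A))
    (hE : ∀ A ∈ 𝓑, μ (E A) ≤ ε * μ A) (hε : 24 * K ^ 4 * ε ≤ 1) {n : ℕ} (hBn : B n ∈ 𝓑) :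
    2 * ∑' m : later 𝓑 B n, μ (B m) ≤ μ (B n) := by
  have hK := h.one_le_const hBn
  have hK4 : (1 : ℝ≥0∞) ≤ K ^ 4 := one_le_pow₀ hK
  have hε4 : 4 * ε ≤ 1 := by
    refine le_trans ?_ hε
    calc 4 * ε = 4 * 1 * ε := by ring
      _ ≤ 24 * K ^ 4 * ε := by gcongr; norm_num
  have hε2 : 2 * ε ≤ 1 := le_trans (by gcongr; norm_num) hε4
  set Q₁ : Set ℕ := {q | n < q ∧ B q ∈ 𝓑 ∧ par q ≤ n ∧ (hull^[2] (B q) ∩ B n).Nonempty} with hQ₁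
  set R : Set ℕ := {m | m = n ∨ (n < m ∧ B m ∈ 𝓑 ∧ (hull^[2] (B m) ∩ B n).Nonempty)} with hR
  have hparR : ∀ m, n < m → B m ∈ 𝓑 → n ≤ par m → (hull^[2] (B m) ∩ B n).Nonempty →
      par m ∈ R := by
    intro m hm hBm hpar hmeet
    have hm0 : m ≠ 0 := by omega
    rcases hpar.eq_or_lt with h1 | h1
    · exact Or.inl h1.symm
    · exact Or.inr ⟨h1, t.par_mem m hm0 hBm, hmeet.mono (inter_subset_inter_left _
        (t.iterate_two_hull_subset h hE hε hm0 hBm))⟩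
  have hRsub : R ⊆ ({n} ∪ Q₁) ∪ children 𝓑 B par R := by
    rintro m (rfl | ⟨hm, hBm, hmeet⟩)
    · exact Or.inl (Or.inl rfl)
    · rcases le_total (par m) n with h1 | h1
      · exact Or.inl (Or.inr ⟨hm, hBm, h1, hmeet⟩)
      · exact Or.inr ⟨by omega, hBm, hparR m hm hBm h1 hmeet⟩
  have hlater : later 𝓑 B n ⊆ children 𝓑 B par R := by
    rintro m ⟨hm, hBm, hmeet⟩
    refine ⟨by omega, hBm, hparR m hm hBm
      (t.le_par_of_inter_nonempty h hE hε2 hBn hm hBm hmeet) ?_⟩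
    exact hmeet.mono (inter_subset_inter_left _ (h.subset_iterate_hull hBm 2))
  have hQ₁sum : ∑' q : Q₁, μ (B q) ≤ 2 * K ^ 4 * μ (B n) := by
    -- A later ball has at most twice the measure of `B n`; its double hull costs a further $K^2$.
    obtain ⟨G, hG, hGμ, hGsub⟩ := h.exists_ball_superset hBn (c := 2 * K ^ 2)
      (by
        calc (1 : ℝ≥0∞) = 1 * 1 := by norm_num
          _ ≤ 2 * K ^ 2 := mul_le_mul' (by norm_num) (one_le_pow₀ hK)) (by finiteness)
    have hd : Q₁.PairwiseDisjoint B := by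
      -- If $m<m'$ met, then $m\le$ `par m'` $\le n$, against $n<m$.
      have key : ∀ m ∈ Q₁, ∀ m' ∈ Q₁, m < m' → Disjoint (B m) (B m') := by
        intro m hm m' hm' hlt
        by_contra hdis
        have h1 := t.le_par_of_inter_nonempty h hE hε2 hm.2.1 hlt hm'.2.1
          (by rw [inter_comm]; exact not_disjoint_iff_nonempty_inter.1 hdis)
        exact absurd (h1.trans hm'.2.2.1) (not_le.2 hm.1)
      intro m hm m' hm' hne
      rcases lt_or_gt_of_ne hne with h1 | h1
      · exact key m hm m' hm' h1
      · exact (key m' hm' m hm h1).symm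
    have h1 := tsum_measure_le h (fun m (hm : m ∈ Q₁) => hm.2.1) hd MeasurableSet.univ
    simp only [inter_univ] at h1
    refine h1.trans ((measure_mono (iUnion₂_subset fun q hq => ?_)).trans
      (hGμ.trans (le_of_eq (by ring))))
    refine (h.subset_iterate_hull hq.2.1 2).trans
      (hGsub _ (h.iterate_hull_mem hq.2.1 2) hq.2.2.2 ?_)
    calc μ (hull^[2] (B q)) ≤ K ^ 2 * (2 * μ (B n)) :=
          (h.measure_iterate_hull_le hq.2.1 2).trans (mul_le_mul_right
            (t.measure_le_two_mul hE hε2 q hq.1 hq.2.1) _)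
      _ = 2 * K ^ 2 * μ (B n) := by ring
  have hsing : ∑' m : ({n} : Set ℕ), μ (B m) = μ (B n) := by
    rw [tsum_singleton n (fun m => μ (B m))]
  calc 2 * ∑' m : later 𝓑 B n, μ (B m)
      ≤ 2 * (2 * ε * (2 * (μ (B n) + 2 * K ^ 4 * μ (B n)))) := by
        gcongr
        refine (ENNReal.tsum_mono_subtype (fun m => μ (B m)) hlater).trans
          ((t.tsum_children_le h hEm hE hε2 R).trans (mul_le_mul_right ?_ _))
        refine (t.tsum_le_of_subset_union_children h hEm hE hε4 hRsub).trans
          (mul_le_mul_right ?_ _)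
        refine (ENNReal.tsum_union_le (fun m => μ (B m)) _ _).trans ?_
        rw [hsing]
        gcongr
    _ ≤ 2 * (2 * ε * (2 * (K ^ 4 * μ (B n) + 2 * K ^ 4 * μ (B n)))) := by
        gcongr
        exact le_mul_of_one_le_left' hK4
    _ = 24 * K ^ 4 * ε * μ (B n) := by ring
    _ ≤ μ (B n) := mul_le_of_le_one_left' hε

/-- The balls of a stopping sequence form a sparse family. -/
theorem exists_disjoint_parts (t : IsStoppingSeq μ 𝓑 hull E B par y)
    (h : IsBallBasis μ K 𝓑 hull) (hEm : ∀ A ∈ 𝓑, MeasurableSet (E A))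
    (hE : ∀ A ∈ 𝓑, μ (E A) ≤ ε * μ A) (hε : 24 * K ^ 4 * ε ≤ 1) :
    ∃ F : {n // B n ∈ 𝓑} → Set X, (∀ i, MeasurableSet (F i)) ∧ (∀ i, F i ⊆ B i.1) ∧
      Pairwise (Function.onFun Disjoint F) ∧ ∀ i, μ (B i.1) ≤ 2 * μ (F i) := by
  refine ⟨fun i => B i \ ⋃ m ∈ later 𝓑 B i, B m, fun i => (h.measurableSet _ i.2).diff
    (MeasurableSet.biUnion (to_countable _) fun m hm => h.measurableSet _ hm.2.1),
    fun i => sdiff_subset, ?_, fun i => ?_⟩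
  · have key : ∀ i j : {n // B n ∈ 𝓑}, (i : ℕ) < j →
        Disjoint (B i \ ⋃ m ∈ later 𝓑 B i, B m) (B j \ ⋃ m ∈ later 𝓑 B j, B m) := by
      intro i j hij
      refine disjoint_left.2 fun x hx hx' => hx.2 ?_
      exact mem_biUnion (show (j : ℕ) ∈ later 𝓑 B i from ⟨hij, j.2, x, hx'.1, hx.1⟩) hx'.1
    intro i j hne
    rcases lt_or_gt_of_ne (fun h1 => hne (Subtype.ext h1)) with h1 | h1
    · exact key i j h1
    · exact (key j i h1).symm
  · set U := ⋃ m ∈ later 𝓑 B i, B m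
    have hU : 2 * μ U ≤ μ (B i) :=
      (mul_le_mul_right (measure_biUnion_le μ (to_countable _) _) _).trans
        (t.tsum_later_le h hEm hE hε i.2)
    have hBt : μ (B i) ≠ ∞ := (h.measure_lt_top _ i.2).ne
    have h1 : μ (B i) ≤ μ (B i \ U) + μ U :=
      (measure_mono (by rw [sdiff_union_self]; exact subset_union_left)).trans
        (measure_union_le _ _)
    have h2 : μ (B i) + μ (B i) ≤ 2 * μ (B i \ U) + μ (B i) := by
      calc μ (B i) + μ (B i) = 2 * μ (B i) := (two_mul _).symm
        _ ≤ 2 * (μ (B i \ U) + μ U) := mul_le_mul_right h1 _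
        _ = 2 * μ (B i \ U) + 2 * μ U := mul_add _ _ _
        _ ≤ 2 * μ (B i \ U) + μ (B i) := add_le_add_right hU _
    exact (ENNReal.add_le_add_iff_right hBt).1 h2

/-- Almost every point of the first hull lies in a last hull, outside of its exceptional set. -/
theorem ae_exists_mem_hull_notMem (t : IsStoppingSeq μ 𝓑 hull E B par y)
    (h : IsBallBasis μ K 𝓑 hull) (hEm : ∀ A ∈ 𝓑, MeasurableSet (E A))
    (hE : ∀ A ∈ 𝓑, μ (E A) ≤ ε * μ A) (hε : 4 * ε ≤ 1) :
    ∀ᵐ x ∂μ, x ∈ hull (B 0) → ∃ n, B n ∈ 𝓑 ∧ x ∈ hull (B n) ∧ x ∉ E (B n) := by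
  set R : Set ℕ := {n | B n ∈ 𝓑} with hR
  have hRsum : ∑' m : R, μ (B m) ≠ ∞ := by
    have h1 : R ⊆ {0} ∪ children 𝓑 B par R := by
      intro m hm
      by_cases hm0 : m = 0
      · exact Or.inl hm0
      · exact Or.inr ⟨hm0, hm, t.par_mem m hm0 hm⟩
    refine ne_top_of_le_ne_top ?_ (t.tsum_le_of_subset_union_children h hEm hE hε h1)
    rw [tsum_singleton 0 (fun m => μ (B m))]
    have := (h.measure_lt_top _ t.zero_mem).ne
    finiteness
  have hsum : ∑' m, μ (B m) ≠ ∞ := by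
    rwa [tsum_subtype_eq_of_support_subset (f := fun m => μ (B m))] at hRsum
    intro m hm
    rcases t.mem_or_eq_empty m with h1 | h1
    · exact h1
    · simp [h1] at hm
  have hlim := ENNReal.tendsto_atTop_zero_of_tsum_ne_top hsum
  set H : ℕ → Set X := fun n => {x | B n ∈ 𝓑 ∧ x ∈ hull (B n)} with hH
  have hHsum : ∑' n, μ (H n) ≠ ∞ := by
    refine ne_top_of_le_ne_top (ENNReal.mul_ne_top (ENNReal.coe_ne_top (r := K)) hsum) ?_
    rw [← ENNReal.tsum_mul_left]
    refine ENNReal.tsum_le_tsum fun n => ?_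
    by_cases hn : B n ∈ 𝓑
    · exact (measure_mono fun x hx => hx.2).trans (h.measure_hull_le _ hn)
    · have : H n = ∅ := eq_empty_of_forall_notMem fun x hx => hn hx.1
      simp [this]
  have hdens : ∀ᵐ x ∂μ, ∀ n, B n ∈ 𝓑 → x ∈ E (B n) →
      ∃ G ∈ 𝓑, x ∈ G ∧ μ G ≤ 2 * μ (G ∩ E (B n)) := by
    refine ae_all_iff.2 fun n => ?_
    by_cases hn : B n ∈ 𝓑
    · filter_upwards [h.ae_exists_density_ball (hEm _ hn)] with x hx _ using hx
    · exact Filter.Eventually.of_forall fun x hx => absurd hx hn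
  filter_upwards [hdens, ae_finite_setOfPred_mem hHsum] with x hx hfin hx0
  -- By Borel–Cantelli almost every point lies in finitely many hulls; `n` is the last of them.
  obtain ⟨n, hn, hmax⟩ := hfin.exists_maximal (⟨0, t.zero_mem, hx0⟩ : {n | x ∈ H n}.Nonempty)
  refine ⟨n, hn.1, hn.2, fun hxE => ?_⟩
  obtain ⟨G, hG, hxG, hGd⟩ := hx n hn.1 hxE
  -- Were the point exceptional for `B n`, its density ball would be a candidate at every later
  -- stage, while the measures of the selected balls tend to 0.
  have hcand : ∀ m, n < m → μ G ≤ 2 * μ (B m) := fun m hm =>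
    (t.maximal m (by omega) G ⟨hG, n, hm, hn.1, hGd, x, hxG, hn.2, fun j hj _ hBj hxj =>
      absurd (hmax (show j ∈ {n | x ∈ H n} from ⟨hBj, hxj⟩) hj.le) (not_le.2 hj)⟩).2
  have hpos : 0 < μ G / 2 := ENNReal.half_pos (h.measure_pos _ hG).ne'
  obtain ⟨m, hm, hm'⟩ := ((Filter.eventually_gt_atTop n).and (hlim.eventually_lt_const hpos)).exists
  refine hm'.not_ge ?_
  rw [ENNReal.div_le_iff_le_mul (by simp) (by simp), mul_comm]
  exact hcand m hm

end IsStoppingSeq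

/-! ### Weak-type and oscillation estimates for the operator. -/

theorem le_weakOneNorm {X : Type*} [MeasurableSpace X] {μ : Measure X} (T : (X → ℝ) → (X → ℝ))
    {t : ℝ} (ht : 0 < t) {f : X → ℝ} (hf : Integrable f μ) :
    ENNReal.ofReal t * μ {x | t < |T f x|} / ∫⁻ x, ‖f x‖ₑ ∂μ ≤ weakOneNorm μ T :=
  le_iSup₂_of_le t ht (le_iSup₂_of_le f hf le_rfl)

theorem le_locConst {X : Type*} [MeasurableSpace X] {μ : Measure X} {𝓑 : Set (Set X)}
    {hull : Set X → Set X} (T : (X → ℝ) → (X → ℝ)) {B : Set X} (hB : B ∈ 𝓑) {x x' : X}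
    (hx : x ∈ B) (hx' : x' ∈ B) {f : X → ℝ} (hf : Integrable f μ) :
    ‖T ((hull B)ᶜ.indicator f) x - T ((hull B)ᶜ.indicator f) x'‖ₑ / ballAvgSup μ 𝓑 B f ≤
      locConst μ 𝓑 hull T :=
  le_iSup₂_of_le B hB (le_iSup₂_of_le x hx (le_iSup₂_of_le x' hx'
    (le_iSup₂_of_le f hf le_rfl)))

theorem le_connDelta {X : Type*} [MeasurableSpace X] {μ : Measure X}
    (hull : Set X → Set X) (T : (X → ℝ) → (X → ℝ)) {A : Set X} (B : Set X) {x : X}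
    (hx : x ∈ A) {f : X → ℝ} (hf : Integrable f μ) :
    ‖T ((hull B \ hull A).indicator f) x‖ₑ / ballAvg μ (hull B) f ≤ connDelta μ hull T A B :=
  le_iSup₂_of_le x hx (le_iSup₂_of_le f hf le_rfl)

/-- The infimum over larger balls need not be attained, hence the strict inequalities. -/
theorem exists_connDelta_lt {X : Type*} [MeasurableSpace X] {μ : Measure X} {𝓑 : Set (Set X)}
    {hull : Set X → Set X} {T : (X → ℝ) → (X → ℝ)} {L : ℝ≥0∞} (hL : connConst μ 𝓑 hull T < L)
    {A : Set X} (hA : A ∈ 𝓑) (hA' : hull A ≠ univ) :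
    ∃ B ∈ 𝓑, A ⊂ B ∧ connDelta μ hull T A B < L := by
  have h1 : (⨅ B ∈ 𝓑, ⨅ (_ : A ⊂ B), connDelta μ hull T A B) < L :=
    lt_of_le_of_lt (le_iSup₂_of_le (f := fun A (_ : A ∈ 𝓑) => ⨆ (_ : hull A ≠ univ),
      ⨅ B ∈ 𝓑, ⨅ (_ : A ⊂ B), connDelta μ hull T A B) A hA (le_iSup_of_le hA' le_rfl)) hL
  simpa only [iInf_lt_iff, exists_prop] using h1

namespace IsSubadditiveOp

variable {X : Type*} [MeasurableSpace X] {μ : Measure X} {T : (X → ℝ) → (X → ℝ)}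

theorem enorm_add_le (hT : IsSubadditiveOp μ T) {f g : X → ℝ} (hf : Integrable f μ)
    (hg : Integrable g μ) (x : X) : ‖T (f + g) x‖ₑ ≤ ‖T f x‖ₑ + ‖T g x‖ₑ := by
  simp only [Real.enorm_eq_ofReal_abs]
  rw [← ENNReal.ofReal_add (abs_nonneg _) (abs_nonneg _)]
  exact ENNReal.ofReal_le_ofReal (hT.abs_add_le f g hf hg x)

theorem enorm_sub_le (hT : IsSubadditiveOp μ T) {f g : X → ℝ} (hf : Integrable f μ)
    (hg : Integrable g μ) (x : X) : ‖T (f - g) x‖ₑ ≤ ‖T f x‖ₑ + ‖T g x‖ₑ := by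
  have h1 : f - g = f + (-1 : ℝ) • g := by ext; simp [sub_eq_add_neg]
  have h2 : ‖T ((-1 : ℝ) • g) x‖ₑ = ‖T g x‖ₑ := by
    simp only [Real.enorm_eq_ofReal_abs, hT.abs_smul _ g hg x, abs_neg, abs_one, one_mul]
  rw [h1, ← h2]
  exact hT.enorm_add_le hf (hg.smul _) x

/-- The degenerate cases, where the convention $a/0=\infty$ or a vanishing norm forces null level
sets. -/
theorem measure_lt_eq_zero (hW : weakOneNorm μ T ≠ ∞) {f : X → ℝ} (hf : Integrable f μ)
    (h0 : weakOneNorm μ T = 0 ∨ ∫⁻ x, ‖f x‖ₑ ∂μ = 0) : μ {x | 0 < ‖T f x‖ₑ} = 0 := by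
  have hle : ∀ t : ℝ, 0 < t → μ {x | t < |T f x|} = 0 := by
    intro t ht
    have h1 : ENNReal.ofReal t * μ {x | t < |T f x|} / ∫⁻ x, ‖f x‖ₑ ∂μ ≤ weakOneNorm μ T :=
      le_weakOneNorm T ht hf
    have ht' : ENNReal.ofReal t ≠ 0 := (ENNReal.ofReal_pos.2 ht).ne'
    have hft : ∫⁻ x, ‖f x‖ₑ ∂μ ≠ ∞ := hf.2.ne
    by_contra hne
    have hne' : ENNReal.ofReal t * μ {x | t < |T f x|} ≠ 0 := mul_ne_zero ht' hne
    rcases h0 with h0 | h0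
    · rw [h0, nonpos_iff_eq_zero, ENNReal.div_eq_zero_iff] at h1
      exact h1.elim hne' hft
    · rw [h0, ENNReal.div_zero hne'] at h1
      exact hW (top_le_iff.1 h1)
  have hU : {x | 0 < ‖T f x‖ₑ} ⊆ ⋃ n : ℕ, {x | 1 / ((n : ℝ) + 1) < |T f x|} := by
    intro x hx
    have hx' : 0 < |T f x| := by
      simpa [Real.enorm_eq_ofReal_abs] using hx
    obtain ⟨n, hn⟩ := exists_nat_one_div_lt hx'
    exact mem_iUnion.2 ⟨n, hn⟩
  exact measure_mono_null hU (measure_iUnion_null fun n => hle _ (by positivity))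

/-- The weak-type inequality in the form in which good points are found: `N` is chosen so that the
bad set fills a prescribed fraction $1/N$ of the measure `m`. -/
theorem measure_lt_enorm_le {L : ℝ≥0∞} (hW : weakOneNorm μ T ≤ L) (hL0 : L ≠ 0) (hL : L ≠ ∞)
    {f : X → ℝ} (hf : Integrable f μ) {s m N : ℝ≥0∞} (hs : s ≠ ∞) (hN0 : N ≠ 0)
    (hN : N ≠ ∞) (hI : ∫⁻ x, ‖f x‖ₑ ∂μ ≤ s * m) : μ {x | N * L * s < ‖T f x‖ₑ} ≤ m / N := by
  have hWt : weakOneNorm μ T ≠ ∞ := ne_top_of_le_ne_top hL hW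
  by_cases hf0 : ∫⁻ x, ‖f x‖ₑ ∂μ = 0
  · refine (measure_mono fun x (hx : N * L * s < ‖T f x‖ₑ) => ?_).trans
      ((measure_lt_eq_zero hWt hf (Or.inr hf0)).le.trans bot_le)
    exact bot_le.trans_lt hx
  have hs0 : s ≠ 0 := fun h => hf0 (by simpa [h] using hI)
  set c := N * L * s with hc
  have hc0 : c ≠ 0 := mul_ne_zero (mul_ne_zero hN0 hL0) hs0
  have hct : c ≠ ∞ := by finiteness
  have hset : {x | c < ‖T f x‖ₑ} = {x | c.toReal < |T f x|} := by
    ext x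
    rw [mem_ofPred_eq, mem_ofPred_eq, Real.enorm_eq_ofReal_abs]
    rw [ENNReal.lt_ofReal_iff_toReal_lt hct]
  have h1 : ENNReal.ofReal c.toReal * μ {x | c.toReal < |T f x|} / ∫⁻ x, ‖f x‖ₑ ∂μ ≤ L :=
    (le_weakOneNorm T (ENNReal.toReal_pos hc0 hct) hf).trans hW
  rw [ENNReal.ofReal_toReal hct, ← hset, ENNReal.div_le_iff_le_mul (Or.inl hf0)
    (Or.inl hf.2.ne)] at h1
  rw [ENNReal.le_div_iff_mul_le (Or.inl hN0) (Or.inl hN)]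
  have h2 : (L * s) * (μ {x | c < ‖T f x‖ₑ} * N) ≤ (L * s) * m := by
    calc (L * s) * (μ {x | c < ‖T f x‖ₑ} * N) = c * μ {x | c < ‖T f x‖ₑ} := by rw [hc]; ring
      _ ≤ L * ∫⁻ x, ‖f x‖ₑ ∂μ := h1
      _ ≤ L * (s * m) := mul_le_mul_right hI _
      _ = (L * s) * m := by ring
  exact (ENNReal.mul_le_mul_iff_right (mul_ne_zero hL0 hs0) (by finiteness)).1 h2

end IsSubadditiveOp

theorem ballAvg_mono {X : Type*} [MeasurableSpace X] (μ : Measure X) (B : Set X) {f g : X → ℝ}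
    (hfg : ∀ x, ‖f x‖ₑ ≤ ‖g x‖ₑ) : ballAvg μ B f ≤ ballAvg μ B g :=
  ENNReal.div_le_div_right (lintegral_mono hfg) _

theorem enorm_indicator_le {X : Type*} (S : Set X) (f : X → ℝ) (x : X) :
    ‖S.indicator f x‖ₑ ≤ ‖f x‖ₑ := by
  rw [enorm_indicator_eq_indicator_enorm]
  exact indicator_le_self' (fun _ _ => bot_le) _

theorem lintegral_enorm_indicator {X : Type*} [MeasurableSpace X] (μ : Measure X) {S : Set X}
    (hS : MeasurableSet S) (f : X → ℝ) :
    ∫⁻ x, ‖S.indicator f x‖ₑ ∂μ = ∫⁻ x in S, ‖f x‖ₑ ∂μ := by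
  simp_rw [enorm_indicator_eq_indicator_enorm]
  exact lintegral_indicator hS _

namespace IsBallBasis

variable {X : Type*} [MeasurableSpace X] {μ : Measure X} {K : ℝ≥0} {𝓑 : Set (Set X)}
  {hull : Set X → Set X} {T : (X → ℝ) → (X → ℝ)} {L : ℝ≥0∞}

theorem ballAvg_mul_measure (h : IsBallBasis μ K 𝓑 hull) {B : Set X} (hB : B ∈ 𝓑) (f : X → ℝ) :
    ballAvg μ B f * μ B = ∫⁻ x in B, ‖f x‖ₑ ∂μ :=
  ENNReal.div_mul_cancel (h.measure_pos _ hB).ne' (h.measure_lt_top _ hB).ne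

theorem ballAvg_ne_top (h : IsBallBasis μ K 𝓑 hull) {B : Set X} (hB : B ∈ 𝓑) {f : X → ℝ}
    (hf : Integrable f μ) : ballAvg μ B f ≠ ∞ :=
  ENNReal.div_ne_top (ne_top_of_le_ne_top hf.2.ne (setLIntegral_le_lintegral _ _))
    (h.measure_pos _ hB).ne'

/-- The weak-type inequality for the maximal function of all balls. -/
theorem mul_measure_exists_lt_ballAvg_le (h : IsBallBasis μ K 𝓑 hull) {f : X → ℝ}
    (hf : Integrable f μ) {c : ℝ≥0∞} (hc0 : c ≠ 0) (hc : c ≠ ∞) :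
    μ {x | ∃ B ∈ 𝓑, x ∈ B ∧ c < ballAvg μ B f} ≤ K * (c⁻¹ * ∫⁻ x, ‖f x‖ₑ ∂μ) := by
  set s : Set (Set X) := {B ∈ 𝓑 | c < ballAvg μ B f} with hs
  set ρ : Measure X := c⁻¹ • μ.withDensity fun x => ‖f x‖ₑ with hρ
  have hρle : ∀ S, ρ S ≤ c⁻¹ * ∫⁻ x, ‖f x‖ₑ ∂μ := fun S => by
    refine (measure_mono (subset_univ S)).trans (le_of_eq ?_)
    rw [hρ, Measure.smul_apply, withDensity_apply _ MeasurableSet.univ, setLIntegral_univ,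
      smul_eq_mul]
  have hle : ∀ B ∈ s, μ B ≤ ρ B := fun B hB => by
    rw [hρ, Measure.smul_apply, withDensity_apply _ (h.measurableSet _ hB.1), smul_eq_mul,
      mul_comm, ← div_eq_mul_inv, ENNReal.le_div_iff_mul_le (Or.inl hc0) (Or.inl hc), mul_comm]
    exact ENNReal.mul_le_of_le_div hB.2.le
  have hset : {x | ∃ B ∈ 𝓑, x ∈ B ∧ c < ballAvg μ B f} ⊆ ⋃ B ∈ s, B := by
    rintro x ⟨B, hB, hx, hlt⟩
    exact mem_biUnion (show B ∈ s from ⟨hB, hlt⟩) hx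
  refine (measure_mono hset).trans ?_
  have hft := hf.2.ne
  refine (h.measure_biUnion_le_of_forall_le id s (fun B hB => hB.1)
    (M := c⁻¹ * ∫⁻ x, ‖f x‖ₑ ∂μ) ?_ (fun B hB => (hle B hB).trans (hρle B)) ρ hle).trans
    (mul_le_mul_right (hρle _) _)
  exact ENNReal.mul_ne_top (ENNReal.inv_ne_top.2 hc0) hft

/-- The oscillation estimate on a ball. -/
theorem enorm_indicator_compl_hull_le
    (hL1 : locConst μ 𝓑 hull T ≤ L) (hL0 : L ≠ 0) (hL : L ≠ ∞) {G : Set X} (hG : G ∈ 𝓑)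
    {f : X → ℝ} (hf : Integrable f μ) {s : ℝ≥0∞} (hs : ballAvgSup μ 𝓑 G f ≤ s)
    {x x' : X} (hx : x ∈ G) (hx' : x' ∈ G) :
    ‖T ((hull G)ᶜ.indicator f) x‖ₑ ≤ ‖T ((hull G)ᶜ.indicator f) x'‖ₑ + L * s := by
  set u := (hull G)ᶜ.indicator f with hu
  have h1 : ‖T u x - T u x'‖ₑ / ballAvgSup μ 𝓑 G f ≤ L :=
    (le_locConst T hG hx hx' hf).trans hL1
  rw [ENNReal.div_le_iff_le_mul (Or.inr hL) (Or.inr hL0)] at h1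
  calc ‖T u x‖ₑ = ‖T u x' + (T u x - T u x')‖ₑ := by rw [add_sub_cancel]
    _ ≤ ‖T u x'‖ₑ + ‖T u x - T u x'‖ₑ := _root_.enorm_add_le _ _
    _ ≤ ‖T u x'‖ₑ + L * s := add_le_add_right (h1.trans (mul_le_mul_right hs _)) _

/-- At the comparison point the far part is written as $f$ minus the near part, both of which are
small at well-chosen points. -/
theorem enorm_indicator_compl_hull_le' (h : IsBallBasis μ K 𝓑 hull) (hT : IsSubadditiveOp μ T)
    (hL1 : locConst μ 𝓑 hull T ≤ L) (hL0 : L ≠ 0) (hL : L ≠ ∞) {G : Set X} (hG : G ∈ 𝓑)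
    {f : X → ℝ} (hf : Integrable f μ) {s : ℝ≥0∞} (hs : ballAvgSup μ 𝓑 G f ≤ s)
    {x x' : X} (hx : x ∈ G) (hx' : x' ∈ G) :
    ‖T ((hull G)ᶜ.indicator f) x‖ₑ ≤ ‖T f x'‖ₑ + ‖T ((hull G).indicator f) x'‖ₑ + L * s := by
  refine (enorm_indicator_compl_hull_le hL1 hL0 hL hG hf hs hx hx').trans
    (add_le_add_left ?_ _)
  have h2 : (hull G)ᶜ.indicator f = f - (hull G).indicator f := by
    rw [indicator_compl]
  rw [h2]
  exact hT.enorm_sub_le hf (hf.indicator (h.measurableSet _ (h.hull_mem _ hG))) x'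

end IsBallBasis

/-! ### Exceptional sets and sparse domination. -/

/-- The exceptional set of a ball. -/
noncomputable def excSet {X : Type*} [MeasurableSpace X] (μ : Measure X) (𝓑 : Set (Set X))
    (hull : Set X → Set X) (T : (X → ℝ) → (X → ℝ)) (f : X → ℝ) (C L : ℝ≥0∞) (A : Set X) : Set X :=
  toMeasurable μ ({x | C * L * ballAvg μ (hull^[3] A) f < ‖T ((hull^[3] A).indicator f) x‖ₑ} ∪
    {x | ∃ B ∈ 𝓑, x ∈ B ∧ C * ballAvg μ (hull^[3] A) f < ballAvg μ B ((hull^[3] A).indicator f)})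

namespace IsBallBasis

variable {X : Type*} [MeasurableSpace X] {μ : Measure X} {K : ℝ≥0} {𝓑 : Set (Set X)}
  {hull : Set X → Set X} {T : (X → ℝ) → (X → ℝ)} {L : ℝ≥0∞}

/-- Weak type for $T$ and for the maximal function, at heights proportional to the average over the
triple hull, gives $(1+K)\mu(A^{***})/C$, and $\mu(A^{***})\le K^3\mu(A)$. -/
theorem measure_excSet_le (h : IsBallBasis μ K 𝓑 hull) (hW : weakOneNorm μ T ≤ L) (hL0 : L ≠ 0)
    (hL : L ≠ ∞) {f : X → ℝ} (hf : Integrable f μ) {C : ℝ≥0∞} (hC0 : C ≠ 0) (hC : C ≠ ∞)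
    {A : Set X} (hA : A ∈ 𝓑) :
    μ (excSet μ 𝓑 hull T f C L A) ≤ 2 * K ^ 4 / C * μ A := by
  rw [excSet, measure_toMeasurable]
  set Y := hull^[3] A with hY
  have hYB : Y ∈ 𝓑 := h.iterate_hull_mem hA 3
  have hYm := h.measurableSet _ hYB
  set a := ballAvg μ Y f with ha
  have hat : a ≠ ∞ := h.ballAvg_ne_top hYB hf
  have hI : ∫⁻ x, ‖Y.indicator f x‖ₑ ∂μ = a * μ Y := by
    rw [lintegral_enorm_indicator μ hYm, ha, h.ballAvg_mul_measure hYB]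
  have hK := h.one_le_const hA
  have hYA : μ Y ≤ K ^ 3 * μ A := h.measure_iterate_hull_le hA 3
  have h1 : μ {x | C * L * a < ‖T (Y.indicator f) x‖ₑ} ≤ μ Y / C :=
    IsSubadditiveOp.measure_lt_enorm_le hW hL0 hL (hf.indicator hYm) hat hC0 hC hI.le
  have h2 : μ {x | ∃ B ∈ 𝓑, x ∈ B ∧ C * a < ballAvg μ B (Y.indicator f)} ≤ K * (μ Y / C) := by
    by_cases ha0 : a = 0
    · have : {x | ∃ B ∈ 𝓑, x ∈ B ∧ C * a < ballAvg μ B (Y.indicator f)} = ∅ := by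
        refine eq_empty_of_forall_notMem ?_
        rintro x ⟨B, hB, -, hlt⟩
        have h3 : ∫⁻ y in B, ‖Y.indicator f y‖ₑ ∂μ = 0 := by
          refine le_antisymm ((setLIntegral_le_lintegral _ _).trans ?_) bot_le
          rw [hI, ha0, zero_mul]
        rw [ballAvg, h3, ENNReal.zero_div] at hlt
        exact not_lt_bot hlt
      rw [this, measure_empty]
      exact bot_le
    · refine (h.mul_measure_exists_lt_ballAvg_le (hf.indicator hYm) (mul_ne_zero hC0 ha0)
        (by finiteness)).trans (mul_le_mul_right (le_of_eq ?_) _)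
      rw [hI, ENNReal.mul_inv (Or.inl hC0) (Or.inl hC), mul_assoc, ← mul_assoc a⁻¹,
        ENNReal.inv_mul_cancel ha0 hat, one_mul, mul_comm, div_eq_mul_inv]
  calc μ (_ ∪ _) ≤ μ Y / C + K * (μ Y / C) := (measure_union_le _ _).trans (add_le_add h1 h2)
    _ ≤ K * (μ Y / C) + K * (μ Y / C) := add_le_add_left (le_mul_of_one_le_left' hK) _
    _ ≤ K * (K ^ 3 * μ A / C) + K * (K ^ 3 * μ A / C) := by gcongr
    _ = 2 * K ^ 4 / C * μ A := by simp only [div_eq_mul_inv]; ring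

end IsBallBasis

/-- The constant in the sparse domination of bounded oscillation operators. -/
noncomputable def domConst (K : ℝ≥0) : ℝ≥0 :=
  48 * K ^ 8 * (4 + 18 * K ^ 2) + 48 * K ^ 8 + 6 * K

namespace IsBallBasis

variable {X : Type*} [MeasurableSpace X] {μ : Measure X} {K : ℝ≥0} {𝓑 : Set (Set X)}
  {hull : Set X → Set X} {T : (X → ℝ) → (X → ℝ)} {L : ℝ≥0∞}

/-- Passage from a ball `A` to a smaller ball `B` that is maximal for the exceptional set
of `A`. -/
theorem enorm_le_enorm_add_of_maximal (h : IsBallBasis μ K 𝓑 hull) (hT : IsSubadditiveOp μ T)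
    (hL1 : locConst μ 𝓑 hull T ≤ L) (hL2 : connConst μ 𝓑 hull T < L)
    (hW : weakOneNorm μ T ≤ L) (hL : L ≠ ∞) {f : X → ℝ} (hf : Integrable f μ) {C : ℝ≥0∞}
    (hC : C ≠ ∞) {A B : Set X} (hA : A ∈ 𝓑) (hB : B ∈ 𝓑)
    (hBA : hull^[3] B ⊆ hull^[3] A) (hBu : hull^[3] B ≠ univ)
    (hmax : ∀ G ∈ 𝓑, hull^[2] B ⊂ G → 2 * μ (G ∩ excSet μ 𝓑 hull T f C L A) < μ G)
    {x : X} (hx : x ∈ hull^[2] B) :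
    ‖T ((hull^[3] A).indicator f) x‖ₑ ≤ ‖T ((hull^[3] B).indicator f) x‖ₑ +
      C * (4 + 18 * K ^ 2) * L * ballAvg μ (hull^[3] A) f := by
  have hL0 : L ≠ 0 := (bot_le.trans_lt hL2).ne'
  have hK := h.one_le_const hA
  have hK0 : (K : ℝ≥0∞) ≠ 0 := (zero_lt_one.trans_le hK).ne'
  set D := hull^[2] B with hD
  have hDB : D ∈ 𝓑 := h.iterate_hull_mem hB 2
  have hY : hull^[3] B = hull D := Function.iterate_succ_apply' hull 2 B
  rw [hY] at hBA hBu ⊢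
  -- Connectivity gives `G` strictly larger than `D`; by maximality less than half of `G` is
  -- exceptional. All comparisons take place in `G`.
  obtain ⟨G, hG, hDG, hΔ⟩ := exists_connDelta_lt hL2 hDB hBu
  set Y := hull^[3] A with hYdef
  have hYB : Y ∈ 𝓑 := h.iterate_hull_mem hA 3
  set u := Y.indicator f with hu
  have huI : Integrable u μ := hf.indicator (h.measurableSet _ hYB)
  set a := ballAvg μ Y f with ha
  have hat : a ≠ ∞ := h.ballAvg_ne_top hYB hf
  set E := excSet μ 𝓑 hull T f C L A with hE
  have hnotE : ∀ z, z ∉ E → ‖T u z‖ₑ ≤ C * L * a ∧ ∀ B' ∈ 𝓑, z ∈ B' → ballAvg μ B' u ≤ C * a := by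
    intro z hz
    have h1 := fun hz' => hz (subset_toMeasurable _ _ hz')
    refine ⟨not_lt.1 fun hlt => h1 (Or.inl hlt), fun B' hB' hzB' => not_lt.1 fun hlt =>
      h1 (Or.inr ⟨B', hB', hzB', hlt⟩)⟩
  set s := C * a with hs
  have hst : s ≠ ∞ := by finiteness
  have hGlt := hmax G hG hDG
  have hGt : μ G ≠ ∞ := (h.measure_lt_top _ hG).ne
  have hG0 : μ G ≠ 0 := (h.measure_pos _ hG).ne'
  have hHG := h.hull_mem _ hG
  have hHGm := h.measurableSet _ hHG
  have hHD := h.hull_mem _ hDB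
  have hHDm := h.measurableSet _ hHD
  have hGH := h.self_subset_hull hG
  have hDH := h.self_subset_hull hDB
  have hxG : x ∈ G := hDG.1 hx
  have hmeet : (hull D ∩ G).Nonempty := ⟨x, hDH hx, hxG⟩
  obtain ⟨x₀, hx₀G, hx₀E⟩ : (G \ E).Nonempty := by
    rw [nonempty_iff_ne_empty]
    intro hemp
    have h1 : G ∩ E = G := inter_eq_left.2 (sdiff_eq_empty.1 hemp)
    rw [h1, two_mul] at hGlt
    exact hGlt.not_ge le_self_add
  have havg := (hnotE x₀ hx₀E).2
  have hball : ∀ Z ∈ 𝓑, x₀ ∈ Z → μ Z ≤ K ^ 2 * μ G →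
      ∫⁻ y in Z, ‖u y‖ₑ ∂μ ≤ s * (K ^ 2 * μ G) := fun Z hZ hxZ hμ => by
    rw [← h.ballAvg_mul_measure hZ]
    exact mul_le_mul' (havg Z hZ hxZ) hμ
  have hKK : (K : ℝ≥0∞) ≤ K ^ 2 := by rw [pow_two]; exact le_mul_of_one_le_left' hK
  have hIG : ∫⁻ y in hull G, ‖u y‖ₑ ∂μ ≤ s * (K ^ 2 * μ G) :=
    hball _ hHG (hGH hx₀G) ((h.measure_hull_le _ hG).trans (mul_le_mul_left hKK _))
  -- Either `hull D` lies in `hull G`, or `G` lies in `hull (hull D)`. In both cases a ball of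
  -- controlled measure contains it together with the good point `x₀`.
  have hID : ∫⁻ y in hull D, ‖u y‖ₑ ∂μ ≤ s * (K ^ 2 * μ G) := by
    rcases le_total (μ (hull D)) (μ G) with h1 | h1
    · exact (lintegral_mono_set (h.subset_hull_of_measure_le hHD hG hmeet h1)).trans hIG
    · have h2 : G ⊆ hull (hull D) :=
        h.subset_hull_of_measure_le hG hHD (by rwa [inter_comm]) h1
      refine (lintegral_mono_set (h.self_subset_hull hHD)).trans
        (hball _ (h.hull_mem _ hHD) (h2 hx₀G) ?_)
      exact (h.measure_iterate_hull_le hDB 2).trans (mul_le_mul_right (measure_mono hDG.1) _)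
  set k₁ := (hull G).indicator u with hk₁
  set k₂ := (hull D).indicator u with hk₂
  set k₃ := (hull G).indicator k₂ with hk₃
  have hk₁I : Integrable k₁ μ := huI.indicator hHGm
  have hk₂I : Integrable k₂ μ := huI.indicator hHDm
  have hk₃I : Integrable k₃ μ := hk₂I.indicator hHGm
  have hN0 : (6 * K ^ 2 : ℝ≥0∞) ≠ 0 := mul_ne_zero (by norm_num) (pow_ne_zero _ hK0)
  have hNt : (6 * K ^ 2 : ℝ≥0∞) ≠ ∞ := by finiteness
  -- Three bad sets of measure at most $\mu(G)/6$ and a part of `E` of measure below $\mu(G)/2$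
  -- cannot cover `G`.
  have hbad : ∀ k : X → ℝ, Integrable k μ → ∫⁻ y, ‖k y‖ₑ ∂μ ≤ s * (K ^ 2 * μ G) →
      μ {z | 6 * K ^ 2 * L * s < ‖T k z‖ₑ} ≤ μ G / 6 := by
    intro k hk hI
    refine (IsSubadditiveOp.measure_lt_enorm_le hW hL0 hL hk hst hN0 hNt hI).trans (le_of_eq ?_)
    rw [mul_comm 6, ENNReal.mul_div_mul_left _ _ (pow_ne_zero _ hK0) (by finiteness)]
  have hI₁ : ∫⁻ y, ‖k₁ y‖ₑ ∂μ ≤ s * (K ^ 2 * μ G) := by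
    rwa [lintegral_enorm_indicator μ hHGm]
  have hI₂ : ∫⁻ y, ‖k₂ y‖ₑ ∂μ ≤ s * (K ^ 2 * μ G) := by
    rwa [lintegral_enorm_indicator μ hHDm]
  have hI₃ : ∫⁻ y, ‖k₃ y‖ₑ ∂μ ≤ s * (K ^ 2 * μ G) :=
    (lintegral_mono (enorm_indicator_le _ _)).trans hI₂
  obtain ⟨x', hx'G, hx'E, hx'₁, hx'₂, hx'₃⟩ : ∃ x' ∈ G, x' ∉ E ∧
      ‖T k₁ x'‖ₑ ≤ 6 * K ^ 2 * L * s ∧ ‖T k₂ x'‖ₑ ≤ 6 * K ^ 2 * L * s ∧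
      ‖T k₃ x'‖ₑ ≤ 6 * K ^ 2 * L * s := by
    by_contra! hcon
    have hcov : G ⊆ (G ∩ E) ∪ ({z | 6 * K ^ 2 * L * s < ‖T k₁ z‖ₑ} ∪
        ({z | 6 * K ^ 2 * L * s < ‖T k₂ z‖ₑ} ∪ {z | 6 * K ^ 2 * L * s < ‖T k₃ z‖ₑ})) := by
      intro z hz
      by_cases hzE : z ∈ E
      · exact Or.inl ⟨hz, hzE⟩
      refine Or.inr ?_
      by_cases h1 : ‖T k₁ z‖ₑ ≤ 6 * K ^ 2 * L * s
      · by_cases h2 : ‖T k₂ z‖ₑ ≤ 6 * K ^ 2 * L * s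
        · exact Or.inr (Or.inr (hcon z hz hzE h1 h2))
        · exact Or.inr (Or.inl (not_le.1 h2))
      · exact Or.inl (not_le.1 h1)
    have h1 : μ G ≤ μ (G ∩ E) + (μ G / 6 + (μ G / 6 + μ G / 6)) :=
      (measure_mono hcov).trans ((measure_union_le _ _).trans (add_le_add_right
        ((measure_union_le _ _).trans (add_le_add (hbad k₁ hk₁I hI₁)
          ((measure_union_le _ _).trans (add_le_add (hbad k₂ hk₂I hI₂) (hbad k₃ hk₃I hI₃))))) _))
    refine hGlt.not_ge ((ENNReal.add_le_add_iff_right hGt).1 ?_)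
    calc μ G + μ G = 2 * μ G := (two_mul _).symm
      _ ≤ 2 * (μ (G ∩ E) + (μ G / 6 + (μ G / 6 + μ G / 6))) := mul_le_mul_right h1 _
      _ = 2 * μ (G ∩ E) + 6 * (μ G / 6) := by ring
      _ = 2 * μ (G ∩ E) + μ G := by rw [ENNReal.mul_div_cancel (by norm_num) (by norm_num)]
  have hsup : ballAvgSup μ 𝓑 G u ≤ s := iSup₂_le fun Z hZ => iSup_le fun hGZ =>
    havg Z hZ (hGZ hx₀G)
  have hsup₂ : ballAvgSup μ 𝓑 G k₂ ≤ s := iSup₂_le fun Z hZ => iSup_le fun hGZ =>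
    (ballAvg_mono μ Z (enorm_indicator_le _ _)).trans (havg Z hZ (hGZ hx₀G))
  have e1 : ‖T ((hull G)ᶜ.indicator u) x‖ₑ ≤ L * s + 6 * K ^ 2 * L * s + L * s := by
    refine (h.enorm_indicator_compl_hull_le' hT hL1 hL0 hL hG huI hsup hxG hx'G).trans ?_
    gcongr
    refine (hnotE x' hx'E).1.trans (le_of_eq ?_)
    rw [hs]; ring
  have e2 : ‖T ((hull G)ᶜ.indicator k₂) x‖ₑ ≤
      6 * K ^ 2 * L * s + 6 * K ^ 2 * L * s + L * s := by
    refine (h.enorm_indicator_compl_hull_le' hT hL1 hL0 hL hG hk₂I hsup₂ hxG hx'G).trans ?_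
    gcongr
  have e3 : ‖T ((hull G \ hull D).indicator u) x‖ₑ ≤ L * s := by
    have h1 := (le_connDelta hull T G hx huI).trans hΔ.le
    rw [ENNReal.div_le_iff_le_mul (Or.inr hL) (Or.inr hL0)] at h1
    exact h1.trans (mul_le_mul_right (havg _ hHG (hGH hx₀G)) _)
  -- `hull D` need not lie in `hull G`, so the near part is $k_2$ minus its portion outside `hull
  -- G`. The costs are $2+6K^2$ for the far part, $1$ for the annulus and $1+12K^2$ for that
  -- portion.
  have hsplit : u = (hull G)ᶜ.indicator u + ((hull G \ hull D).indicator u +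
      (k₂ - (hull G)ᶜ.indicator k₂)) := by
    ext z
    simp only [Pi.add_apply, Pi.sub_apply, hk₂, indicator, mem_compl_iff, mem_sdiff]
    by_cases h1 : z ∈ hull G <;> by_cases h2 : z ∈ hull D <;> simp [h1, h2]
  have hk₂f : k₂ = (hull D).indicator f := by
    rw [hk₂, hu, indicator_indicator, inter_eq_left.2 hBA]
  have i1 : Integrable ((hull G)ᶜ.indicator u) μ := huI.indicator hHGm.compl
  have i2 : Integrable ((hull G)ᶜ.indicator k₂) μ := hk₂I.indicator hHGm.compl
  have i3 : Integrable ((hull G \ hull D).indicator u) μ := huI.indicator (hHGm.diff hHDm)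
  rw [← hk₂f]
  calc ‖T u x‖ₑ ≤ ‖T ((hull G)ᶜ.indicator u) x‖ₑ + (‖T ((hull G \ hull D).indicator u) x‖ₑ +
        (‖T k₂ x‖ₑ + ‖T ((hull G)ᶜ.indicator k₂) x‖ₑ)) := by
        conv_lhs => rw [hsplit]
        refine (hT.enorm_add_le i1 (i3.add (hk₂I.sub i2)) x).trans (add_le_add_right ?_ _)
        refine (hT.enorm_add_le i3 (hk₂I.sub i2) x).trans (add_le_add_right ?_ _)
        exact hT.enorm_sub_le hk₂I i2 x
    _ ≤ (L * s + 6 * K ^ 2 * L * s + L * s) + (L * s +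
        (‖T k₂ x‖ₑ + (6 * K ^ 2 * L * s + 6 * K ^ 2 * L * s + L * s))) := by gcongr
    _ = ‖T k₂ x‖ₑ + C * (4 + 18 * K ^ 2) * L * a := by rw [hs]; ring

/-- The contribution of the part of `f` far from a ball that carries half of the mass of `f`. -/
theorem enorm_le_enorm_add_of_large (h : IsBallBasis μ K 𝓑 hull) (hT : IsSubadditiveOp μ T)
    (hL1 : locConst μ 𝓑 hull T ≤ L) (hW : weakOneNorm μ T ≤ L) (hL0 : L ≠ 0) (hL : L ≠ ∞)
    {f : X → ℝ} (hf : Integrable f μ) {A : Set X} (hA : A ∈ 𝓑)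
    (hfA : ∫⁻ x, ‖f x‖ₑ ∂μ ≤ 2 * ∫⁻ x in hull^[3] A, ‖f x‖ₑ ∂μ) {x : X} (hx : x ∈ hull^[2] A) :
    ‖T f x‖ₑ ≤ ‖T ((hull^[3] A).indicator f) x‖ₑ + 6 * K * L * ballAvg μ (hull^[3] A) f := by
  set G := hull^[2] A with hG
  have hGB : G ∈ 𝓑 := h.iterate_hull_mem hA 2
  have hY : hull^[3] A = hull G := Function.iterate_succ_apply' hull 2 A
  rw [hY] at hfA ⊢
  have hYB := h.hull_mem _ hGB
  have hYm := h.measurableSet _ hYB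
  have hG0 : μ G ≠ 0 := (h.measure_pos _ hGB).ne'
  have hGt : μ G ≠ ∞ := (h.measure_lt_top _ hGB).ne
  set a := ballAvg μ (hull G) f with ha
  have hat : a ≠ ∞ := h.ballAvg_ne_top hYB hf
  -- With this value the whole mass of $f$ is at most $s\mu(G)$, so every ball containing `G` has
  -- average at most `s`. The bad set for the far part fills at most half of `G`, and the total cost
  -- is $3Ls=6KLa$.
  set s := 2 * (K * a) with hs
  have hst : s ≠ ∞ := by finiteness
  have hI : ∫⁻ x, ‖f x‖ₑ ∂μ ≤ s * μ G := by
    refine hfA.trans ?_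
    rw [← h.ballAvg_mul_measure hYB, hs]
    calc 2 * (a * μ (hull G)) ≤ 2 * (a * (K * μ G)) := by
          gcongr; exact h.measure_hull_le _ hGB
      _ = 2 * (K * a) * μ G := by ring
  have hsup : ballAvgSup μ 𝓑 G f ≤ s := iSup₂_le fun Z hZ => iSup_le fun hGZ => by
    rw [ballAvg]
    refine ENNReal.div_le_of_le_mul ?_
    exact (setLIntegral_le_lintegral _ _).trans (hI.trans (mul_le_mul_right (measure_mono hGZ) _))
  set u := (hull G)ᶜ.indicator f with hu
  have huI : Integrable u μ := hf.indicator hYm.compl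
  have hbad : μ {z | 2 * L * s < ‖T u z‖ₑ} ≤ μ G / 2 :=
    IsSubadditiveOp.measure_lt_enorm_le hW hL0 hL huI hst (by norm_num) (by norm_num)
      ((lintegral_mono (enorm_indicator_le _ _)).trans hI)
  obtain ⟨x', hx'G, hx'⟩ : ∃ x' ∈ G, ‖T u x'‖ₑ ≤ 2 * L * s := by
    by_contra! hcon
    exact (ENNReal.half_lt_self hG0 hGt).not_ge
      ((measure_mono (show G ⊆ {z | 2 * L * s < ‖T u z‖ₑ} from hcon)).trans hbad)
  have e1 : ‖T u x‖ₑ ≤ 2 * L * s + L * s :=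
    (enorm_indicator_compl_hull_le hL1 hL0 hL hGB hf hsup hx hx'G).trans
      (add_le_add_left hx' _)
  have hsplit : f = (hull G).indicator f + u := (indicator_self_add_compl _ _).symm
  calc ‖T f x‖ₑ ≤ ‖T ((hull G).indicator f) x‖ₑ + ‖T u x‖ₑ := by
        conv_lhs => rw [hsplit]
        exact hT.enorm_add_le (hf.indicator hYm) huI x
    _ ≤ ‖T ((hull G).indicator f) x‖ₑ + (2 * L * s + L * s) := add_le_add_right e1 _
    _ = ‖T ((hull G).indicator f) x‖ₑ + 6 * K * L * a := by rw [hs]; ring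

/-- Sparse domination of a bounded oscillation operator on a ball. -/
theorem exists_sparse_domination (h : IsBallBasis μ K 𝓑 hull) (hT : IsSubadditiveOp μ T)
    (hL1 : locConst μ 𝓑 hull T ≤ L) (hL2 : connConst μ 𝓑 hull T < L)
    (hW : weakOneNorm μ T ≤ L) (hL : L ≠ ∞) {f : X → ℝ} (hf : Integrable f μ)
    {A₀ : Set X} (hA₀ : A₀ ∈ 𝓑)
    (hfA : ∫⁻ x, ‖f x‖ₑ ∂μ ≤ 2 * ∫⁻ x in hull^[3] A₀, ‖f x‖ₑ ∂μ) :
    ∃ (I : Set ℕ) (Y F : I → Set X), (∀ i, Y i ∈ 𝓑) ∧ (∀ i, MeasurableSet (F i)) ∧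
      (∀ i, F i ⊆ Y i) ∧ Pairwise (Function.onFun Disjoint F) ∧
      (∀ i, μ (Y i) ≤ 2 * K ^ 3 * μ (F i)) ∧
      ∀ᵐ x ∂μ, x ∈ hull A₀ → ‖T f x‖ₑ ≤
        domConst K * L * ∑' i, (Y i).indicator (fun _ => ballAvg μ (Y i) f) x := by
  have hL0 : L ≠ 0 := (bot_le.trans_lt hL2).ne'
  have hK := h.one_le_const hA₀
  have hK0 : (K : ℝ≥0∞) ≠ 0 := (zero_lt_one.trans_le hK).ne'
  -- This makes $\varepsilon=2K^4/C=1/(24K^4)$, as sparseness requires.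
  set C : ℝ≥0∞ := 48 * K ^ 8 with hC
  have hC0 : C ≠ 0 := mul_ne_zero (by norm_num) (pow_ne_zero _ hK0)
  have hCt : C ≠ ∞ := by finiteness
  set ε : ℝ≥0∞ := 2 * K ^ 4 / C with hεdef
  have hε : 24 * K ^ 4 * ε ≤ 1 := by
    have : 24 * K ^ 4 * ε = C / C := by
      rw [hεdef, ← mul_div_assoc, hC]
      congr 1
      ring
    rw [this]
    exact ENNReal.div_self_le_one
  have hε4 : 4 * ε ≤ 1 := by
    refine le_trans ?_ hε
    calc 4 * ε = 4 * 1 * ε := by ring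
      _ ≤ 24 * K ^ 4 * ε := by gcongr; norm_num; exact one_le_pow₀ hK
  have hε2 : 2 * ε ≤ 1 := le_trans (by gcongr; norm_num) hε4
  set E := excSet μ 𝓑 hull T f C L with hEdef
  have hEm : ∀ A ∈ 𝓑, MeasurableSet (E A) := fun A _ => measurableSet_toMeasurable _ _
  have hE : ∀ A ∈ 𝓑, μ (E A) ≤ ε * μ A := fun A hA =>
    h.measure_excSet_le hW hL0 hL hf hC0 hCt hA
  obtain ⟨B, par, y, hB0, t⟩ := h.exists_isStoppingSeq (E := E) (fun A hA =>
    ne_top_of_le_ne_top (ENNReal.mul_ne_top (ne_top_of_le_ne_top ENNReal.one_ne_top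
      ((le_mul_of_one_le_left' (by norm_num)).trans hε2)) (h.measure_lt_top A hA).ne) (hE A hA)) hA₀
  obtain ⟨F, hFm, hFB, hFd, hF⟩ := t.exists_disjoint_parts h hEm hE hε
  set c : ℝ≥0∞ := C * (4 + 18 * K ^ 2) with hc
  set S : ℕ → X → ℝ≥0∞ := fun i x => {n | B n ∈ 𝓑}.indicator
    (fun i => (hull^[3] (B i)).indicator (fun _ => ballAvg μ (hull^[3] (B i)) f) x) i with hS
  have hSi : ∀ i x, B i ∈ 𝓑 → x ∈ hull^[2] (B i) → S i x = ballAvg μ (hull^[3] (B i)) f := by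
    intro i x hi hx
    have hx' : x ∈ hull^[3] (B i) := by
      rw [Function.iterate_succ_apply' hull 2]
      exact h.self_subset_hull (h.iterate_hull_mem hi 2) hx
    rw [hS]
    simp only
    rw [indicator_of_mem (show i ∈ {n | B n ∈ 𝓑} from hi), indicator_of_mem hx']
  have hstep : ∀ n, n ≠ 0 → B n ∈ 𝓑 → ∀ x ∈ hull^[2] (B n),
      ‖T ((hull^[3] (B (par n))).indicator f) x‖ₑ ≤ ‖T ((hull^[3] (B n)).indicator f) x‖ₑ +
        c * L * S (par n) x := by
    intro n hn hBn x hx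
    have hP := t.par_mem n hn hBn
    rw [hSi _ _ hP (t.iterate_two_hull_subset h hE hε hn hBn hx)]
    refine h.enorm_le_enorm_add_of_maximal hT hL1 hL2 hW hL hf hCt hP hBn ?_ ?_ ?_ hx
    · refine (t.iterate_hull_subset h hE hε hn hBn).trans ?_
      rw [Function.iterate_succ_apply' hull 2]
      exact h.self_subset_hull (h.iterate_hull_mem hP 2)
    -- The triple hull of a child has smaller measure than the parent, so it is not the whole space
    -- and connectivity applies.
    · intro hu
      have h1 : μ (hull^[3] (B n)) < μ (hull^[3] (B n)) := by
        calc μ (hull^[3] (B n)) ≤ K ^ 3 * (2 * ε * μ (B (par n))) :=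
              (h.measure_iterate_hull_le hBn 3).trans
                (mul_le_mul_right (t.measure_le_mul_measure_par hE hn hBn) _)
          _ ≤ K ^ 4 * (2 * ε * μ (B (par n))) := by gcongr; norm_num
          _ = (2 * K ^ 4 * ε) * μ (B (par n)) := by ring
          _ < 1 * μ (B (par n)) := by
              refine ENNReal.mul_lt_mul_left (h.measure_pos _ hP).ne' (h.measure_lt_top _ hP).ne ?_
              have h2 : 12 * (2 * K ^ 4 * ε) ≤ 1 := by
                calc 12 * (2 * K ^ 4 * ε) = 24 * K ^ 4 * ε := by ring
                  _ ≤ 1 := hε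
              by_contra hge
              have h3 : (12 : ℝ≥0∞) * 1 ≤ 1 := (mul_le_mul_right (not_lt.1 hge) _).trans h2
              norm_num at h3
          _ ≤ μ (hull^[3] (B n)) := by
              rw [one_mul, hu]; exact measure_mono (subset_univ _)
      exact lt_irrefl _ h1
    -- Such a `G` would be a candidate at stage `n`, with witness `y n`. Then $\mu(G)\le2\mu(B_n)$
    -- puts `G` inside the double hull of `B n`, which it strictly contains.
    · intro G hG hDG
      by_contra hle
      have hyD : y n ∈ hull^[2] (B n) :=
        h.subset_iterate_hull hBn 2 (t.mem n hn hBn)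
      have h1 := (t.maximal n hn G ⟨hG, par n, t.par_lt n hn hBn, hP, not_lt.1 hle, y n,
        hDG.1 hyD, t.mem_hull n hn hBn, t.notMem_hull n hn hBn⟩).2
      refine hDG.2 (h.subset_hull _ (h.hull_mem _ hBn) _ hG
        (h1.trans (mul_le_mul_right (measure_mono (h.self_subset_hull hBn)) _)) ⟨y n, hDG.1 hyD, ?_⟩)
      exact h.self_subset_hull hBn (t.mem n hn hBn)
  -- Iteration of the step along the parents; their indices strictly decrease, so each average is
  -- paid for once.
  have hchain : ∀ n, B n ∈ 𝓑 → ∀ x ∈ hull^[2] (B n), x ∈ hull^[2] (B 0) ∧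
      ‖T ((hull^[3] (B 0)).indicator f) x‖ₑ ≤ ‖T ((hull^[3] (B n)).indicator f) x‖ₑ +
        c * L * ∑ i ∈ Finset.range n, S i x := by
    intro n
    induction n using Nat.strong_induction_on with
    | _ n ih =>
      intro hBn x hx
      by_cases hn : n = 0
      · subst hn
        exact ⟨hx, le_self_add⟩
      have hlt := t.par_lt n hn hBn
      obtain ⟨h0, h1⟩ := ih _ hlt (t.par_mem n hn hBn) x
        (t.iterate_two_hull_subset h hE hε hn hBn hx)
      refine ⟨h0, h1.trans ((add_le_add_left (hstep n hn hBn x hx) _).trans ?_)⟩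
      rw [add_assoc, ← mul_add, add_comm (S _ _), ← Finset.sum_range_succ]
      gcongr
      exact hlt
  have hsum : ∀ x, ∑' i : {n | B n ∈ 𝓑}, (hull^[3] (B i)).indicator
      (fun _ => ballAvg μ (hull^[3] (B i)) f) x = ∑' i, S i x := fun x =>
    tsum_subtype {n | B n ∈ 𝓑} (fun i => (hull^[3] (B i)).indicator
      (fun _ => ballAvg μ (hull^[3] (B i)) f) x)
  refine ⟨{n | B n ∈ 𝓑}, fun i => hull^[3] (B i), F, fun i => h.iterate_hull_mem i.2 3, hFm,
    fun i => (hFB i).trans (h.subset_iterate_hull i.2 3), hFd, fun i => ?_, ?_⟩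
  · calc μ (hull^[3] (B i)) ≤ K ^ 3 * (2 * μ (F i)) :=
          (h.measure_iterate_hull_le i.2 3).trans (mul_le_mul_right (hF i) _)
      _ = 2 * K ^ 3 * μ (F i) := by ring
  · filter_upwards [t.ae_exists_mem_hull_notMem h hEm hE hε4] with x hx hxA
    rw [hsum]
    obtain ⟨n, hBn, hxn, hxE⟩ := hx (hB0 ▸ hxA)
    have hxn2 : x ∈ hull^[2] (B n) := h.self_subset_hull (h.hull_mem _ hBn) hxn
    obtain ⟨hx0, h1⟩ := hchain n hBn x hxn2
    have h2 : ‖T ((hull^[3] (B n)).indicator f) x‖ₑ ≤ C * L * S n x := by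
      rw [hSi n x hBn hxn2]
      exact not_lt.1 fun hlt => hxE (subset_toMeasurable _ _ (Or.inl hlt))
    have h3 : ‖T f x‖ₑ ≤ ‖T ((hull^[3] (B 0)).indicator f) x‖ₑ + 6 * K * L * S 0 x := by
      rw [hSi 0 x t.zero_mem hx0]
      rw [← hB0] at hfA
      exact h.enorm_le_enorm_add_of_large hT hL1 hW hL0 hL hf t.zero_mem hfA hx0
    -- The last ball, the chain of parents, and the part of $f$ far from the first ball.
    calc ‖T f x‖ₑ ≤ C * L * S n x + c * L * ∑ i ∈ Finset.range n, S i x + 6 * K * L * S 0 x :=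
          h3.trans (add_le_add_left (h1.trans (add_le_add_left h2 _)) _)
      _ ≤ C * L * ∑' i, S i x + c * L * ∑' i, S i x + 6 * K * L * ∑' i, S i x := by
          gcongr
          · exact ENNReal.le_tsum n
          · exact ENNReal.sum_le_tsum _
          · exact ENNReal.le_tsum 0
      _ = domConst K * L * ∑' i, S i x := by
          rw [domConst, hc, hC]
          push_cast
          ring

end IsBallBasis

/-! ### Outer norms and the final estimate. -/

/-- Outer measure is continuous along increasing sequences of arbitrary sets. The majorant may
therefore change with `k`, as the sparse families do, if the bound does not. -/
theorem outerLpNorm_le_of_exhaustion {X : Type*} [MeasurableSpace X] {ν : Measure X} [SFinite ν]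
    {p : ℝ} (hp : 0 < p) (g : X → ℝ≥0∞) (W : ℕ → Set X) (hW : Monotone W)
    (hWu : ⋃ k, W k = univ) {M : ℝ≥0∞}
    (hS : ∀ k, ∃ S : X → ℝ≥0∞, Measurable S ∧ (∀ᵐ x ∂ν, x ∈ W k → g x ≤ S x) ∧
      ∫⁻ x, S x ^ p ∂ν ≤ M) : outerLpNorm ν p g ≤ M ^ (1 / p) := by
  refine ENNReal.rpow_le_rpow ?_ (by positivity)
  have h1 : ∀ t : ℝ, ENNReal.ofReal (t ^ (p - 1)) * ν {x | ENNReal.ofReal t < g x} =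
      ⨆ k, ENNReal.ofReal (t ^ (p - 1)) * ν ({x | ENNReal.ofReal t < g x} ∩ W k) := by
    intro t
    have hm : Monotone fun k => {x | ENNReal.ofReal t < g x} ∩ W k := fun i j hij =>
      inter_subset_inter_right _ (hW hij)
    rw [← ENNReal.mul_iSup, ← hm.measure_iUnion, ← inter_iUnion, hWu, inter_univ]
  simp_rw [h1]
  rw [lintegral_iSup]
  · rw [ENNReal.mul_iSup]
    refine iSup_le fun k => ?_
    obtain ⟨S, hSm, hgS, hSM⟩ := hS k
    refine le_trans (mul_le_mul_right (lintegral_mono fun t => mul_le_mul_right ?_ _) _)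
      ((lintegral_rpow_eq_lintegral_measure_lt ν hSm hp).symm.le.trans hSM)
    refine measure_mono_ae ?_
    filter_upwards [hgS] with x hx hx'
    exact lt_of_lt_of_le hx'.1 (hx hx'.2)
  · intro k
    have : Measurable fun t : ℝ => ν ({x | ENNReal.ofReal t < g x} ∩ W k) := by
      refine Antitone.measurable fun s t hst => measure_mono ?_
      exact inter_subset_inter_left _ fun x hx => (ENNReal.ofReal_le_ofReal hst).trans_lt hx
    exact Measurable.mul (by fun_prop) this
  · intro i j hij t
    exact mul_le_mul_right (measure_mono (inter_subset_inter_right _ (hW hij))) _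

theorem outerLpNorm_le {X : Type*} [MeasurableSpace X] {ν : Measure X} [SFinite ν]
    {p : ℝ} (hp : 0 < p) {g S : X → ℝ≥0∞} (hS : Measurable S) (hgS : ∀ᵐ x ∂ν, g x ≤ S x) :
    outerLpNorm ν p g ≤ (∫⁻ x, S x ^ p ∂ν) ^ (1 / p) :=
  outerLpNorm_le_of_exhaustion hp g (fun _ => univ) monotone_const (iUnion_const _)
    fun _ => ⟨S, hS, by filter_upwards [hgS] with x hx _ using hx, le_rfl⟩

theorem outerLpNorm_eq_zero {X : Type*} [MeasurableSpace X] {ν : Measure X} [SFinite ν]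
    {p : ℝ} (hp : 0 < p) {g : X → ℝ≥0∞} (hg : ∀ᵐ x ∂ν, g x = 0) : outerLpNorm ν p g = 0 := by
  have h1 := outerLpNorm_le (ν := ν) hp (g := g) (S := fun _ => 0) measurable_const
    (by filter_upwards [hg] with x hx using hx.le)
  rw [ENNReal.zero_rpow_of_pos hp, lintegral_zero, ENNReal.zero_rpow_of_pos (by positivity)] at h1
  exact le_antisymm h1 bot_le

theorem sparseConst_ne_top (K : ℝ≥0) {p : ℝ} (hp : 1 < p) : sparseConst K p ≠ ∞ := by
  have hp0 : 0 < p - 1 := by linarith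
  have hq : 1 < p / (p - 1) := by rw [lt_div_iff₀ hp0]; linarith
  exact ENNReal.mul_ne_top (ENNReal.rpow_ne_top_of_nonneg (by positivity) (buckleyConst_ne_top K hp))
    (ENNReal.rpow_ne_top_of_nonneg (by positivity) (buckleyConst_ne_top K hq))

namespace IsBallBasis

variable {X : Type*} [MeasurableSpace X] {μ : Measure X} {K : ℝ≥0} {𝓑 : Set (Set X)}
  {hull : Set X → Set X} {p : ℝ} {w : X → ℝ≥0∞}

theorem exists_isApPair (h : IsBallBasis μ K 𝓑 hull) (hp : 1 < p)
    (hw : IsApWeight μ 𝓑 p w) :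
    ∃ w' σ : X → ℝ≥0∞, w =ᵐ[μ] w' ∧ IsApPair μ 𝓑 p (apConst μ 𝓑 p w) w' σ := by
  have hp0 : 0 < p - 1 := by linarith
  have hww := hw.aemeasurable.ae_eq_mk
  set w' := hw.aemeasurable.mk w
  have hw'm : Measurable w' := hw.aemeasurable.measurable_mk
  have hpos : ∀ᵐ x ∂μ, w' x ≠ 0 ∧ w' x ≠ ∞ := by
    filter_upwards [hww, hw.pos_lt_top] with x hx hx'
    rw [← hx]
    exact ⟨hx'.1.ne', hx'.2.ne⟩
  refine ⟨w', fun x => w' x ^ (-1 / (p - 1)), hww, hw'm, hw'm.pow_const _,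
    hpos.mono fun x hx => hx.1, hpos.mono fun x hx => hx.2, hpos.mono fun x hx => ?_,
    hpos.mono fun x hx => ?_, hpos.mono fun x hx => ?_, fun B hB => ?_⟩
  · simp [ENNReal.rpow_eq_zero_iff, hx.1, hx.2]
  · simp [ENNReal.rpow_eq_top_iff, hx.1, hx.2]
  · rw [← ENNReal.rpow_mul, div_mul_cancel₀ _ hp0.ne', ENNReal.rpow_neg_one,
      ENNReal.mul_inv_cancel hx.1 hx.2]
  · have hB0 := (h.measure_pos B hB).ne'
    have hBt := (h.measure_lt_top B hB).ne
    have h1 : ((∫⁻ x in B, w x ∂μ) / μ B) *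
        ((∫⁻ x in B, (w x) ^ (-1 / (p - 1)) ∂μ) / μ B) ^ (p - 1) ≤ apConst μ 𝓑 p w :=
      le_iSup₂ (f := fun B (_ : B ∈ 𝓑) => ((∫⁻ x in B, w x ∂μ) / μ B) *
        ((∫⁻ x in B, (w x) ^ (-1 / (p - 1)) ∂μ) / μ B) ^ (p - 1)) B hB
    have e1 : ∫⁻ x in B, w' x ∂μ = ∫⁻ x in B, w x ∂μ :=
      lintegral_congr_ae (ae_restrict_of_ae (by filter_upwards [hww] with x hx using hx.symm))
    have e2 : ∫⁻ x in B, w' x ^ (-1 / (p - 1)) ∂μ = ∫⁻ x in B, w x ^ (-1 / (p - 1)) ∂μ :=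
      lintegral_congr_ae (ae_restrict_of_ae (by filter_upwards [hww] with x hx using by rw [hx]))
    rw [e1, e2]
    have hr0 : μ B ^ (p - 1) ≠ 0 := by simp [ENNReal.rpow_eq_zero_iff, hB0, hBt]
    have hrt : μ B ^ (p - 1) ≠ ∞ := ENNReal.rpow_ne_top_of_nonneg hp0.le hBt
    set a := ∫⁻ x in B, w x ∂μ
    set b := ∫⁻ x in B, w x ^ (-1 / (p - 1)) ∂μ
    calc a * b ^ (p - 1) = a * b ^ (p - 1) *
          ((μ B ^ (p - 1) * (μ B ^ (p - 1))⁻¹) * (μ B * (μ B)⁻¹)) := by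
          rw [ENNReal.mul_inv_cancel hB0 hBt, ENNReal.mul_inv_cancel hr0 hrt, mul_one, mul_one]
      _ = (a / μ B) * (b / μ B) ^ (p - 1) * (μ B ^ (p - 1) * μ B) := by
          rw [ENNReal.div_rpow_of_nonneg _ _ hp0.le]
          simp only [div_eq_mul_inv]
          ring
      _ ≤ apConst μ 𝓑 p w * μ B ^ p := by
          rw [ENNReal.rpow_sub_one_mul_self hp.le]
          exact mul_le_mul_left h1 _

/-- Hölder's inequality for $w^{1/p}\sigma^{1/p'}=1$ on a ball. It permits larger powers of the
characteristic. -/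
theorem one_le_of_isApPair (h : IsBallBasis μ K 𝓑 hull) (hp : 1 < p) {Q : ℝ≥0∞}
    {σ : X → ℝ≥0∞} (hw : IsApPair μ 𝓑 p Q w σ) {B : Set X} (hB : B ∈ 𝓑) : 1 ≤ Q := by
  have hp0 : 0 < p - 1 := by linarith
  have hpp : 0 < p := by linarith
  have hpq : p.HolderConjugate (p / (p - 1)) := Real.HolderConjugate.conjExponent hp
  have hwm := hw.measurable_left
  have hσm := hw.measurable_right
  have hB0 := (h.measure_pos B hB).ne'
  have hBt := (h.measure_lt_top B hB).ne
  have h1 : μ B ≤ (∫⁻ x in B, w x ∂μ) ^ (1 / p) * (∫⁻ x in B, σ x ∂μ) ^ ((p - 1) / p) := by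
    calc μ B = ∫⁻ x in B, ((fun x => w x ^ (1 / p)) * (fun x => σ x ^ ((p - 1) / p))) x ∂μ := by
          rw [← setLIntegral_one]
          refine lintegral_congr_ae (ae_restrict_of_ae ?_)
          filter_upwards [hw.mul_rpow_eq_one] with x hx
          have h1 := congrArg (fun y => y ^ (1 / p)) hx
          simp only [ENNReal.one_rpow] at h1
          rw [ENNReal.mul_rpow_of_nonneg _ _ (by positivity), ← ENNReal.rpow_mul,
            mul_one_div] at h1
          rw [Pi.mul_apply, h1]
      _ ≤ (∫⁻ x in B, (w x ^ (1 / p)) ^ p ∂μ) ^ (1 / p) *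
          (∫⁻ x in B, (σ x ^ ((p - 1) / p)) ^ (p / (p - 1)) ∂μ) ^ (1 / (p / (p - 1))) :=
          ENNReal.lintegral_mul_le_Lp_mul_Lq _ hpq (by fun_prop) (by fun_prop)
      _ = _ := by
          have e : (p - 1) / p * (p / (p - 1)) = 1 := by field_simp
          simp_rw [← ENNReal.rpow_mul, e, one_div_mul_cancel hpp.ne', ENNReal.rpow_one, one_div_div]
  have h2 := (ENNReal.rpow_le_rpow h1 hpp.le).trans (le_of_eq (ENNReal.mul_rpow_of_nonneg _ _ hpp.le))
  rw [← ENNReal.rpow_mul, ← ENNReal.rpow_mul, one_div_mul_cancel hpp.ne',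
    div_mul_cancel₀ _ hpp.ne', ENNReal.rpow_one] at h2
  have h3 : 1 * μ B ^ p ≤ Q * μ B ^ p := by
    rw [one_mul]
    exact h2.trans (hw.mul_rpow_le B hB)
  refine (ENNReal.mul_le_mul_iff_left ?_ (ENNReal.rpow_ne_top_of_nonneg hpp.le hBt)).1 h3
  simp [ENNReal.rpow_eq_zero_iff, hB0, hBt]

/-- The weighted estimate for the sparse sum of an indexed sparse family of balls. -/
theorem lintegral_tsum_ballAvg_rpow_le (h : IsBallBasis μ K 𝓑 hull) (hp : 1 < p)
    (hw : IsApWeight μ 𝓑 p w) {ι : Type*} [Countable ι] {A F : ι → Set X} {Γ : ℝ≥0∞}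
    (hA : ∀ i, A i ∈ 𝓑) (hF : ∀ i, MeasurableSet (F i)) (hFA : ∀ i, F i ⊆ A i)
    (hd : Pairwise (Function.onFun Disjoint F)) (hΓ : ∀ i, μ (A i) ≤ Γ * μ (F i)) {f : X → ℝ}
    (hf : MemLp f (ENNReal.ofReal p) (μ.withDensity w)) :
    ∫⁻ x, (∑' i, (A i).indicator (fun _ => ballAvg μ (A i) f) x) ^ p ∂(μ.withDensity w) ≤
      (Γ * apConst μ 𝓑 p w ^ (p / (p - 1)) * sparseConst K p *
        eLpNorm f (ENNReal.ofReal p) (μ.withDensity w)) ^ p := by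
  have hpp : 0 < p := by linarith
  have hAm : ∀ i, MeasurableSet (A i) := fun i => h.measurableSet _ (hA i)
  obtain ⟨w', σ, hww, hpair⟩ := h.exists_isApPair hp hw
  -- Positivity of the weight transfers measurability of $f$ from $w\,d\mu$ to $\mu$, as the
  -- averages require.
  have hac : μ ≪ μ.withDensity w := withDensity_absolutelyContinuous' hw.aemeasurable
    (hw.pos_lt_top.mono fun x hx => hx.1.ne')
  have hfm : AEMeasurable (fun x => ‖f x‖ₑ) μ := (hf.1.mono_ac hac).enorm
  obtain ⟨φ, hφ, hfφ⟩ := hfm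
  have hw'm := hpair.measurable_left
  have hν : μ.withDensity w = μ.withDensity w' := withDensity_congr_ae hww
  have hnorm : eLpNorm f (ENNReal.ofReal p) (μ.withDensity w) ^ p = ∫⁻ x, φ x ^ p * w' x ∂μ := by
    rw [eLpNorm_eq_lintegral_rpow_enorm_toReal (by simpa using hpp) ENNReal.ofReal_ne_top,
      ENNReal.toReal_ofReal hpp.le, ← ENNReal.rpow_mul, one_div_mul_cancel hpp.ne',
      ENNReal.rpow_one, hν]
    have h1 : ∫⁻ x, ‖f x‖ₑ ^ p ∂(μ.withDensity w') = ∫⁻ x, φ x ^ p ∂(μ.withDensity w') :=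
      lintegral_congr_ae (by
        filter_upwards [(withDensity_absolutelyContinuous μ w').ae_le hfφ] with x hx
        rw [hx])
    rw [h1, lintegral_withDensity_eq_lintegral_mul _ hw'm (by fun_prop)]
    exact lintegral_congr fun x => mul_comm _ _
  have hfin : ∫⁻ x, φ x ^ p * w' x ∂μ ≠ ∞ := by
    rw [← hnorm]
    exact ENNReal.rpow_ne_top_of_nonneg hpp.le hf.2.ne
  have havg : ∀ i, ballAvg μ (A i) f = (∫⁻ y in A i, φ y ∂μ) / μ (A i) := fun i => by
    rw [ballAvg, lintegral_congr_ae (ae_restrict_of_ae hfφ)]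
  have hSm : Measurable fun x => ∑' i, (A i).indicator (fun _ => ballAvg μ (A i) f) x :=
    Measurable.tsum fun i => measurable_const.indicator (hAm i)
  rw [ENNReal.mul_rpow_of_nonneg _ _ hpp.le, hnorm, hν,
    lintegral_withDensity_eq_lintegral_mul _ hw'm (hSm.pow_const _)]
  refine le_trans (le_of_eq (lintegral_congr fun x => ?_)) (h.lintegral_tsum_rpow_le hA hF hFA hd
    hΓ hpair hp hw.apConst_lt_top.ne hφ hfin)
  rw [Pi.mul_apply, mul_comm]
  simp_rw [havg]

end IsBallBasis

/-- For $p\le2$ this is $(2-p)(p+1)\ge0$, for $p\ge2$ it is $(p-2)(2p-1)\ge0$. -/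
theorem div_sub_one_le_max {p : ℝ} (hp : 1 < p) :
    p / (p - 1) ≤ max ((p + 2) / (p * (p - 1))) ((3 * p - 2) / p) := by
  have hp0 : 0 < p - 1 := by linarith
  have hpp : 0 < p := by linarith
  rcases le_total p 2 with h2 | h2
  · refine le_max_of_le_left ?_
    rw [div_le_div_iff₀ hp0 (by positivity)]
    nlinarith [mul_nonneg hp0.le (mul_nonneg (sub_nonneg.2 h2) (by linarith : 0 ≤ p + 1))]
  · refine le_max_of_le_right ?_
    rw [div_le_div_iff₀ hp0 hpp]
    nlinarith [mul_nonneg (sub_nonneg.2 h2) (by linarith : 0 ≤ 2 * p - 1)]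

/-- The constant `c(p, K)`. -/
noncomputable def weightedConst (p : ℝ) (K : ℝ≥0) : ℝ≥0 :=
  (1 + 2 * K ^ 3 * domConst K) * (sparseConst K p).toNNReal

theorem mainTheorem4 (p : ℝ) (hp : 1 < p) (K : ℝ≥0) :
    ∃ c : ℝ≥0, ∀ (X : Type*) [MeasurableSpace X] (μ : Measure X)
      (𝓑 : Set (Set X)) (hull : Set X → Set X), IsBallBasis μ K 𝓑 hull →
      ∀ w : X → ℝ≥0∞, IsApWeight μ 𝓑 p w →
        (∀ γ : ℝ, 0 < γ → γ < 1 → ∀ 𝓢 : Set (Set X), IsSparse μ 𝓑 γ 𝓢 →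
          opLpNorm (μ.withDensity w) p univ (sparseOp μ 𝓢) ≤
            (c : ℝ≥0∞) * ENNReal.ofReal γ⁻¹ *
              apConst μ 𝓑 p w ^ max ((p + 2) / (p * (p - 1))) ((3 * p - 2) / p)) ∧
        (∀ T : (X → ℝ) → (X → ℝ), IsBO μ 𝓑 hull T → weakOneNorm μ T < ∞ →
          opLpNorm (μ.withDensity w) p {f | Integrable f μ} (fun f x => ‖T f x‖ₑ) ≤
            (c : ℝ≥0∞) * (locConst μ 𝓑 hull T + connConst μ 𝓑 hull T + weakOneNorm μ T) *
              apConst μ 𝓑 p w ^ max ((p + 2) / (p * (p - 1))) ((3 * p - 2) / p)) := by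
  refine ⟨weightedConst p K, fun X _ μ 𝓑 hull h w hw => ?_⟩
  have hpp : 0 < p := by linarith
  have hsf := h.sigmaFinite
  have hνsf : SigmaFinite (μ.withDensity w) :=
    SigmaFinite.withDensity_of_ne_top (hw.pos_lt_top.mono fun x hx => hx.2.ne)
  -- An empty space has no balls, and then the characteristic is 0 rather than at least 1.
  rcases isEmpty_or_nonempty X with hX | hX
  · have h0 : ∀ g : X → ℝ≥0∞, outerLpNorm (μ.withDensity w) p g = 0 := fun g =>
      outerLpNorm_eq_zero hpp (Filter.Eventually.of_forall fun x => isEmptyElim x)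
    constructor
    · intro γ _ _ 𝓢 _
      exact iSup₂_le fun f _ => iSup_le fun _ => by rw [h0, ENNReal.zero_div]; exact bot_le
    · intro T _ _
      exact iSup₂_le fun f _ => iSup_le fun _ => by rw [h0, ENNReal.zero_div]; exact bot_le
  set e := max ((p + 2) / (p * (p - 1))) ((3 * p - 2) / p) with he
  set Q := apConst μ 𝓑 p w with hQ
  have hQe : Q ^ (p / (p - 1)) ≤ Q ^ e := by
    obtain ⟨B, hB, -⟩ := h.exists_ball hX.some hX.some
    obtain ⟨w', σ, -, hpair⟩ := h.exists_isApPair hp hw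
    exact ENNReal.rpow_le_rpow_of_exponent_le (h.one_le_of_isApPair hp hpair hB)
      (div_sub_one_le_max hp)
  have hcs : ((sparseConst K p).toNNReal : ℝ≥0∞) = sparseConst K p :=
    ENNReal.coe_toNNReal (sparseConst_ne_top K hp)
  have hc : (weightedConst p K : ℝ≥0∞) = (1 + 2 * K ^ 3 * domConst K) * sparseConst K p := by
    rw [weightedConst]
    push_cast
    rw [hcs]
  constructor
  · intro γ hγ _ 𝓢 hS
    obtain ⟨hS𝓑, E, hE, hd⟩ := hS
    have hcount : 𝓢.Countable := h.countable_of_pairwiseDisjoint (fun B hB => (hE B hB).1)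
      (fun B hB => lt_of_lt_of_le (ENNReal.mul_pos (ENNReal.ofReal_pos.2 hγ).ne'
        (h.measure_pos B (hS𝓑 hB)).ne') (hE B hB).2.2) hd
    have : Countable 𝓢 := hcount.to_subtype
    refine iSup₂_le fun f _ => iSup_le fun hf => ENNReal.div_le_of_le_mul ?_
    have hSm : Measurable (sparseOp μ 𝓢 f) := Measurable.tsum fun i =>
      measurable_const.indicator (h.measurableSet _ (hS𝓑 i.2))
    refine (outerLpNorm_le hpp hSm (Filter.Eventually.of_forall fun _ => le_rfl)).trans ?_
    have h1 := h.lintegral_tsum_ballAvg_rpow_le hp hw (ι := 𝓢) (A := fun B => B)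
      (F := fun B => E B) (Γ := ENNReal.ofReal γ⁻¹) (fun B => hS𝓑 B.2) (fun B => (hE B B.2).1)
      (fun B => (hE B B.2).2.1) (fun B B' hne => hd B.2 B'.2 fun h => hne (Subtype.ext h))
      (fun B => by
        refine le_trans (le_of_eq ?_) (mul_le_mul_right (hE B B.2).2.2 _)
        rw [← mul_assoc, ← ENNReal.ofReal_mul (by positivity), inv_mul_cancel₀ hγ.ne',
          ENNReal.ofReal_one, one_mul]) hf
    refine (ENNReal.rpow_le_rpow h1 (by positivity)).trans ?_
    rw [← ENNReal.rpow_mul, mul_one_div_cancel hpp.ne', ENNReal.rpow_one]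
    refine mul_le_mul_left ?_ _
    calc ENNReal.ofReal γ⁻¹ * Q ^ (p / (p - 1)) * sparseConst K p
        ≤ ENNReal.ofReal γ⁻¹ * Q ^ e * (weightedConst p K : ℝ≥0∞) := by
          gcongr
          rw [hc]
          exact le_mul_of_one_le_left' le_self_add
      _ = _ := by ring
  · intro T hT hTw
    refine iSup₂_le fun f (hf : Integrable f μ) => iSup_le fun hfp => ENNReal.div_le_of_le_mul ?_
    -- Otherwise the sum `L` strictly exceeds the connectivity constant, as the choice of larger
    -- balls requires.
    by_cases hW0 : weakOneNorm μ T = 0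
    · have h1 := IsSubadditiveOp.measure_lt_eq_zero hTw.ne hf (Or.inl hW0)
      rw [outerLpNorm_eq_zero hpp ((withDensity_absolutelyContinuous μ w).ae_le
        (show ∀ᵐ x ∂μ, ‖T f x‖ₑ = 0 by simpa [ae_iff, pos_iff_ne_zero] using h1))]
      exact bot_le
    set L := locConst μ 𝓑 hull T + connConst μ 𝓑 hull T + weakOneNorm μ T with hL
    have hL1 : locConst μ 𝓑 hull T ≤ L := by rw [hL, add_assoc]; exact le_self_add
    have hL2 : connConst μ 𝓑 hull T < L := by
      rw [hL, add_assoc, add_comm]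
      exact (ENNReal.lt_add_right hT.connectivity.ne hW0).trans_le le_self_add
    have hLW : weakOneNorm μ T ≤ L := le_add_self
    have hLt : L ≠ ∞ := ENNReal.add_ne_top.2
      ⟨ENNReal.add_ne_top.2 ⟨hT.localization.ne, hT.connectivity.ne⟩, hTw.ne⟩
    obtain ⟨A, hA, hAx⟩ := h.exists_exhausting_seq
    -- The points that lie in all hulls from index `k` on: an increasing exhaustion of $X$ even if
    -- the hulls are not nested.
    set W : ℕ → Set X := fun k => ⋂ j ≥ k, hull (A j) with hWdef
    have hWm : ∀ k, MeasurableSet (W k) := fun k => MeasurableSet.biInter (to_countable _)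
      fun j _ => h.measurableSet _ (h.hull_mem _ (hA j))
    have hWmono : Monotone W := fun i j hij => biInter_subset_biInter_left fun k hk => hij.trans hk
    have hWu : ⋃ k, W k = univ := eq_univ_of_forall fun x => by
      obtain ⟨k, hk⟩ := Filter.eventually_atTop.1 (hAx x)
      exact mem_iUnion.2 ⟨k, mem_iInter₂.2 hk⟩
    have hWhull : ∀ k, W k ⊆ hull (A k) := fun k => biInter_subset_of_mem (le_refl k)
    -- Continuity of $|f|\,d\mu$ along the exhaustion puts half of the mass of $f$ in the triple
    -- hulls from some index on.
    obtain ⟨k₀, hk₀⟩ : ∃ k₀, ∀ k ≥ k₀, ∫⁻ x, ‖f x‖ₑ ∂μ ≤ 2 * ∫⁻ x in hull^[3] (A k), ‖f x‖ₑ ∂μ := by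
      set ρ := μ.withDensity fun x => ‖f x‖ₑ with hρ
      have hρu : ρ univ = ∫⁻ x, ‖f x‖ₑ ∂μ := by
        rw [hρ, withDensity_apply _ MeasurableSet.univ, setLIntegral_univ]
      have hft : ρ univ ≠ ∞ := hρu ▸ hf.2.ne
      by_cases hf0 : ρ univ = 0
      · exact ⟨0, fun k _ => by rw [← hρu, hf0]; exact bot_le⟩
      have hlim := tendsto_measure_iUnion_atTop (μ := ρ) hWmono
      rw [hWu] at hlim
      obtain ⟨k₀, hk₀⟩ := Filter.eventually_atTop.1
        (hlim.eventually_const_lt (ENNReal.half_lt_self hf0 hft))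
      refine ⟨k₀, fun k hk => ?_⟩
      have h1 : ρ univ / 2 ≤ ∫⁻ x in hull^[3] (A k), ‖f x‖ₑ ∂μ := by
        rw [← withDensity_apply _ (h.measurableSet _ (h.iterate_hull_mem (hA k) 3))]
        refine (hk₀ k hk).le.trans (measure_mono ((hWhull k).trans ?_))
        exact h.subset_iterate_hull (h.hull_mem _ (hA k)) 2
      rw [← hρu]
      rwa [ENNReal.div_le_iff_le_mul (by simp) (by simp), mul_comm] at h1
    set N := eLpNorm f (ENNReal.ofReal p) (μ.withDensity w) with hN
    set D : ℝ≥0∞ := domConst K * L with hD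
    set P : ℝ≥0∞ := 2 * K ^ 3 * Q ^ (p / (p - 1)) * sparseConst K p * N with hP
    have hmain := outerLpNorm_le_of_exhaustion (ν := μ.withDensity w) hpp
      (fun x => ‖T f x‖ₑ) (fun k => W (k + k₀)) (fun i j hij => hWmono (by omega))
      (by rw [← hWu]; exact hWmono.iUnion_nat_add k₀) (M := (D * P) ^ p) (fun k => by
        obtain ⟨I, Y, F, hY, hFm, hFY, hFd, hF, hdom⟩ := h.exists_sparse_domination
          hT.subadditive hL1 hL2 hLW hLt hf (hA (k + k₀)) (hk₀ _ (by omega))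
        have hSm : Measurable fun x => ∑' i, (Y i).indicator (fun _ => ballAvg μ (Y i) f) x :=
          Measurable.tsum fun i => measurable_const.indicator (h.measurableSet _ (hY i))
        refine ⟨fun x => D * ∑' i, (Y i).indicator (fun _ => ballAvg μ (Y i) f) x,
          hSm.const_mul _, ?_, ?_⟩
        · filter_upwards [(withDensity_absolutelyContinuous μ w).ae_le hdom] with x hx hxW
          exact hx (hWhull _ hxW)
        · simp_rw [ENNReal.mul_rpow_of_nonneg _ _ hpp.le]
          rw [lintegral_const_mul _ (hSm.pow_const _)]
          exact mul_le_mul_right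
            (h.lintegral_tsum_ballAvg_rpow_le hp hw hY hFm hFY hFd hF hfp) _)
    rw [← ENNReal.rpow_mul, mul_one_div_cancel hpp.ne', ENNReal.rpow_one] at hmain
    refine hmain.trans ?_
    calc D * P = (2 * K ^ 3 * domConst K * sparseConst K p) * L * Q ^ (p / (p - 1)) * N := by
          rw [hD, hP]; ring
      _ ≤ (weightedConst p K : ℝ≥0∞) * L * Q ^ e * N := by
          gcongr
          rw [hc]
          gcongr
          exact le_add_self
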